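/- **Setting.** Let $d\ge 1$, $N\ge 2$, $\kappa\in\{1,-1\}$, $\beta\in(0,1)$, let $V\in C_c^\infty(\mathbb R^d)$ be even and nonnegative with $\int V=1$, and put $V_N=N^{d\beta}V(N^{d\beta}\,\cdot\,)$. Let $\mathcal S_s(\mathbb R^{dk})$ be the Schwartz functions on $\mathbb R^{dk}$ that are symmetric under permutations of the $k$ particles, and $\mathcal S_s'(\mathbb R^{dk})$ the symmetric tempered distributions with the strong topology. Spaces $\mathcal L(\cdot,\cdot)$ of continuous linear maps carry the topology of bounded convergence. *Observables.* $\mathfrak g_k$ is the real space of $A\in\mathcal L(\mathcal S_s(\mathbb R^{dk}),\mathcal S_s(\mathbb R^{dk}))$ with $\langle Af,g\rangle_{L^2}=-\langle f,Ag\rangle_{L^2}$ for all $f,g$, with bracket $[A,B]_{\mathfrak g_k}=k(AB-BA)$. For $1\le k\le N$ let $\epsilon_{k,N}:\mathfrak g_k\to\mathfrak g_N$, $\epsilon_{k,N}(A)=\frac{(N-k)!}{N!}\sum A_{(j_1,\dots,j_k)}$, the sum being over all $k$-tuples of distinct elements of $\{1,\dots,N\}$ and $A_{(j_1,\dots,j_k)}$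 denoting $A$ acting in the variables $x_{j_1},\dots,x_{j_k}$; these maps are injective. On $\mathfrak G_N=\bigoplus_{k=1}^N\mathfrak g_k$ put $$[A,B]_{\mathfrak G_N}^{(k)}=\sum_{\substack{1\le \ell,j\le N\\ \min\{\ell+j-1,N\}=k}}\epsilon_{k,N}^{-1}\bigl([\epsilon_{\ell,N}(A^{(\ell)}),\epsilon_{j,N}(B^{(j)})]_{\mathfrak g_N}\bigr).$$ *Density matrices.* $\mathfrak G_N^*$ is the real topological vector space of all $\Gamma=(\gamma^{(k)})_{k=1}^N\in\prod_{k=1}^N\mathcal L(\mathcal S_s'(\mathbb R^{dk}),\mathcal S_s(\mathbb R^{dk}))$ with every $\gamma^{(k)}$ self-adjoint. $\mathrm{Tr}_{1,\dots,k}$ is the integral of the Schwartz kernel over the diagonal; $\mathrm{Tr}_{k+1}\gamma^{(k+1)}$ is the operator with kernel $\int\gamma^{(k+1)}(\underline x_k,y;\underline x_k',y)\,dy$; and $\mathrm{Tr}(A\cdot\Gamma)=\sum_{k=1}^N\mathrm{Tr}_{1,\dots,k}(A^{(k)}\gamma^{(k)})$. *Poisson structure.* $\mathcal A_{H,N}$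 is the algebra of functionals $\mathfrak G_N^*\to\mathbb R$ generated by the constants and the smooth functionals $\Gamma\mapsto i\,\mathrm{Tr}(A\cdot\Gamma)$, $A\in\mathfrak G_N$. For $F\in\mathcal A_{H,N}$, the derivative of $F$ at $\Gamma$ is identified with the element $dF[\Gamma]\in\mathfrak G_N$ such that $\frac{d}{ds}\big|_{s=0}F(\Gamma+s\,\delta\Gamma)=i\,\mathrm{Tr}(dF[\Gamma]\cdot\delta\Gamma)$ for all $\delta\Gamma\in\mathfrak G_N^*$, and $$\{F,G\}(\Gamma)=i\,\mathrm{Tr}\bigl([dF[\Gamma],dG[\Gamma]]_{\mathfrak G_N}\cdot\Gamma\bigr).$$ A Hamiltonian vector field of $H\in\mathcal A_{H,N}$ is a smooth map $X_H:\mathfrak G_N^*\to\mathfrak G_N^*$ with $\frac{d}{ds}\big|_{s=0}F(\Gamma+sX_H(\Gamma))=\{F,H\}(\Gamma)$ for all $F\in\mathcal A_{H,N}$ and $\Gamma\in\mathfrak G_N^*$. *BBGKY.* Let $\mathcal H_{BBGKY,N}(\Gamma)=\mathrm{Tr}(\mathbf W_{BBGKY,N}\cdot\Gamma)$ with $\mathbf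 W_{BBGKY,N}=(-\Delta_{x_1},\kappa V_N(X_1-X_2),0,\dots,0)$, where $V_N(X_i-X_j)$ is multiplication by $V_N(x_i-x_j)$. The quantum BBGKY hierarchy is, for $1\le k\le N$, $$i\partial_t\gamma^{(k)}=\Bigl[-\sum_{j=1}^k\Delta_{x_j},\gamma^{(k)}\Bigr]+\frac{2\kappa}{N-1}\sum_{1\le i<j\le k}\bigl[V_N(X_i-X_j),\gamma^{(k)}\bigr]+\frac{2\kappa(N-k)}{N-1}\sum_{i=1}^k\mathrm{Tr}_{k+1}\bigl(\bigl[V_N(X_i-X_{k+1}),\gamma^{(k+1)}\bigr]\bigr),$$ where the last term is absent for $k=N$. **Theorem.** The functional $\mathcal H_{BBGKY,N}$ is real valued and belongs to $\mathcal A_{H,N}$, and it has exactly one Hamiltonian vector field $X_{\mathcal H_{BBGKY,N}}$. Let $I=[a,b]$ with $a<b$, and let $\Gamma_N=(\gamma_N^{(k)})_{k=1}^N\in C^\infty(I;\mathfrak G_N^*)$ be such that the $\gamma_N^{(k)}$ with $k\ge 2$ are reduced density matrices of one another: $\gamma_N^{(k)}(t)=\mathrm{Tr}_{k+1}\gamma_N^{(k+1)}(t)$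 for all $t\in I$ and $2\le k<N$ (no condition if $N=2$). Then $\Gamma_N$ solves the quantum BBGKY hierarchy on $I$ if and only if $$\frac{d}{dt}\Gamma_N(t)=X_{\mathcal H_{BBGKY,N}}(\Gamma_N(t))\qquad\text{for all }t\in I.$$ -/

import Mathlib

open scoped SchwartzMap Topology ContDiff

noncomputable section

/-! ### Calculus on real topological vector spaces -/

/-- Smooth maps between real topological vector spaces, through iterated Gateaux derivatives:
`D n x v` is the `n`-th derivative at `x` in the directions `v 0, …, v (n - 1)`; all of these
exist and are jointly continuous in the point and the directions. -/
def GateauxSmooth {X Y : Type*} [AddCommGroup X] [Module ℝ X] [TopologicalSpace X]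
    [AddCommGroup Y] [Module ℝ Y] [TopologicalSpace Y] (f : X → Y) : Prop :=
  ∃ D : (n : ℕ) → X → (Fin n → X) → Y,
    (∀ x v, D 0 x v = f x) ∧
    (∀ n, Continuous fun p : X × (Fin n → X) => D n p.1 p.2) ∧
    ∀ (n : ℕ) (x : X) (v : Fin n → X) (w : X),
      Filter.Tendsto (fun s : ℝ => s⁻¹ • (D n (x + s • w) v - D n x v)) (𝓝[≠] 0)
        (𝓝 (D (n + 1) x (Fin.snoc v w)))

/-- `v` is the derivative at time `t` of the curve `c` restricted to `I` (one-sided at the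
endpoints when `I` is a compact interval). -/
def HasCurveDerivAt {X : Type*} [AddCommGroup X] [Module ℝ X] [TopologicalSpace X]
    (I : Set ℝ) (c : ℝ → X) (v : X) (t : ℝ) : Prop :=
  Filter.Tendsto (fun s : ℝ => (s - t)⁻¹ • (c s - c t)) (𝓝[I \ {t}] t) (𝓝 v)

/-- The curve `c` is of class `C^∞` on `I`: `D n` is its `n`-th derivative on `I`. -/
def SmoothCurveOn {X : Type*} [AddCommGroup X] [Module ℝ X] [TopologicalSpace X]
    (I : Set ℝ) (c : ℝ → X) : Prop :=
  ∃ D : ℕ → ℝ → X, (∀ t ∈ I, D 0 t = c t) ∧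
    (∀ n, ContinuousOn (D n) I) ∧
    ∀ n, ∀ t ∈ I, HasCurveDerivAt I (D n) (D (n + 1) t) t

/-! ### Schwartz functions of `k` particles in `ℝ^d` -/

/-- Configurations `(x_1, …, x_k)` of `k` particles in `ℝ^d`. The norm (a maximum of Euclidean
norms) only serves to define Schwartz functions; the volume is Lebesgue measure on `ℝ^{dk}`. -/
abbrev Cfg (d k : ℕ) : Type := Fin k → EuclideanSpace ℝ (Fin d)

instance instCfgHaar (d k : ℕ) :
    (MeasureTheory.volume : MeasureTheory.Measure (Cfg d k)).IsAddHaarMeasure :=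
  inferInstanceAs ((MeasureTheory.Measure.pi fun _ : Fin k =>
    (MeasureTheory.volume : MeasureTheory.Measure (EuclideanSpace ℝ (Fin d)))).IsAddHaarMeasure)

/-- The Schwartz space `𝓢(ℝ^{dk})`. -/
abbrev Sch (d k : ℕ) : Type := 𝓢(Cfg d k, ℂ)

/-- Tempered distributions with the strong topology (uniform convergence on bounded sets). -/
abbrev SchDual (d k : ℕ) : Type := Sch d k →L[ℂ] ℂ

/-- The bosonic Schwartz space `𝓢_s(ℝ^{dk})`, with the subspace topology. -/
def symSch (d k : ℕ) : Submodule ℂ (Sch d k) where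
  carrier := {f | ∀ (π : Equiv.Perm (Fin k)) (x : Cfg d k), f (fun i => x (π i)) = f x}
  add_mem' := by
    intro f g hf hg π x
    simp [hf π x, hg π x]
  zero_mem' := by
    intro π x
    simp
  smul_mem' := by
    intro c f hf π x
    simp [hf π x]

/-- `𝓢_s(ℝ^{dk})` as a type. -/
abbrev BSch (d k : ℕ) : Type := ↥(symSch d k)

instance instBSchConstSMul (d k : ℕ) : ContinuousConstSMul ℝ (BSch d k) :=
  ⟨fun c => by
    refine Continuous.subtype_mk (f := fun f : BSch d k => c • (f : Sch d k)) ?_ ?_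
    exact continuous_subtype_val.const_smul c⟩

/-- Symmetric tempered distributions with the strong topology, as the dual of the bosonic
Schwartz space: a symmetric distribution on `ℝ^{dk}` is the same as a continuous functional on
`𝓢_s(ℝ^{dk})` (restrict it, respectively compose with the symmetrization). -/
abbrev BSchDual (d k : ℕ) : Type := BSch d k →L[ℂ] ℂ

/-- The `L²` inner product, linear in the second entry. -/
def l2inner {d k : ℕ} (f g : Sch d k) : ℂ := ∫ x, (starRingEnd ℂ) (f x) * g x

/-- A bosonic Schwartz function `f` as the symmetric distribution `h ↦ ∫ f h`. -/
def toBDual {d k : ℕ} (f : BSch d k) : BSchDual d k :=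
  (SchwartzMap.integralCLM ℂ MeasureTheory.volume ∘L
    SchwartzMap.pairing (ContinuousLinearMap.mul ℂ ℂ) (f : Sch d k)) ∘L (symSch d k).subtypeL

/-- The Dirac mass at `x`. -/
def diracAt {d k : ℕ} (x : Cfg d k) : SchDual d k :=
  BoundedContinuousFunction.evalCLM ℂ x ∘L
    SchwartzMap.toBoundedContinuousFunctionCLM ℂ (Cfg d k) ℂ

/-! ### Operators with Schwartz kernel, trace, partial trace, commutators -/

/-- `𝓛(𝓢'(ℝ^{dk}), 𝓢(ℝ^{dk}))` with the topology of bounded convergence. -/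
abbrev SmoothOp (d k : ℕ) : Type := SchDual d k →L[ℂ] Sch d k

/-- `𝓛(𝓢_s'(ℝ^{dk}), 𝓢_s(ℝ^{dk}))` with the topology of bounded convergence. -/
abbrev BSmoothOp (d k : ℕ) : Type := BSchDual d k →L[ℂ] BSch d k

/-- An operator in `𝓛(𝓢_s', 𝓢_s)` regarded as an element of `𝓛(𝓢', 𝓢)`. -/
def BSmoothOp.toOp {d k : ℕ} (T : BSmoothOp d k) : SmoothOp d k :=
  (symSch d k).subtypeL ∘L T ∘L ContinuousLinearMap.precomp ℂ (symSch d k).subtypeL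

/-- The Schwartz kernel `K(x; x')` of an operator, `(T f)(x) = ∫ K(x; x') f(x') dx'`. -/
def SmoothOp.kernel {d k : ℕ} (T : SmoothOp d k) (x x' : Cfg d k) : ℂ := T (diracAt x') x

/-- The trace `Tr_{1,…,k}`: the integral of the kernel over the diagonal. -/
def SmoothOp.trace {d k : ℕ} (T : SmoothOp d k) : ℂ := ∫ x, T.kernel x x

/-- The partial trace `Tr_{k+1}`: the operator with kernel
`(x; x') ↦ ∫ K(x, y; x', y) dy`. -/
def SmoothOp.partialTrace {d k : ℕ} (T : SmoothOp d (k + 1)) : SmoothOp d k :=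
  Classical.epsilon fun R : SmoothOp d k =>
    ∀ x x' : Cfg d k, R.kernel x x' =
      ∫ y : EuclideanSpace ℝ (Fin d),
        T.kernel (Fin.snoc (α := fun _ => EuclideanSpace ℝ (Fin d)) x y)
          (Fin.snoc (α := fun _ => EuclideanSpace ℝ (Fin d)) x' y)

/-- The commutator `[B, T] = B T - T B` for an operator `B` on `𝓢` that is its own transpose for
the bilinear pairing `∫ f g` (such as a Laplacian or a multiplication operator), so that it is
extended to `𝓢'` by `u ↦ u ∘ B`. -/
def SmoothOp.commutator {d k : ℕ} (B : Sch d k →L[ℂ] Sch d k) (T : SmoothOp d k) :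
    SmoothOp d k :=
  B ∘L T - T ∘L ContinuousLinearMap.precomp ℂ B

/-- The Laplacian `Δ_{x_j}` in the position of the `j`-th particle. -/
def laplacianAt (d k : ℕ) (j : Fin k) : Sch d k →L[ℂ] Sch d k :=
  ∑ a : Fin d,
    LineDeriv.lineDerivOpCLM ℂ (Sch d k) (Pi.single j (EuclideanSpace.single a (1 : ℝ)) : Cfg d k) ∘L
      LineDeriv.lineDerivOpCLM ℂ (Sch d k) (Pi.single j (EuclideanSpace.single a (1 : ℝ)) : Cfg d k)

/-- The Laplacian `Δ_{x_1} + … + Δ_{x_k}`. -/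
def totalLaplacian (d k : ℕ) : Sch d k →L[ℂ] Sch d k := ∑ j, laplacianAt d k j

/-- Multiplication by `U(x_i - x_j)`. -/
def pairMul {d : ℕ} (U : EuclideanSpace ℝ (Fin d) → ℝ) {k : ℕ} (i j : Fin k) :
    Sch d k →L[ℂ] Sch d k :=
  SchwartzMap.smulLeftCLM ℂ fun x : Cfg d k => ((U (x i - x j) : ℝ) : ℂ)

/-- The rescaled potential `V_N = N^{dβ} V(N^{dβ} ·)`. -/
def scaledPotential {d : ℕ} (V : EuclideanSpace ℝ (Fin d) → ℝ) (β : ℝ) (N : ℕ) :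
    EuclideanSpace ℝ (Fin d) → ℝ :=
  fun x => (N : ℝ) ^ ((d : ℝ) * β) * V ((N : ℝ) ^ ((d : ℝ) * β) • x)

/-! ### Observables: the Lie algebra of observable `N`-hierarchies -/

theorem l2inner_integrable {d k : ℕ} (f g : Sch d k) :
    MeasureTheory.Integrable (fun x => (starRingEnd ℂ) (f x) * g x) := by
  have h : MeasureTheory.MemLp (fun x => f x) 2 := f.memLp 2
  have h2 : MeasureTheory.MemLp (fun x => g x) 2 := g.memLp 2
  exact MeasureTheory.MemLp.integrable_mul h.star h2

theorem l2inner_add_left {d k : ℕ} (f f' g : Sch d k) :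
    l2inner (f + f') g = l2inner f g + l2inner f' g := by
  simp only [l2inner, add_apply, map_add, add_mul]
  exact MeasureTheory.integral_add (l2inner_integrable f g) (l2inner_integrable f' g)

theorem l2inner_add_right {d k : ℕ} (f g g' : Sch d k) :
    l2inner f (g + g') = l2inner f g + l2inner f g' := by
  simp only [l2inner, add_apply, mul_add]
  exact MeasureTheory.integral_add (l2inner_integrable f g) (l2inner_integrable f g')

theorem l2inner_smul_left {d k : ℕ} (c : ℝ) (f g : Sch d k) :
    l2inner (c • f) g = c * l2inner f g := by
  simp only [l2inner, smul_apply, Complex.real_smul, map_mul, Complex.conj_ofReal,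
    mul_assoc]
  exact MeasureTheory.integral_const_mul _ _

theorem l2inner_smul_right {d k : ℕ} (c : ℝ) (f g : Sch d k) :
    l2inner f (c • g) = c * l2inner f g := by
  simp only [l2inner, smul_apply, Complex.real_smul, mul_left_comm]
  exact MeasureTheory.integral_const_mul _ _

/-- `𝔤_k`: the skew-adjoint elements of `𝓛(𝓢_s(ℝ^{dk}), 𝓢_s(ℝ^{dk}))`. -/
def observables (d k : ℕ) : Submodule ℝ (BSch d k →L[ℂ] BSch d k) where
  carrier := {A | ∀ f g : BSch d k, l2inner (A f : Sch d k) g = -l2inner (f : Sch d k) (A g)}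
  add_mem' := by
    intro A B hA hB f g
    have h1 : ((A + B) f : Sch d k) = (A f : Sch d k) + (B f : Sch d k) := rfl
    have h2 : ((A + B) g : Sch d k) = (A g : Sch d k) + (B g : Sch d k) := rfl
    rw [h1, h2, l2inner_add_left, l2inner_add_right, hA f g, hB f g]
    ring
  zero_mem' := by
    intro f g
    simp [l2inner]
  smul_mem' := by
    intro c A hA f g
    have h1 : ((c • A) f : Sch d k) = c • (A f : Sch d k) := rfl
    have h2 : ((c • A) g : Sch d k) = c • (A g : Sch d k) := rfl
    rw [h1, h2, l2inner_smul_left, l2inner_smul_right, hA f g]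
    ring

/-- `𝔤_k` as a type. -/
abbrev Obs (d k : ℕ) : Type := ↥(observables d k)

/-- The Lie bracket `[A, B]_{𝔤_k} = k (A B - B A)`. -/
def obsBracket {d k : ℕ} (A B : Obs d k) : Obs d k :=
  k • (⟨A.1 ∘L B.1 - B.1 ∘L A.1, by
    intro f g
    have h1 : ((A.1 ∘L B.1 - B.1 ∘L A.1) f : Sch d k)
        = (A.1 (B.1 f) : Sch d k) + (-1 : ℝ) • (B.1 (A.1 f) : Sch d k) := by
      simp [sub_eq_add_neg]
    have h2 : ((A.1 ∘L B.1 - B.1 ∘L A.1) g : Sch d k)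
        = (A.1 (B.1 g) : Sch d k) + (-1 : ℝ) • (B.1 (A.1 g) : Sch d k) := by
      simp [sub_eq_add_neg]
    rw [h1, h2, l2inner_add_left, l2inner_add_right, l2inner_smul_left, l2inner_smul_right,
      A.2 (B.1 f) g, B.2 f (A.1 g), B.2 (A.1 f) g, A.2 f (B.1 g)]
    push_cast
    ring⟩ : Obs d k)

theorem extend_hasTemperateGrowth {d k N : ℕ} (x : Cfg d N) (j : Fin k ↪ Fin N) :
    (fun y : Cfg d k => (Function.extend j y x : Cfg d N)).HasTemperateGrowth := by
  classical
  let L : Cfg d k →L[ℝ] Cfg d N := ContinuousLinearMap.pi fun i =>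
    if h : ∃ a, j a = i then ContinuousLinearMap.proj (Classical.choose h) else 0
  have h : (fun y : Cfg d k => (Function.extend j y x : Cfg d N)) =
      fun y => L y + (Function.extend j (0 : Cfg d k) x : Cfg d N) := by
    funext y i
    by_cases h : ∃ a, j a = i
    · obtain ⟨a, rfl⟩ := h
      have h' : ∃ a', j a' = j a := ⟨a, rfl⟩
      have h2 : Classical.choose h' = a := j.injective (Classical.choose_spec h')
      simp only [Pi.add_apply, j.injective.extend_apply, Pi.zero_apply, add_zero, L,
        ContinuousLinearMap.pi_apply, dif_pos h', ContinuousLinearMap.proj_apply, h2]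
    · simp [Function.extend_apply' _ _ _ h, L, dif_neg h]
  rw [h]
  fun_prop

theorem extend_antilipschitz {d k N : ℕ} (x : Cfg d N) (j : Fin k ↪ Fin N) :
    AntilipschitzWith 1 fun y : Cfg d k => (Function.extend j y x : Cfg d N) := by
  refine AntilipschitzWith.of_le_mul_dist fun y y' => ?_
  simp only [NNReal.coe_one, one_mul]
  refine (dist_pi_le_iff dist_nonneg).2 fun a => ?_
  have h := dist_le_pi_dist (Function.extend j y x : Cfg d N) (Function.extend j y' x) (j a)
  simpa only [j.injective.extend_apply] using h

/-- For distinct `j_1, …, j_k` in `{1, …, N}` and `x ∈ ℝ^{dN}`, the function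
`y ↦ f(x with x_{j_1}, …, x_{j_k} replaced by y_1, …, y_k)` on `ℝ^{dk}`. -/
def slice {d k N : ℕ} (f : BSch d N) (x : Cfg d N) (j : Fin k ↪ Fin N) : BSch d k :=
  ⟨SchwartzMap.compCLMOfAntilipschitz ℂ (extend_hasTemperateGrowth x j)
      (extend_antilipschitz x j) (f : Sch d N), by
    intro π y
    have h : (Function.extend j (fun i => y (π i)) x : Cfg d N) =
        fun i => (Function.extend j y x : Cfg d N) (π.viaEmbedding j i) := by
      funext i
      by_cases h : ∃ a, j a = i
      · obtain ⟨a, rfl⟩ := h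
        rw [Equiv.Perm.viaEmbedding_apply, j.injective.extend_apply, j.injective.extend_apply]
      · rw [Equiv.Perm.viaEmbedding_apply_of_notMem, Function.extend_apply' _ _ _ h,
          Function.extend_apply' _ _ _ h]
        simpa using h
    change (f : Sch d N) (Function.extend j (fun i => y (π i)) x) =
      (f : Sch d N) (Function.extend j y x)
    rw [h, f.2]⟩

/-- `ε_{k,N}`: the operator `(N! / (N - k)!)⁻¹ ∑ A_{(j_1, …, j_k)}`, the sum over all tuples of
distinct particle labels, where `A_{(j_1, …, j_k)}` is `A` acting in the variables
`x_{j_1}, …, x_{j_k}`, the other variables being frozen. -/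
def eps {d : ℕ} (k N : ℕ) (A : Obs d k) : Obs d N :=
  Classical.epsilon fun B : Obs d N =>
    ∀ (f : BSch d N) (x : Cfg d N),
      (B.1 f : Sch d N) x = ((N.descFactorial k : ℕ) : ℂ)⁻¹ *
        ∑ j : Fin k ↪ Fin N, (A.1 (slice f x j) : Sch d k) fun i => x (j i)

/-- The inverse of the injective map `ε_{k,N}` on its image. -/
def epsInv {d : ℕ} (k N : ℕ) : Obs d N → Obs d k := Function.invFun (eps k N)

/-- The particle numbers `1, …, N`. -/
abbrev Idx (N : ℕ) : Type := ↥(Finset.Icc 1 N)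

/-- `𝔊_N`: observable `N`-hierarchies `A = (A^{(1)}, …, A^{(N)})`, `A^{(k)} ∈ 𝔤_k`. -/
abbrev ObsHier (d N : ℕ) : Type := (k : Idx N) → Obs d k

/-- The Lie bracket of `𝔊_N`:
`[A, B]^{(k)} = ∑_{min (ℓ + j - 1, N) = k} ε_{k,N}⁻¹ [ε_{ℓ,N} A^{(ℓ)}, ε_{j,N} B^{(j)}]`. -/
def hierBracket {d N : ℕ} (A B : ObsHier d N) : ObsHier d N := fun k =>
  ∑ p : Idx N × Idx N with min ((p.1 : ℕ) + (p.2 : ℕ) - 1) N = (k : ℕ),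
    epsInv (k : ℕ) N (obsBracket (eps (p.1 : ℕ) N (A p.1)) (eps (p.2 : ℕ) N (B p.2)))

/-! ### Density matrix hierarchies and their weak Lie-Poisson structure -/

instance instBSmoothOpAddCommGroup (d k : ℕ) : AddCommGroup (BSmoothOp d k) :=
  ContinuousLinearMap.addCommGroup

instance instBSmoothOpModule (d k : ℕ) : Module ℝ (BSmoothOp d k) := ContinuousLinearMap.module

/-- `𝔤_k^*`: the self-adjoint elements of `𝓛(𝓢_s'(ℝ^{dk}), 𝓢_s(ℝ^{dk}))`. -/
def densityMatrices (d k : ℕ) : Submodule ℝ (BSmoothOp d k) where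
  carrier := {γ | ∀ f g : BSch d k,
    l2inner (γ (toBDual f) : Sch d k) g = l2inner (f : Sch d k) (γ (toBDual g))}
  add_mem' := by
    intro A B hA hB f g
    have h1 : ((A + B) (toBDual f) : Sch d k) = (A (toBDual f) : Sch d k) + (B (toBDual f) : Sch d k) := rfl
    have h2 : ((A + B) (toBDual g) : Sch d k) = (A (toBDual g) : Sch d k) + (B (toBDual g) : Sch d k) := rfl
    rw [h1, h2, l2inner_add_left, l2inner_add_right, hA f g, hB f g]
  zero_mem' := by
    intro f g
    simp [l2inner]
  smul_mem' := by
    intro c A hA f g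
    have h1 : ((c • A) (toBDual f) : Sch d k) = c • (A (toBDual f) : Sch d k) := rfl
    have h2 : ((c • A) (toBDual g) : Sch d k) = c • (A (toBDual g) : Sch d k) := rfl
    rw [h1, h2, l2inner_smul_left, l2inner_smul_right, hA f g]

/-- `𝔤_k^*` as a type, with the subspace topology. -/
abbrev DM (d k : ℕ) : Type := ↥(densityMatrices d k)

instance instDMAddCommGroup (d k : ℕ) : AddCommGroup (DM d k) :=
  (densityMatrices d k).addCommGroup

instance instDMModule (d k : ℕ) : Module ℝ (DM d k) := (densityMatrices d k).module

/-- `𝔊_N^*`: density matrix `N`-hierarchies `Γ = (γ^{(1)}, …, γ^{(N)})`, `γ^{(k)} ∈ 𝔤_k^*`, with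
the product topology. -/
abbrev DMHier (d N : ℕ) : Type := (k : Idx N) → DM d k

instance instDMHierAddCommGroup (d N : ℕ) : AddCommGroup (DMHier d N) := Pi.addCommGroup

instance instDMHierModule (d N : ℕ) : Module ℝ (DMHier d N) := Pi.module _ _ _

instance instDMHierSMul (d N : ℕ) : SMul ℝ (DMHier d N) := (instDMHierModule d N).toSMul

/-- The pairing `Tr(A · Γ) = ∑_k Tr_{1,…,k}(A^{(k)} γ^{(k)})`. -/
def trPairing {d N : ℕ} (A : ObsHier d N) (Γ : DMHier d N) : ℂ :=
  ∑ k : Idx N, SmoothOp.trace (BSmoothOp.toOp ((A k).1 ∘L (Γ k).1))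

/-- The unital algebra `𝒜_{H,N}` of functionals on `𝔊_N^*` generated by the constants and the
smooth functionals `Γ ↦ i Tr(A · Γ)`, `A ∈ 𝔊_N`. -/
def admissible (d N : ℕ) : Subalgebra ℝ (DMHier d N → ℝ) :=
  Algebra.adjoin ℝ {F | GateauxSmooth F ∧
    ∃ A : ObsHier d N, ∀ Γ, ((F Γ : ℝ) : ℂ) = Complex.I * trPairing A Γ}

/-- The observable hierarchy `dF[Γ] ∈ 𝔊_N` that represents the derivative of `F` at `Γ`, that is,
the derivative of `F` at `Γ` in the direction `δ` is `i Tr(dF[Γ] · δ)`. -/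
def dmGradient {d N : ℕ} (F : DMHier d N → ℝ) (Γ : DMHier d N) : ObsHier d N :=
  Classical.epsilon fun A : ObsHier d N => ∀ δ : DMHier d N, ∃ F' : ℝ,
    HasDerivAt (fun s : ℝ => F (Γ + s • δ)) F' 0 ∧ (F' : ℂ) = Complex.I * trPairing A δ

/-- The Lie-Poisson bracket `{F, G}(Γ) = i Tr([dF[Γ], dG[Γ]] · Γ)` (a real number). -/
def poissonBracket {d N : ℕ} (F G : DMHier d N → ℝ) (Γ : DMHier d N) : ℝ :=
  (Complex.I * trPairing (hierBracket (dmGradient F Γ) (dmGradient G Γ)) Γ).re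

/-- `X` is the Hamiltonian vector field of `H`: it is smooth, and the derivative of every
`F ∈ 𝒜_{H,N}` along `X` is `{F, H}`. -/
def IsHamiltonianVectorField {d N : ℕ} (H : DMHier d N → ℝ) (X : DMHier d N → DMHier d N) :
    Prop :=
  GateauxSmooth X ∧ ∀ F ∈ admissible d N, ∀ Γ : DMHier d N,
    HasDerivAt (fun s : ℝ => F (Γ + s • X Γ)) (poissonBracket F H Γ) 0

/-! ### The BBGKY Hamiltonian and the BBGKY hierarchy -/

/-- The component `γ^{(k)}` of `Γ` as an operator on `𝓢'(ℝ^{dk})` (zero for `k` outside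
`1, …, N`). -/
def DMHier.op {d N : ℕ} (Γ : DMHier d N) (k : ℕ) : SmoothOp d k :=
  if hk : k ∈ Finset.Icc 1 N then BSmoothOp.toOp (Γ ⟨k, hk⟩).1 else 0

/-- `W_{BBGKY,N} = (-Δ_{x_1}, κ V_N(X_1 - X_2), 0, …, 0)`, for the pair potential `U = V_N`. -/
def bbgkyW {d : ℕ} (U : EuclideanSpace ℝ (Fin d) → ℝ) (κ : ℝ) : (k : ℕ) → Sch d k →L[ℂ] Sch d k
  | 1 => -totalLaplacian d 1
  | 2 => (κ : ℂ) • pairMul U 0 1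
  | _ => 0

/-- `Tr(W_{BBGKY,N} · Γ)`. -/
def bbgkyTrace {d N : ℕ} (U : EuclideanSpace ℝ (Fin d) → ℝ) (κ : ℝ) (Γ : DMHier d N) : ℂ :=
  ∑ k ∈ Finset.Icc 1 N, SmoothOp.trace (bbgkyW U κ k ∘L Γ.op k)

/-- The BBGKY Hamiltonian `H_{BBGKY,N}(Γ) = Tr(W_{BBGKY,N} · Γ)`, which is real. -/
def bbgkyHamiltonian {d N : ℕ} (U : EuclideanSpace ℝ (Fin d) → ℝ) (κ : ℝ) (Γ : DMHier d N) : ℝ :=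
  (bbgkyTrace U κ Γ).re

/-- The components of `Γ` of order at least two are reduced density matrices of one another:
`γ^{(k)} = Tr_{k+1} γ^{(k+1)}` for `2 ≤ k < N`. This holds if `γ^{(k)} = Tr_{k+1,…,N} γ^{(N)}` for
all `k < N`, and it is void for `N = 2`. -/
def IsReducedHierarchy {d N : ℕ} (Γ : DMHier d N) : Prop :=
  ∀ k, 2 ≤ k → k < N → Γ.op k = SmoothOp.partialTrace (Γ.op (k + 1))

/-- The right-hand side
`[-Δ, γ^{(k)}] + (2κ / (N - 1)) ∑_{1 ≤ i < j ≤ k} [U(X_i - X_j), γ^{(k)}]`. -/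
def bbgkyInternal {d : ℕ} (N : ℕ) (U : EuclideanSpace ℝ (Fin d) → ℝ) (κ : ℝ) {k : ℕ}
    (γ : SmoothOp d k) : SmoothOp d k :=
  SmoothOp.commutator (-totalLaplacian d k) γ +
    ((2 * κ / ((N : ℝ) - 1) : ℝ) : ℂ) •
      ∑ p : Fin k × Fin k with p.1 < p.2, SmoothOp.commutator (pairMul U p.1 p.2) γ

/-- The coupling term
`(2κ (N - k) / (N - 1)) ∑_{i ≤ k} Tr_{k+1} [U(X_i - X_{k+1}), γ^{(k+1)}]`. -/
def bbgkyCoupling {d : ℕ} (N : ℕ) (U : EuclideanSpace ℝ (Fin d) → ℝ) (κ : ℝ) {k : ℕ}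
    (γ : SmoothOp d (k + 1)) : SmoothOp d k :=
  ((2 * κ * ((N : ℝ) - k) / ((N : ℝ) - 1) : ℝ) : ℂ) •
    ∑ i : Fin k, SmoothOp.partialTrace (SmoothOp.commutator (pairMul U i.castSucc (Fin.last k)) γ)

/-- The curve `Γ` solves the quantum BBGKY hierarchy on `I`:
`i ∂_t γ^{(k)}` is the internal term plus, for `k < N`, the coupling term. -/
def SolvesBBGKY {d N : ℕ} (I : Set ℝ) (U : EuclideanSpace ℝ (Fin d) → ℝ) (κ : ℝ)
    (Γ : ℝ → DMHier d N) : Prop :=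
  ∀ t ∈ I, ∃ v : DMHier d N, HasCurveDerivAt I Γ v t ∧
    (∀ k, 1 ≤ k → k < N → Complex.I • v.op k =
      bbgkyInternal N U κ ((Γ t).op k) + bbgkyCoupling N U κ ((Γ t).op (k + 1))) ∧
    Complex.I • v.op N = bbgkyInternal N U κ ((Γ t).op N)

end

/-! The Hamiltonian is linear in Γ, so its gradient is the constant hierarchy -iW, and the task is
to compute the bracket of an arbitrary hierarchy A with -iW and to move the result onto Γ through
the trace. Only W^(1) and W^(2) are nonzero, so A^(k) contributes to the bracket at level k, through
W^(1), and at level min(k+1, N), through W^(2).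

On bosonic functions ε_{k,N} A is the symmetrization of A acting in any fixed set of k labels
(`eps_val`). Hence N ε_{1,N} of the Laplacian is the full N-particle Laplacian, and N(N-1) ε_{2,N}
of the pair potential is the sum over all ordered pairs. In the commutator with the Laplacian only
the labels of A survive. In the commutator with the pair sum, pairs away from A drop out, pairs
inside A give a commutator in k variables, and by symmetry all N-k outer particles contribute
equally; the result is an operator of k+1 variables, `nextOp`. Injectivity of ε (`eps_injective`)
allows ε^{-1} of these commutators to be read off. It is proved by testing on tensor powers, with
skew-adjointness and Ryser's formula replacing a density argument.

Dualizing uses that the trace is cyclic for Laplacians and potentials and that the partial trace is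
adjoint to D ↦ D ⊗ 1 (`SmoothOp.trace_act_comp`). This produces `bbgkyField`. At levels k < N it
contains the commutator of the pair sum with Tr_{k+1} γ^{(k+1)} where the hierarchy has γ^{(k)}. The
two agree under the reduction condition for k ≥ 2, and for k = 1 there are no pairs at all; this
gives `solvesBBGKY_iff`. The field is unique because the observables i|f⟩⟨f| separate density
matrices, and gradients are unique because the densities |f⟩⟨f| separate observables.

The analytic base is the correspondence between operators from 𝓢' to 𝓢 and Schwartz kernels,
continuous in both directions (`kernelCLM`, `kernelOpCLM`), together with the density of the span of
the Dirac masses (`apply_eq_zero_of_dirac`). It makes the objects defined by choice computable. The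
Schwartz functions needed come mostly from one device: in a class of functions closed under
derivatives and coordinates, sup bounds control all seminorms (`DerivClosed`, `SchwartzClosed`). -/

noncomputable section

set_option linter.unusedSectionVars false

/-! ### Schwartz functions from families closed under derivatives and coordinates -/

section Constructor

open Finset

variable {Z : Type*} [NormedAddCommGroup Z] [NormedSpace ℝ Z] {ι : Type*} [Fintype ι]

theorem norm_le_sum_of_frame {e : ι → Z} {c : ι → Z →L[ℝ] ℝ} (hrep : ∀ z, ∑ i, c i z • e i = z)
    (z : Z) : ‖z‖ ≤ (1 + ∑ i, ‖e i‖) * ∑ i, ‖c i z‖ := by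
  conv_lhs => rw [← hrep z]
  refine (norm_sum_le _ _).trans ?_
  rw [mul_sum]
  refine sum_le_sum fun i hi => ?_
  rw [norm_smul, mul_comm]
  gcongr
  have := single_le_sum (f := fun i => ‖e i‖) (fun i _ => norm_nonneg _) hi
  linarith

/-- Continuous partial derivatives give Fréchet differentiability. The frame may be redundant; only
the representation `hrep` of vectors is used. -/
theorem hasFDerivAt_of_frame {e : ι → Z} {c : ι → Z →L[ℝ] ℝ} (hrep : ∀ z, ∑ i, c i z • e i = z)
    {f : Z → ℂ} {f' : ι → Z → ℂ} (hf' : ∀ i, Continuous (f' i))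
    (hd : ∀ i z, HasDerivAt (fun s : ℝ => f (z + s • e i)) (f' i z) 0) (z : Z) :
    HasFDerivAt f (∑ i, (c i).smulRight (f' i z)) z := by
  classical
  have hd' : ∀ i z (s : ℝ), HasDerivAt (fun s : ℝ => f (z + s • e i)) (f' i (z + s • e i)) s := by
    intro i z s
    have h1 := hd i (z + s • e i)
    have h2 : HasDerivAt (fun r : ℝ => r - s) 1 s := by
      simpa using (hasDerivAt_id s).sub_const s
    have h3 := HasDerivAt.scomp (x := s) (h := fun r : ℝ => r - s)
      (g₁ := fun s' : ℝ => f (z + s • e i + s' • e i)) (g₁' := f' i (z + s • e i))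
      (by simpa using h1) h2
    rw [one_smul] at h3
    refine h3.congr_of_eventuallyEq (Filter.Eventually.of_forall fun r => ?_)
    simp only [Function.comp]
    congr 1
    module
  -- The increment is taken along the frame vectors in t, one more at each induction step; t = univ
  -- recovers h through `hrep`.
  have key : ∀ t : Finset ι, (fun h => f (z + ∑ i ∈ t, c i h • e i) - f z -
      ∑ i ∈ t, c i h • f' i z) =o[𝓝 0] fun h : Z => h := by
    intro t
    induction t using Finset.induction_on with
    | empty => simp
    | insert j t hj ih =>
      have h2 : (fun h => f (z + ∑ i ∈ t, c i h • e i + c j h • e j) -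
          f (z + ∑ i ∈ t, c i h • e i) - c j h • f' j z) =o[𝓝 0] fun h : Z => h := by
        have h3 : (fun h => f (z + ∑ i ∈ t, c i h • e i + c j h • e j) -
          f (z + ∑ i ∈ t, c i h • e i) - c j h • f' j z) =o[𝓝 0] fun h : Z => c j h := by
          rw [Asymptotics.isLittleO_iff]
          intro ε hε
          have hcont := (hf' j).continuousAt (x := z)
          rw [Metric.continuousAt_iff] at hcont
          obtain ⟨δ, hδ, hδ'⟩ := hcont ε hε
          have t1 : ∀ᶠ h in 𝓝 (0 : Z), ‖∑ i ∈ t, c i h • e i‖ < δ / 2 := by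
            have : Continuous fun h : Z => ‖∑ i ∈ t, c i h • e i‖ := by fun_prop
            have h0 := this.tendsto 0
            simp only [map_zero, zero_smul, sum_const_zero, norm_zero] at h0
            exact h0.eventually_lt_const (half_pos hδ)
          have t2 : ∀ᶠ h in 𝓝 (0 : Z), ‖c j h • e j‖ < δ / 2 := by
            have : Continuous fun h : Z => ‖c j h • e j‖ := by fun_prop
            have h0 := this.tendsto 0
            simp only [map_zero, zero_smul, norm_zero] at h0
            exact h0.eventually_lt_const (half_pos hδ)
          filter_upwards [t1, t2] with h h1 h2
          set w := z + ∑ i ∈ t, c i h • e i with hw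
          -- After subtraction of its linear part, the function of s on [0, 1] has derivative at
          -- most ε ‖c j h‖, by continuity of f' j at z.
          have hmv := Convex.norm_image_sub_le_of_norm_hasDerivWithin_le
            (f := fun s : ℝ => f (w + s • (c j h • e j)) - s • (c j h • f' j z))
            (f' := fun s => c j h • f' j (w + s • (c j h • e j)) - c j h • f' j z)
            (C := ε * ‖c j h‖) (s := Set.Icc (0:ℝ) 1) (x := 0) (y := 1) ?_ ?_
            (convex_Icc _ _) (by simp) (by simp)
          · have e1 : f (w + c j h • e j) - f w - c j h • f' j z =
              f (w + c j h • e j) - c j h • f' j z - f w := by ring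
            rw [e1]
            simpa using hmv
          · intro s hs
            have g1 := hd' j w (s * c j h)
            have g2 : HasDerivAt (fun s : ℝ => s * c j h) (c j h) s := by
              simpa using (hasDerivAt_id s).mul_const (c j h)
            have g3 := HasDerivAt.scomp (x := s) (h := fun s : ℝ => s * c j h) g1 g2
            have g4 : HasDerivAt (fun s : ℝ => s • (c j h • f' j z)) (c j h • f' j z) s := by
              simpa using (hasDerivAt_id s).smul_const (c j h • f' j z)
            have g5 := g3.sub g4
            refine HasDerivAt.hasDerivWithinAt ?_
            convert g5 using 1
            · funext s'
              simp [Function.comp, mul_smul]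
            · simp [mul_smul]
          · intro s hs
            rw [← smul_sub, norm_smul, mul_comm]
            gcongr
            rw [← dist_eq_norm]
            refine (hδ' ?_).le
            rw [dist_eq_norm, hw]
            calc ‖z + ∑ i ∈ t, c i h • e i + s • (c j h • e j) - z‖
                = ‖∑ i ∈ t, c i h • e i + s • (c j h • e j)‖ := by congr 1; abel
              _ ≤ ‖∑ i ∈ t, c i h • e i‖ + ‖s • (c j h • e j)‖ := norm_add_le _ _
              _ ≤ ‖∑ i ∈ t, c i h • e i‖ + 1 * ‖c j h • e j‖ := by
                  rw [norm_smul s]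
                  gcongr
                  rw [Real.norm_eq_abs, abs_le]
                  constructor <;> linarith [hs.1, hs.2]
              _ < δ := by linarith
        exact h3.trans_isBigO ((c j).isBigO_id _)
      refine (ih.add h2).congr' (Filter.Eventually.of_forall fun h => ?_) Filter.EventuallyEq.rfl
      simp only
      rw [sum_insert hj, sum_insert hj]
      have : z + (c j h • e j + ∑ i ∈ t, c i h • e i) = z + ∑ i ∈ t, c i h • e i + c j h • e j := by
        abel
      rw [this]
      ring
  rw [hasFDerivAt_iff_isLittleO_nhds_zero]
  refine (key univ).congr' (Filter.Eventually.of_forall fun h => ?_) Filter.EventuallyEq.rfl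
  simp only
  rw [hrep h]
  simp

variable {Θ : Type*} {e : ι → Z} {c : ι → Z →L[ℝ] ℝ}

/-- A class of families of functions that is closed under the derivatives and the coordinates of
a frame `e`, `c`. -/
structure DerivClosed (e : ι → Z) (c : ι → Z →L[ℝ] ℝ) (G : Set (Θ → Z → ℂ)) : Prop where
  cont : ∀ g ∈ G, ∀ θ, Continuous (g θ)
  deriv : ∀ g ∈ G, ∀ i, ∃ g' ∈ G, ∀ θ z, HasDerivAt (fun s : ℝ => g θ (z + s • e i)) (g' θ z) 0
  coord : ∀ g ∈ G, ∀ i, ∃ g' ∈ G, ∀ θ z, g' θ z = c i z • g θ z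

namespace DerivClosed

variable {G : Set (Θ → Z → ℂ)}

theorem exists_fderiv (hG : DerivClosed e c G) (hrep : ∀ z, ∑ i, c i z • e i = z)
    {g : Θ → Z → ℂ} (hg : g ∈ G) : ∃ g' : ι → Θ → Z → ℂ, (∀ i, g' i ∈ G) ∧
      ∀ θ z, HasFDerivAt (g θ) (∑ i, (c i).smulRight (g' i θ z)) z := by
  choose g' hg' hd using hG.deriv g hg
  exact ⟨g', hg', fun θ z => hasFDerivAt_of_frame hrep (fun i => hG.cont _ (hg' i) θ)
    (fun i z => hd i θ z) z⟩

theorem contDiff (hG : DerivClosed e c G) (hrep : ∀ z, ∑ i, c i z • e i = z)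
    {g : Θ → Z → ℂ} (hg : g ∈ G) (θ : Θ) : ContDiff ℝ ∞ (g θ) := by
  rw [contDiff_infty]
  intro n
  induction n generalizing g with
  | zero => exact contDiff_zero.2 (hG.cont g hg θ)
  | succ n ih =>
    obtain ⟨g', hg', hd⟩ := hG.exists_fderiv hrep hg
    have : ((n + 1 : ℕ) : WithTop ℕ∞) = n + 1 := by norm_cast
    rw [this, contDiff_succ_iff_fderiv]
    refine ⟨fun z => (hd θ z).differentiableAt, by simp, ?_⟩
    have h1 : fderiv ℝ (g θ) = fun z => ∑ i, (c i).smulRight (g' i θ z) :=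
      funext fun z => (hd θ z).fderiv
    rw [h1]
    refine ContDiff.sum fun i _ => ?_
    exact ContDiff.comp (g := fun y : ℂ => (c i).smulRight y)
      ((ContinuousLinearMap.smulRightL ℝ Z ℂ (c i)).contDiff) (ih (hg' i))

/-- Each factor ‖z‖ is traded for the coordinates and each derivative for the directional ones, so a
Schwartz seminorm is controlled by sup norms of finitely many members of the class. The finite set
and the constant do not depend on θ, which later turns uniform smallness into convergence of the
whole family. -/
theorem exists_bound (hG : DerivClosed e c G) (hrep : ∀ z, ∑ i, c i z • e i = z)
    {g : Θ → Z → ℂ} (hg : g ∈ G) (k n : ℕ) :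
    ∃ (s : Finset (Θ → Z → ℂ)) (C : ℝ), 0 ≤ C ∧ ↑s ⊆ G ∧
      ∀ θ z, ‖z‖ ^ k * ‖iteratedFDeriv ℝ n (g θ) z‖ ≤ C * ∑ g' ∈ s, ‖g' θ z‖ := by
  classical
  induction n generalizing g with
  | zero =>
    induction k generalizing g with
    | zero => exact ⟨{g}, 1, zero_le_one, by simpa using hg, fun θ z => by simp⟩
    | succ k ih =>
      choose g' hg' hc using hG.coord g hg
      choose s C hC hs hb using fun i => ih (hg' i)
      refine ⟨univ.biUnion s, (1 + ∑ i, ‖e i‖) * ∑ i, C i, by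
        have : 0 ≤ ∑ i, ‖e i‖ := sum_nonneg fun i _ => norm_nonneg _
        have : 0 ≤ ∑ i, C i := sum_nonneg fun i _ => hC i
        positivity, by simpa using hs, fun θ z => ?_⟩
      have hle : 0 ≤ 1 + ∑ i, ‖e i‖ := by
        have : 0 ≤ ∑ i, ‖e i‖ := sum_nonneg fun i _ => norm_nonneg _
        linarith
      calc ‖z‖ ^ (k + 1) * ‖iteratedFDeriv ℝ 0 (g θ) z‖
          = ‖z‖ * (‖z‖ ^ k * ‖g θ z‖) := by rw [norm_iteratedFDeriv_zero]; ring
        _ ≤ ((1 + ∑ i, ‖e i‖) * ∑ i, ‖c i z‖) * (‖z‖ ^ k * ‖g θ z‖) := by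
            gcongr
            exact norm_le_sum_of_frame hrep z
        _ = (1 + ∑ i, ‖e i‖) * ∑ i, ‖z‖ ^ k * ‖g' i θ z‖ := by
            rw [mul_assoc, sum_mul]
            congr 1
            refine sum_congr rfl fun i _ => ?_
            rw [hc, norm_smul]
            ring
        _ ≤ (1 + ∑ i, ‖e i‖) * ∑ i, C i * ∑ g' ∈ univ.biUnion s, ‖g' θ z‖ := by
            refine mul_le_mul_of_nonneg_left (sum_le_sum fun i _ => ?_) hle
            have := hb i θ z
            rw [norm_iteratedFDeriv_zero] at this
            refine this.trans ?_
            refine mul_le_mul_of_nonneg_left ?_ (hC i)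
            exact sum_le_sum_of_subset_of_nonneg (subset_biUnion_of_mem s (mem_univ i))
              fun _ _ _ => norm_nonneg _
        _ = _ := by rw [← sum_mul, mul_assoc]
  | succ n ih =>
    obtain ⟨g', hg', hd⟩ := hG.exists_fderiv hrep hg
    choose s C hC hs hb using fun i => ih (hg' i)
    refine ⟨univ.biUnion s, ∑ i, ‖ContinuousLinearMap.smulRightL ℝ Z ℂ (c i)‖ * C i,
      sum_nonneg fun i _ =>
        mul_nonneg (norm_nonneg (ContinuousLinearMap.smulRightL ℝ Z ℂ (c i))) (hC i), by simpa using hs, fun θ z => ?_⟩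
    have h1 : fderiv ℝ (g θ) = fun z => ∑ i, ContinuousLinearMap.smulRightL ℝ Z ℂ (c i) (g' i θ z) :=
      funext fun z => (hd θ z).fderiv
    have hsm : ∀ i, ContDiff ℝ n (g' i θ) := fun i =>
      (hG.contDiff hrep (hg' i) θ).of_le (by exact_mod_cast le_top)
    rw [← norm_iteratedFDeriv_fderiv, h1, iteratedFDeriv_sum]
    · rw [mul_comm, Finset.sum_apply]
      calc ‖∑ i, iteratedFDeriv ℝ n (fun z => ContinuousLinearMap.smulRightL ℝ Z ℂ (c i) (g' i θ z)) z‖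
            * ‖z‖ ^ k
          ≤ (∑ i, ‖ContinuousLinearMap.smulRightL ℝ Z ℂ (c i)‖ * ‖iteratedFDeriv ℝ n (g' i θ) z‖)
            * ‖z‖ ^ k := by
            gcongr
            refine (norm_sum_le _ _).trans (sum_le_sum fun i _ => ?_)
            exact ContinuousLinearMap.norm_iteratedFDeriv_comp_left _ (hsm i).contDiffAt le_rfl
        _ = ∑ i, ‖ContinuousLinearMap.smulRightL ℝ Z ℂ (c i)‖ *
              (‖z‖ ^ k * ‖iteratedFDeriv ℝ n (g' i θ) z‖) := by
            rw [sum_mul]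
            refine sum_congr rfl fun i _ => by ring
        _ ≤ ∑ i, ‖ContinuousLinearMap.smulRightL ℝ Z ℂ (c i)‖ *
              (C i * ∑ g' ∈ univ.biUnion s, ‖g' θ z‖) := by
            refine sum_le_sum fun i _ => mul_le_mul_of_nonneg_left ?_
              (norm_nonneg (ContinuousLinearMap.smulRightL ℝ Z ℂ (c i)))
            refine (hb i θ z).trans ?_
            refine mul_le_mul_of_nonneg_left ?_ (hC i)
            exact sum_le_sum_of_subset_of_nonneg (subset_biUnion_of_mem s (mem_univ i))
              fun _ _ _ => norm_nonneg _
        _ = _ := by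
            rw [sum_mul]
            refine sum_congr rfl fun i _ => by ring
    · intro i _
      exact ContDiff.comp (g := fun y : ℂ => ContinuousLinearMap.smulRightL ℝ Z ℂ (c i) y)
        ((ContinuousLinearMap.smulRightL ℝ Z ℂ (c i)).contDiff) (hsm i)

/-- A member of a bounded closed class is a Schwartz function. -/
theorem exists_schwartz (hG : DerivClosed e c G) (hrep : ∀ z, ∑ i, c i z • e i = z)
    (hb : ∀ g ∈ G, ∀ θ, ∃ C, ∀ z, ‖g θ z‖ ≤ C) {g : Θ → Z → ℂ} (hg : g ∈ G) (θ : Θ) :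
    ∃ f : 𝓢(Z, ℂ), ∀ z, f z = g θ z := by
  refine ⟨⟨g θ, hG.contDiff hrep hg θ, fun k n => ?_⟩, fun z => rfl⟩
  obtain ⟨s, C, hC, hs, hbd⟩ := hG.exists_bound hrep hg k n
  choose! C' hC' using fun g (hg : g ∈ G) => hb g hg θ
  refine ⟨C * ∑ g' ∈ s, C' g', fun z => (hbd θ z).trans ?_⟩
  gcongr with g' hg'
  exact hC' g' (hs hg') z

end DerivClosed

end Constructor

/-! ### Basic operators on Schwartz functions and uniform criteria -/

section Operators

variable {Z : Type*} [NormedAddCommGroup Z] [NormedSpace ℝ Z]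

theorem exists_frame (Z : Type*) [NormedAddCommGroup Z] [NormedSpace ℝ Z] [FiniteDimensional ℝ Z] :
    ∃ (n : ℕ) (e : Fin n → Z) (c : Fin n → Z →L[ℝ] ℝ), ∀ z, ∑ i, c i z • e i = z := by
  refine ⟨Module.finrank ℝ Z, Module.finBasis ℝ Z,
    fun i => LinearMap.toContinuousLinearMap ((Module.finBasis ℝ Z).coord i), fun z => ?_⟩
  simp [(Module.finBasis ℝ Z).sum_repr z]

/-- Multiplication by a linear form. -/
def mulForm (c : Z →L[ℝ] ℝ) : 𝓢(Z, ℂ) →L[ℂ] 𝓢(Z, ℂ) :=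
  SchwartzMap.smulLeftCLM ℂ fun z => ((c z : ℝ) : ℂ)

theorem mulForm_apply (c : Z →L[ℝ] ℝ) (f : 𝓢(Z, ℂ)) (z : Z) :
    mulForm c f z = (c z : ℂ) * f z := by
  rw [mulForm, SchwartzMap.smulLeftCLM_apply_apply (by fun_prop), smul_eq_mul]

/-- The directional derivative. -/
def dirDeriv (v : Z) : 𝓢(Z, ℂ) →L[ℂ] 𝓢(Z, ℂ) := LineDeriv.lineDerivOpCLM ℂ 𝓢(Z, ℂ) v

theorem dirDeriv_apply (v : Z) (f : 𝓢(Z, ℂ)) (z : Z) : dirDeriv v f z = fderiv ℝ f z v := rfl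

theorem hasDerivAt_line (f : 𝓢(Z, ℂ)) (z v : Z) (s : ℝ) :
    HasDerivAt (fun s : ℝ => f (z + s • v)) (dirDeriv v f (z + s • v)) s := by
  have h := (f.hasFDerivAt (z + s • v)).comp_hasDerivAt s
    (f := fun s : ℝ => z + s • v) (f' := v) (by
      simpa using ((hasDerivAt_id s).smul_const v).const_add z)
  exact h

theorem hasDerivAt_line_zero (f : 𝓢(Z, ℂ)) (z v : Z) :
    HasDerivAt (fun s : ℝ => f (z + s • v)) (dirDeriv v f z) 0 := by
  simpa using hasDerivAt_line f z v 0

theorem dirDeriv_comm (v w : Z) (f : 𝓢(Z, ℂ)) :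
    dirDeriv v (dirDeriv w f) = dirDeriv w (dirDeriv v f) := by
  ext z
  have h : ∀ v w : Z, dirDeriv v (dirDeriv w f) z = fderiv ℝ (fderiv ℝ f) z v w := by
    intro v w
    rw [dirDeriv_apply]
    have h1 : (dirDeriv w f : Z → ℂ) = fun z => fderiv ℝ f z w := rfl
    have h2 : DifferentiableAt ℝ (fderiv ℝ f) z :=
      ((f.smooth 2).fderiv_right (m := 1) (by norm_num)).differentiable (by norm_num) z
    rw [h1, fderiv_clm_apply h2 (differentiableAt_const w)]
    simp
  rw [h, h]
  exact (f.smooth 2).contDiffAt.isSymmSndFDerivAt (by simp) v w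

theorem exists_sup_bound (f : 𝓢(Z, ℂ)) : ∃ C, 0 ≤ C ∧ ∀ z, ‖f z‖ ≤ C :=
  ⟨_, apply_nonneg _ _, SchwartzMap.norm_le_seminorm ℂ f⟩

theorem eventually_sup_le {ε : ℝ} (hε : 0 < ε) :
    ∀ᶠ f : 𝓢(Z, ℂ) in 𝓝 0, ∀ z, ‖f z‖ ≤ ε := by
  have h := ((schwartz_withSeminorms ℂ Z ℂ).continuous_seminorm (0, 0)).tendsto 0
  rw [map_zero] at h
  filter_upwards [h.eventually_le_const hε] with f hf z
  exact (SchwartzMap.norm_le_seminorm ℂ f z).trans hf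

/-- First order Taylor estimate along a line. -/
theorem norm_taylor_le (f : 𝓢(Z, ℂ)) (v : Z) {C : ℝ}
    (hC : ∀ z, ‖dirDeriv v (dirDeriv v f) z‖ ≤ C) (z : Z) (s : ℝ) :
    ‖f (z + s • v) - f z - s • dirDeriv v f z‖ ≤ C * s ^ 2 := by
  have hlip : ∀ r : ℝ, ‖dirDeriv v f (z + r • v) - dirDeriv v f z‖ ≤ C * |r| := by
    intro r
    have := Convex.norm_image_sub_le_of_norm_hasDerivWithin_le
      (f := fun s : ℝ => dirDeriv v f (z + s • v)) (s := Set.univ) (x := 0) (y := r)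
      (fun s _ => (hasDerivAt_line (dirDeriv v f) z v s).hasDerivWithinAt) (fun s _ => hC _)
      convex_univ trivial trivial
    simpa using this
  have hC0 : 0 ≤ C := (norm_nonneg _).trans (hC z)
  have := Convex.norm_image_sub_le_of_norm_hasDerivWithin_le
    (f := fun r : ℝ => f (z + r • v) - r • dirDeriv v f z)
    (f' := fun r => dirDeriv v f (z + r • v) - dirDeriv v f z)
    (C := C * |s|) (s := Set.uIcc 0 s) (x := 0) (y := s) ?_ ?_
      (convex_uIcc _ _) (by simp) (by simp)
  · have e : f (z + s • v) - f z - s • dirDeriv v f z =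
        f (z + s • v) - s • dirDeriv v f z - f z := by ring
    rw [e]
    simp only [zero_smul, add_zero, sub_zero, Real.norm_eq_abs] at this
    rw [mul_assoc, ← sq, sq_abs] at this
    exact this
  · intro r _
    have h1 : HasDerivAt (fun r : ℝ => r • dirDeriv v f z) (dirDeriv v f z) r := by
      simpa using (hasDerivAt_id r).smul_const (dirDeriv v f z)
    exact ((hasDerivAt_line f z v r).sub h1).hasDerivWithinAt
  · intro r hr
    refine (hlip r).trans ?_
    have h2 := Set.abs_sub_left_of_mem_uIcc hr
    rw [sub_zero, sub_zero] at h2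
    exact mul_le_mul_of_nonneg_left h2 hC0

theorem norm_sub_le_seminorm (f : 𝓢(Z, ℂ)) (z z' : Z) :
    ‖f z - f z'‖ ≤ SchwartzMap.seminorm ℂ 0 1 f * ‖z - z'‖ := by
  refine Convex.norm_image_sub_le_of_norm_fderiv_le (𝕜 := ℝ) (s := Set.univ)
    (fun z _ => f.differentiableAt) (fun z _ => ?_) convex_univ trivial trivial
  have := SchwartzMap.norm_iteratedFDeriv_le_seminorm ℂ f 1 z
  rwa [norm_iteratedFDeriv_one] at this

variable {Θ : Type*} {ι : Type*} [Fintype ι] {e : ι → Z} {c : ι → Z →L[ℝ] ℝ}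

/-- A class of families of Schwartz functions that is closed under the derivatives and the
coordinates of a frame. -/
structure SchwartzClosed (e : ι → Z) (c : ι → Z →L[ℝ] ℝ) (G : Set (Θ → 𝓢(Z, ℂ))) : Prop where
  deriv : ∀ g ∈ G, ∀ i, (fun θ => dirDeriv (e i) (g θ)) ∈ G
  coord : ∀ g ∈ G, ∀ i, (fun θ => mulForm (c i) (g θ)) ∈ G

namespace SchwartzClosed

variable {G : Set (Θ → 𝓢(Z, ℂ))}

theorem exists_bound (hG : SchwartzClosed e c G) (hrep : ∀ z, ∑ i, c i z • e i = z)
    {g : Θ → 𝓢(Z, ℂ)} (hg : g ∈ G) (k n : ℕ) :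
    ∃ (s : Finset (Θ → Z → ℂ)) (C : ℝ), 0 ≤ C ∧ (∀ g' ∈ s, ∃ g'' ∈ G, ∀ θ z, g' θ z = g'' θ z) ∧
      ∀ θ z, ‖z‖ ^ k * ‖iteratedFDeriv ℝ n (g θ) z‖ ≤ C * ∑ g' ∈ s, ‖g' θ z‖ := by
  have h : DerivClosed e c {g : Θ → Z → ℂ | ∃ g'' ∈ G, ∀ θ z, g θ z = g'' θ z} := by
    refine ⟨?_, ?_, ?_⟩
    · rintro g ⟨g', hg', h⟩ θ
      rw [funext (h θ)]
      exact (g' θ).continuous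
    · rintro g ⟨g', hg', h⟩ i
      refine ⟨_, ⟨_, hG.deriv g' hg' i, fun _ _ => rfl⟩, fun θ z => ?_⟩
      rw [funext (h θ)]
      exact hasDerivAt_line_zero (g' θ) z (e i)
    · rintro g ⟨g', hg', h⟩ i
      refine ⟨_, ⟨_, hG.coord g' hg' i, fun _ _ => rfl⟩, fun θ z => ?_⟩
      rw [mulForm_apply, h θ z, Complex.real_smul]
  obtain ⟨s, C, hC, hs, hb⟩ := h.exists_bound hrep (g := fun θ z => g θ z)
    ⟨g, hg, fun _ _ => rfl⟩ k n
  exact ⟨s, C, hC, fun g' hg' => hs hg', hb⟩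

/-- Since all seminorms are controlled by sup norms within the class, convergence to zero in sup
norm of every member already gives convergence in the Schwartz topology. -/
theorem tendsto (hG : SchwartzClosed e c G) (hrep : ∀ z, ∑ i, c i z • e i = z) {l : Filter Θ}
    (h : ∀ g ∈ G, ∀ ε : ℝ, 0 < ε → ∀ᶠ θ in l, ∀ z, ‖g θ z‖ ≤ ε) {g : Θ → 𝓢(Z, ℂ)} (hg : g ∈ G) :
    Filter.Tendsto g l (𝓝 0) := by
  rw [(schwartz_withSeminorms ℂ Z ℂ).tendsto_nhds]
  rintro ⟨k, n⟩ ε hε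
  obtain ⟨s, C, hC, hs, hb⟩ := hG.exists_bound hrep hg k n
  -- The threshold is chosen so that C times the sum over s stays below ε / 2; the added ones keep
  -- the denominator positive when C = 0 or s is empty.
  have h1 : ∀ g' ∈ s, ∀ᶠ θ in l, ∀ z, ‖g' θ z‖ ≤ ε / (2 * (C + 1) * (s.card + 1)) := by
    intro g' hg'
    obtain ⟨g'', hg'', he⟩ := hs g' hg'
    filter_upwards [h g'' hg'' (ε / (2 * (C + 1) * (s.card + 1))) (by positivity)] with θ hθ z
    rw [he]
    exact hθ z
  filter_upwards [(Filter.eventually_all_finset s).2 h1] with θ hθ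
  rw [sub_zero]
  refine lt_of_le_of_lt (SchwartzMap.seminorm_le_bound ℂ k n (g θ) (M := ε / 2) (by positivity)
    fun z => (hb θ z).trans ?_) (by linarith)
  calc C * ∑ g' ∈ s, ‖g' θ z‖ ≤ C * ∑ g' ∈ s, ε / (2 * (C + 1) * (s.card + 1)) := by
        gcongr with g' hg'
        exact hθ g' hg' z
    _ = (C / (C + 1)) * (s.card / (s.card + 1)) * (ε / 2) := by
        rw [Finset.sum_const, nsmul_eq_mul]
        field_simp
    _ ≤ 1 * 1 * (ε / 2) := by
        gcongr
        · rw [div_le_one (by positivity)]; linarith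
        · rw [div_le_one (by positivity)]; linarith
    _ = ε / 2 := by ring

theorem isVonNBounded (hG : SchwartzClosed e c G) (hrep : ∀ z, ∑ i, c i z • e i = z)
    (h : ∀ g ∈ G, ∃ M : ℝ, ∀ θ z, ‖g θ z‖ ≤ M) {g : Θ → 𝓢(Z, ℂ)} (hg : g ∈ G) :
    Bornology.IsVonNBounded ℂ (Set.range g) := by
  rw [(schwartz_withSeminorms ℂ Z ℂ).isVonNBounded_iff_seminorm_bddAbove]
  rintro ⟨k, n⟩
  obtain ⟨s, C, hC, hs, hb⟩ := hG.exists_bound hrep hg k n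
  have h1 : ∀ g' : Θ → Z → ℂ, ∃ M : ℝ, g' ∈ s → ∀ θ z, ‖g' θ z‖ ≤ M := by
    intro g'
    by_cases hg' : g' ∈ s
    · obtain ⟨g'', hg'', he⟩ := hs g' hg'
      obtain ⟨M, hM⟩ := h g'' hg''
      exact ⟨M, fun _ θ z => by rw [he]; exact hM θ z⟩
    · exact ⟨0, fun h => absurd h hg'⟩
  choose M hM using h1
  refine ⟨max 0 (C * ∑ g' ∈ s, M g'), ?_⟩
  rintro _ ⟨_, ⟨θ, rfl⟩, rfl⟩
  refine SchwartzMap.seminorm_le_bound ℂ k n (g θ) (le_max_left _ _) fun z => (hb θ z).trans ?_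
  refine le_max_of_le_right ?_
  gcongr with g' hg'
  exact hM g' hg' θ z

end SchwartzClosed

end Operators

/-! ### Operators acting in one group of variables, kernels -/

section Slices

variable {E E' Y : Type*} [NormedAddCommGroup E] [NormedSpace ℝ E] [FiniteDimensional ℝ E]
  [NormedAddCommGroup E'] [NormedSpace ℝ E'] [FiniteDimensional ℝ E']
  [NormedAddCommGroup Y] [NormedSpace ℝ Y] [FiniteDimensional ℝ Y]

theorem hasTemperateGrowth_pair (y : Y) : (fun x : E => (x, y)).HasTemperateGrowth := by
  have h : (fun x : E => (x, y)) = fun x => ContinuousLinearMap.inl ℝ E Y x + (0, y) := by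
    funext x; simp
  rw [h]
  fun_prop

theorem antilipschitz_pair (y : Y) : AntilipschitzWith 1 fun x : E => (x, y) :=
  AntilipschitzWith.of_le_mul_dist fun x x' => by simp [Prod.dist_eq]

/-- `f ↦ f(·, y)`. -/
def sliceAt (y : Y) : 𝓢(E × Y, ℂ) →L[ℂ] 𝓢(E, ℂ) :=
  SchwartzMap.compCLMOfAntilipschitz ℂ (hasTemperateGrowth_pair y) (antilipschitz_pair y)

@[simp] theorem sliceAt_apply (y : Y) (f : 𝓢(E × Y, ℂ)) (x : E) : sliceAt y f x = f (x, y) := rfl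

theorem dirDeriv_sliceAt (v : E) (y : Y) (f : 𝓢(E × Y, ℂ)) :
    dirDeriv v (sliceAt y f) = sliceAt y (dirDeriv (v, 0) f) := by
  ext x
  have h1 := hasDerivAt_line_zero (sliceAt y f) x v
  have h2 := hasDerivAt_line_zero f (x, y) (v, 0)
  simp only [sliceAt_apply] at h1 ⊢
  refine h1.unique ?_
  simpa using h2

theorem mulForm_sliceAt (c : E →L[ℝ] ℝ) (y : Y) (f : 𝓢(E × Y, ℂ)) :
    mulForm c (sliceAt y f) = sliceAt y (mulForm (c ∘L ContinuousLinearMap.fst ℝ E Y) f) := by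
  ext x
  simp [mulForm_apply]

/-- Slices of small functions are uniformly small. -/
theorem tendsto_sliceAt {Θ : Type*} {l : Filter Θ} {f : Θ → 𝓢(E × Y, ℂ)}
    (hf : Filter.Tendsto f l (𝓝 0)) (y : Θ → Y) :
    Filter.Tendsto (fun θ => sliceAt (y θ) (f θ)) l (𝓝 0) := by
  obtain ⟨n, e, c, hrep⟩ := exists_frame E
  -- An arbitrary operator B on the full space closes the class: derivatives and coordinates in E
  -- pass through the slice and are absorbed into B.
  let G : Set (Θ → 𝓢(E, ℂ)) :=
    {g | ∃ B : 𝓢(E × Y, ℂ) →L[ℂ] 𝓢(E × Y, ℂ), g = fun θ => sliceAt (y θ) (B (f θ))}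
  have hG : SchwartzClosed e c G := by
    refine ⟨?_, ?_⟩
    · rintro _ ⟨B, rfl⟩ i
      exact ⟨dirDeriv (e i, 0) ∘L B, by funext θ; simp [dirDeriv_sliceAt]⟩
    · rintro _ ⟨B, rfl⟩ i
      exact ⟨mulForm (c i ∘L ContinuousLinearMap.fst ℝ E Y) ∘L B,
        by funext θ; simp [mulForm_sliceAt]⟩
  refine hG.tendsto hrep ?_ ⟨.id ℂ _, rfl⟩
  rintro _ ⟨B, rfl⟩ ε hε
  have h1 : Filter.Tendsto (fun θ => B (f θ)) l (𝓝 0) := by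
    have := (B.continuous.tendsto 0).comp hf
    rwa [map_zero] at this
  filter_upwards [h1.eventually (eventually_sup_le hε)] with θ hθ z
  exact hθ _

theorem eventually_sliceAt_mem {U : Set 𝓢(E, ℂ)} (hU : U ∈ 𝓝 0) :
    ∀ᶠ f : 𝓢(E × Y, ℂ) in 𝓝 0, ∀ y, sliceAt y f ∈ U := by
  -- The parameter y carries the filter ⊤, so convergence along the product filter is uniform in y.
  have h : Filter.Tendsto (fun p : 𝓢(E × Y, ℂ) × Y => sliceAt p.2 p.1) (𝓝 0 ×ˢ ⊤) (𝓝 0) :=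
    tendsto_sliceAt Filter.tendsto_fst fun p => p.2
  have h2 := h.eventually_mem hU
  rw [Filter.eventually_prod_iff] at h2
  obtain ⟨pa, ha, pb, hb, h3⟩ := h2
  rw [Filter.eventually_top] at hb
  filter_upwards [ha] with f hf y using h3 hf (hb y)

theorem isVonNBounded_sliceAt {B : Set 𝓢(E × Y, ℂ)} (hB : Bornology.IsVonNBounded ℂ B) :
    Bornology.IsVonNBounded ℂ {g : 𝓢(E, ℂ) | ∃ f ∈ B, ∃ y : Y, g = sliceAt y f} := by
  intro U hU
  have h := hB (eventually_sliceAt_mem (Y := Y) hU)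
  filter_upwards [h] with t ht
  rintro _ ⟨f, hf, y, rfl⟩
  obtain ⟨f', hf', rfl⟩ := ht hf
  exact ⟨sliceAt y f', hf' y, by simp⟩

theorem continuous_sliceAt (f : 𝓢(E × Y, ℂ)) : Continuous fun y : Y => sliceAt y f := by
  rw [continuous_iff_continuousAt]
  intro y
  obtain ⟨n, e, c, hrep⟩ := exists_frame E
  let G : Set (Y → 𝓢(E, ℂ)) := {g | ∃ f : 𝓢(E × Y, ℂ), g = fun y' => sliceAt y' f - sliceAt y f}
  have hG : SchwartzClosed e c G := by
    refine ⟨?_, ?_⟩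
    · rintro _ ⟨f, rfl⟩ i
      exact ⟨dirDeriv (e i, 0) f, by funext θ; simp [dirDeriv_sliceAt]⟩
    · rintro _ ⟨f, rfl⟩ i
      exact ⟨mulForm (c i ∘L ContinuousLinearMap.fst ℝ E Y) f,
        by funext θ; simp [mulForm_sliceAt]⟩
  have h : Filter.Tendsto (fun y' => sliceAt y' f - sliceAt y f) (𝓝 y) (𝓝 0) := by
    refine hG.tendsto hrep ?_ ⟨f, rfl⟩
    rintro _ ⟨f, rfl⟩ ε hε
    obtain ⟨C, h⟩ : ∃ C, ∀ z z', ‖f z - f z'‖ ≤ C * ‖z - z'‖ := ⟨_, norm_sub_le_seminorm f⟩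
    have h1 : Filter.Tendsto (fun y' => C * ‖y' - y‖) (𝓝 y) (𝓝 0) := by
      have : Continuous fun y' => C * ‖y' - y‖ := by fun_prop
      simpa using this.tendsto y
    filter_upwards [h1.eventually_le_const hε] with y' hy' z
    refine le_trans ?_ hy'
    simpa using h (z, y') (z, y)
  have h2 := h.add_const (sliceAt y f)
  simpa [ContinuousAt] using h2

/-- The remainder of the difference quotient commutes with derivatives and coordinates in E, so the
remainders of all f form a closed class, and the sup bound of `norm_taylor_le` suffices. -/
theorem tendsto_slope_sliceAt (f : 𝓢(E × Y, ℂ)) (y w : Y) :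
    Filter.Tendsto (fun s : ℝ => s⁻¹ • (sliceAt (y + s • w) f - sliceAt y f)) (𝓝[≠] 0)
      (𝓝 (sliceAt y (dirDeriv (0, w) f))) := by
  obtain ⟨n, e, c, hrep⟩ := exists_frame E
  let D : 𝓢(E × Y, ℂ) → ℝ → 𝓢(E, ℂ) := fun f s =>
    s⁻¹ • (sliceAt (y + s • w) f - sliceAt y f) - sliceAt y (dirDeriv (0, w) f)
  let G : Set (ℝ → 𝓢(E, ℂ)) := {g | ∃ f : 𝓢(E × Y, ℂ), g = D f}
  have hG : SchwartzClosed e c G := by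
    refine ⟨?_, ?_⟩
    · rintro _ ⟨f, rfl⟩ i
      refine ⟨dirDeriv (e i, 0) f, ?_⟩
      funext s
      have hr : ∀ (r : ℝ) (g : 𝓢(E, ℂ)), dirDeriv (e i) (r • g) = r • dirDeriv (e i) g :=
        fun r g => (dirDeriv (e i)).map_smul_of_tower r g
      simp only [D, map_sub, hr, dirDeriv_sliceAt, dirDeriv_comm (0, w) (e i, 0)]
    · rintro _ ⟨f, rfl⟩ i
      refine ⟨mulForm (c i ∘L ContinuousLinearMap.fst ℝ E Y) f, ?_⟩
      funext s
      have hr : ∀ (r : ℝ) (g : 𝓢(E, ℂ)), mulForm (c i) (r • g) = r • mulForm (c i) g :=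
        fun r g => (mulForm (c i)).map_smul_of_tower r g
      have hcomm : dirDeriv ((0 : E), w) (mulForm (c i ∘L ContinuousLinearMap.fst ℝ E Y) f) =
          mulForm (c i ∘L ContinuousLinearMap.fst ℝ E Y) (dirDeriv ((0 : E), w) f) := by
        ext z
        refine (hasDerivAt_line_zero _ z ((0 : E), w)).unique ?_
        simp only [mulForm_apply]
        simpa using (hasDerivAt_line_zero f z ((0 : E), w)).const_mul ((c i z.1 : ℝ) : ℂ)
      simp only [D, map_sub, hr, mulForm_sliceAt, hcomm]
  have h : Filter.Tendsto (D f) (𝓝[≠] 0) (𝓝 0) := by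
    refine hG.tendsto hrep ?_ ⟨f, rfl⟩
    rintro _ ⟨f, rfl⟩ ε hε
    obtain ⟨C, hC, h⟩ := exists_sup_bound (dirDeriv ((0 : E), w) (dirDeriv ((0 : E), w) f))
    have h1 : Filter.Tendsto (fun s : ℝ => C * |s|) (𝓝[≠] 0) (𝓝 0) := by
      have : Continuous fun s : ℝ => C * |s| := by fun_prop
      have h0 := this.tendsto 0
      simp only [abs_zero, mul_zero] at h0
      exact h0.mono_left nhdsWithin_le_nhds
    filter_upwards [h1.eventually_le_const hε, self_mem_nhdsWithin] with s hs hs0 z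
    refine le_trans ?_ hs
    have hs0 : s ≠ 0 := hs0
    have h2 := norm_taylor_le f ((0 : E), w) h (z, y) s
    have h3 : D f s z = s⁻¹ • (f ((z, y) + s • ((0 : E), w)) - f (z, y) -
        s • dirDeriv ((0 : E), w) f (z, y)) := by
      simp only [D, sub_apply, smul_apply, sliceAt_apply, smul_sub, inv_smul_smul₀ hs0]
      simp
    rw [h3, norm_smul]
    calc ‖s⁻¹‖ * _ ≤ ‖s⁻¹‖ * (C * s ^ 2) := by gcongr
      _ = C * |s| := by
        rw [norm_inv, Real.norm_eq_abs, ← sq_abs]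
        field_simp
  have h2 := h.add_const (sliceAt y (dirDeriv ((0 : E), w) f))
  simpa [D] using h2

end Slices

/-! ### Tensoring an operator with the identity -/

section Tensor

variable {E E' Y : Type*} [NormedAddCommGroup E] [NormedSpace ℝ E] [FiniteDimensional ℝ E]
  [NormedAddCommGroup E'] [NormedSpace ℝ E'] [FiniteDimensional ℝ E']
  [NormedAddCommGroup Y] [NormedSpace ℝ Y] [FiniteDimensional ℝ Y]

/-- The Dirac mass. -/
def dirac (x : E) : 𝓢(E, ℂ) →L[ℂ] ℂ :=
  BoundedContinuousFunction.evalCLM ℂ x ∘L SchwartzMap.toBoundedContinuousFunctionCLM ℂ E ℂ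

@[simp] theorem dirac_apply (x : E) (f : 𝓢(E, ℂ)) : dirac x f = f x := rfl

theorem continuous_schwartz_eval {T : Type*} [TopologicalSpace T] {h : T → 𝓢(E, ℂ)}
    (hh : Continuous h) {g : T → E} (hg : Continuous g) : Continuous fun t => h t (g t) := by
  have h1 : Continuous fun t => SchwartzMap.toBoundedContinuousFunctionCLM ℂ E ℂ (h t) :=
    (SchwartzMap.toBoundedContinuousFunctionCLM ℂ E ℂ).continuous.comp hh
  exact h1.eval hg

theorem hasDerivAt_of_tendsto_slope {X : Type*} [AddCommGroup X] [Module ℝ X] [Module ℂ X]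
    [IsScalarTower ℝ ℂ X] [TopologicalSpace X] (φ : X →L[ℂ] ℂ) {γ : ℝ → X} {v : X}
    (h : Filter.Tendsto (fun s : ℝ => s⁻¹ • (γ s - γ 0)) (𝓝[≠] 0) (𝓝 v)) :
    HasDerivAt (fun s => φ (γ s)) (φ v) 0 := by
  rw [hasDerivAt_iff_tendsto_slope_zero]
  have h1 := (φ.continuous.tendsto v).comp h
  refine h1.congr fun s => ?_
  simp only [Function.comp, zero_add]
  rw [φ.map_smul_of_tower, map_sub]

theorem prod_frame {n m : ℕ} {e : Fin n → E} {c : Fin n → E →L[ℝ] ℝ}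
    (h : ∀ z, ∑ i, c i z • e i = z) {e' : Fin m → Y} {c' : Fin m → Y →L[ℝ] ℝ}
    (h' : ∀ z, ∑ i, c' i z • e' i = z) (z : E × Y) :
    ∑ i, (Sum.elim (fun i => c i ∘L ContinuousLinearMap.fst ℝ E Y)
      (fun j => c' j ∘L ContinuousLinearMap.snd ℝ E Y) i) z •
      (Sum.elim (fun i => (e i, (0 : Y))) (fun j => ((0 : E), e' j)) i) = z := by
  rw [Fintype.sum_sum_type]
  simp only [Sum.elim_inl, Sum.elim_inr, ContinuousLinearMap.comp_apply,
    ContinuousLinearMap.coe_fst', ContinuousLinearMap.coe_snd', Prod.smul_mk, smul_zero]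
  ext1
  · simp [Prod.fst_sum, h]
  · simp [Prod.snd_sum, h']

/-- The functions z ↦ Λ(f(·, z.2))(z.1), over all Λ and f, form a closed class: derivatives and
coordinates in E' are absorbed into Λ, those in Y into f. They are bounded because the slices of f
form a bounded set, which Λ preserves. -/
theorem exists_tens (Λ : 𝓢(E, ℂ) →L[ℂ] 𝓢(E', ℂ)) (f : 𝓢(E × Y, ℂ)) :
    ∃ g : 𝓢(E' × Y, ℂ), ∀ z, g z = Λ (sliceAt z.2 f) z.1 := by
  obtain ⟨n, e, c, hrep⟩ := exists_frame E'
  obtain ⟨m, e', c', hrep'⟩ := exists_frame Y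
  let G : Set (Unit → E' × Y → ℂ) := {g | ∃ (Λ : 𝓢(E, ℂ) →L[ℂ] 𝓢(E', ℂ)) (f : 𝓢(E × Y, ℂ)),
    g = fun _ z => Λ (sliceAt z.2 f) z.1}
  have hG : DerivClosed (Sum.elim (fun i => (e i, (0 : Y))) (fun j => ((0 : E'), e' j)))
      (Sum.elim (fun i => c i ∘L ContinuousLinearMap.fst ℝ E' Y)
      (fun j => c' j ∘L ContinuousLinearMap.snd ℝ E' Y)) G := by
    refine ⟨?_, ?_, ?_⟩
    · rintro _ ⟨Λ, f, rfl⟩ _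
      exact continuous_schwartz_eval
        (Λ.continuous.comp ((continuous_sliceAt f).comp continuous_snd)) continuous_fst
    · rintro _ ⟨Λ, f, rfl⟩ (i | j)
      · refine ⟨_, ⟨dirDeriv (e i) ∘L Λ, f, rfl⟩, fun _ z => ?_⟩
        simpa using hasDerivAt_line_zero (Λ (sliceAt z.2 f)) z.1 (e i)
      · refine ⟨_, ⟨Λ, dirDeriv (0, e' j) f, rfl⟩, fun _ z => ?_⟩
        have := hasDerivAt_of_tendsto_slope (dirac z.1 ∘L Λ)
          (γ := fun s : ℝ => sliceAt (z.2 + s • e' j) f) (by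
            simpa using tendsto_slope_sliceAt f z.2 (e' j))
        simpa using this
    · rintro _ ⟨Λ, f, rfl⟩ (i | j)
      · exact ⟨_, ⟨mulForm (c i) ∘L Λ, f, rfl⟩, fun _ z => by simp [mulForm_apply]⟩
      · refine ⟨_, ⟨Λ, mulForm (c' j ∘L ContinuousLinearMap.snd ℝ E Y) f, rfl⟩, fun _ z => ?_⟩
        have : sliceAt z.2 (mulForm (c' j ∘L ContinuousLinearMap.snd ℝ E Y) f) =
            (c' j z.2 : ℂ) • sliceAt z.2 f := by
          ext x; simp [mulForm_apply]
        simp [this]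
  refine hG.exists_schwartz (prod_frame hrep hrep') ?_ ⟨Λ, f, rfl⟩ ()
  rintro _ ⟨Λ, f, rfl⟩ _
  have hb : Bornology.IsVonNBounded ℂ {g : 𝓢(E, ℂ) | ∃ f' ∈ ({f} : Set 𝓢(E × Y, ℂ)), ∃ y : Y, g = sliceAt y f'} :=
    isVonNBounded_sliceAt (Bornology.isVonNBounded_singleton f)
  have hb2 := hb.image Λ
  rw [(schwartz_withSeminorms ℂ E' ℂ).isVonNBounded_iff_seminorm_bddAbove] at hb2
  obtain ⟨C, hC⟩ := hb2 (0, 0)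
  refine ⟨C, fun z => (SchwartzMap.norm_le_seminorm ℂ _ z.1).trans (hC ?_)⟩
  exact ⟨_, ⟨_, ⟨f, rfl, z.2, rfl⟩, rfl⟩, rfl⟩

/-- The operator `Λ ⊗ 1` as a linear map. -/
def tensLM (Y : Type*) [NormedAddCommGroup Y] [NormedSpace ℝ Y] [FiniteDimensional ℝ Y]
    (Λ : 𝓢(E, ℂ) →L[ℂ] 𝓢(E', ℂ)) : 𝓢(E × Y, ℂ) →ₗ[ℂ] 𝓢(E' × Y, ℂ) where
  toFun f := Classical.choose (exists_tens Λ f)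
  map_add' f g := by
    ext z
    rw [add_apply, Classical.choose_spec (exists_tens Λ (f + g)),
      Classical.choose_spec (exists_tens Λ f), Classical.choose_spec (exists_tens Λ g)]
    simp
  map_smul' r f := by
    ext z
    rw [RingHom.id_apply, smul_apply, Classical.choose_spec (exists_tens Λ (r • f)),
      Classical.choose_spec (exists_tens Λ f)]
    simp

theorem tensLM_apply (Λ : 𝓢(E, ℂ) →L[ℂ] 𝓢(E', ℂ)) (f : 𝓢(E × Y, ℂ)) (z : E' × Y) :
    tensLM Y Λ f z = Λ (sliceAt z.2 f) z.1 := Classical.choose_spec (exists_tens Λ f) z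

theorem dirDeriv_tensLM_left (Λ : 𝓢(E, ℂ) →L[ℂ] 𝓢(E', ℂ)) (f : 𝓢(E × Y, ℂ)) (v : E') :
    dirDeriv (v, (0 : Y)) (tensLM Y Λ f) = tensLM Y (dirDeriv v ∘L Λ) f := by
  ext z
  refine (hasDerivAt_line_zero _ z (v, (0 : Y))).unique ?_
  simpa [tensLM_apply] using hasDerivAt_line_zero (Λ (sliceAt z.2 f)) z.1 v

theorem dirDeriv_tensLM_right (Λ : 𝓢(E, ℂ) →L[ℂ] 𝓢(E', ℂ)) (f : 𝓢(E × Y, ℂ)) (w : Y) :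
    dirDeriv ((0 : E'), w) (tensLM Y Λ f) = tensLM Y Λ (dirDeriv ((0 : E), w) f) := by
  ext z
  refine (hasDerivAt_line_zero _ z ((0 : E'), w)).unique ?_
  have := hasDerivAt_of_tendsto_slope (dirac z.1 ∘L Λ)
    (γ := fun s : ℝ => sliceAt (z.2 + s • w) f) (by simpa using tendsto_slope_sliceAt f z.2 w)
  simpa [tensLM_apply] using this

theorem mulForm_tensLM_left (Λ : 𝓢(E, ℂ) →L[ℂ] 𝓢(E', ℂ)) (f : 𝓢(E × Y, ℂ)) (c : E' →L[ℝ] ℝ) :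
    mulForm (c ∘L ContinuousLinearMap.fst ℝ E' Y) (tensLM Y Λ f) = tensLM Y (mulForm c ∘L Λ) f := by
  ext z
  simp [mulForm_apply, tensLM_apply]

theorem mulForm_tensLM_right (Λ : 𝓢(E, ℂ) →L[ℂ] 𝓢(E', ℂ)) (f : 𝓢(E × Y, ℂ)) (c : Y →L[ℝ] ℝ) :
    mulForm (c ∘L ContinuousLinearMap.snd ℝ E' Y) (tensLM Y Λ f) =
      tensLM Y Λ (mulForm (c ∘L ContinuousLinearMap.snd ℝ E Y) f) := by
  ext z
  have : sliceAt z.2 (mulForm (c ∘L ContinuousLinearMap.snd ℝ E Y) f) =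
      (c z.2 : ℂ) • sliceAt z.2 f := by
    ext x; simp [mulForm_apply]
  simp [mulForm_apply, tensLM_apply, this]

/-- The operator `Λ ⊗ 1`. -/
def tens (Y : Type*) [NormedAddCommGroup Y] [NormedSpace ℝ Y] [FiniteDimensional ℝ Y]
    (Λ : 𝓢(E, ℂ) →L[ℂ] 𝓢(E', ℂ)) : 𝓢(E × Y, ℂ) →L[ℂ] 𝓢(E' × Y, ℂ) where
  toLinearMap := tensLM Y Λ
  cont := by
    refine continuous_of_continuousAt_zero (tensLM Y Λ) ?_
    rw [ContinuousAt, map_zero]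
    obtain ⟨n, e, c, hrep⟩ := exists_frame E'
    obtain ⟨m, e', c', hrep'⟩ := exists_frame Y
    let G : Set (𝓢(E × Y, ℂ) → 𝓢(E' × Y, ℂ)) := {g | ∃ (Λ : 𝓢(E, ℂ) →L[ℂ] 𝓢(E', ℂ))
      (B : 𝓢(E × Y, ℂ) →L[ℂ] 𝓢(E × Y, ℂ)), g = fun f => tensLM Y Λ (B f)}
    have hG : SchwartzClosed (Sum.elim (fun i => (e i, (0 : Y))) (fun j => ((0 : E'), e' j)))
        (Sum.elim (fun i => c i ∘L ContinuousLinearMap.fst ℝ E' Y)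
        (fun j => c' j ∘L ContinuousLinearMap.snd ℝ E' Y)) G := by
      refine ⟨?_, ?_⟩
      · rintro _ ⟨Λ, B, rfl⟩ (i | j)
        · exact ⟨_, B, funext fun f => dirDeriv_tensLM_left Λ (B f) (e i)⟩
        · exact ⟨Λ, dirDeriv ((0 : E), e' j) ∘L B,
            funext fun f => dirDeriv_tensLM_right Λ (B f) (e' j)⟩
      · rintro _ ⟨Λ, B, rfl⟩ (i | j)
        · exact ⟨_, B, funext fun f => mulForm_tensLM_left Λ (B f) (c i)⟩
        · exact ⟨Λ, mulForm (c' j ∘L ContinuousLinearMap.snd ℝ E Y) ∘L B,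
            funext fun f => mulForm_tensLM_right Λ (B f) (c' j)⟩
    refine hG.tendsto (prod_frame hrep hrep') ?_ ⟨Λ, .id ℂ _, rfl⟩
    rintro _ ⟨Λ, B, rfl⟩ ε hε
    have h1 : Filter.Tendsto Λ (𝓝 0) (𝓝 0) := by
      simpa using Λ.continuous.tendsto 0
    have h2 : Filter.Tendsto B (𝓝 0) (𝓝 0) := by
      simpa using B.continuous.tendsto 0
    filter_upwards [h2.eventually (eventually_sliceAt_mem (Y := Y)
      (h1.eventually (eventually_sup_le hε)))] with f hf z
    rw [tensLM_apply]
    exact hf z.2 z.1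

@[simp] theorem tens_apply (Λ : 𝓢(E, ℂ) →L[ℂ] 𝓢(E', ℂ)) (f : 𝓢(E × Y, ℂ)) (z : E' × Y) :
    tens Y Λ f z = Λ (sliceAt z.2 f) z.1 := tensLM_apply Λ f z

end Tensor

/-! ### Contraction with a distribution and operators with a given kernel -/

section Contraction

variable {E F Y : Type*} [NormedAddCommGroup E] [NormedSpace ℝ E] [FiniteDimensional ℝ E]
  [NormedAddCommGroup F] [NormedSpace ℝ F] [FiniteDimensional ℝ F]
  [NormedAddCommGroup Y] [NormedSpace ℝ Y] [FiniteDimensional ℝ Y]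

/-- The constant function `1` on a point. -/
def schwartzOne : 𝓢(Fin 0 → ℝ, ℂ) :=
  HasCompactSupport.toSchwartzMap (f := fun _ => (1 : ℂ))
    (IsCompact.of_isClosed_subset isCompact_univ (isClosed_tsupport _) (Set.subset_univ _))
    contDiff_const

theorem hasTemperateGrowth_pair_left (x : E) : (fun y : Y => (x, y)).HasTemperateGrowth := by
  have h : (fun y : Y => (x, y)) = fun y => ContinuousLinearMap.inr ℝ E Y y + (x, 0) := by
    funext y; simp
  rw [h]
  fun_prop

theorem antilipschitz_pair_left (x : E) : AntilipschitzWith 1 fun y : Y => (x, y) :=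
  AntilipschitzWith.of_le_mul_dist fun y y' => by simp [Prod.dist_eq]

/-- `f ↦ f(x, ·)`. -/
def sliceLeft (x : E) : 𝓢(E × Y, ℂ) →L[ℂ] 𝓢(Y, ℂ) :=
  SchwartzMap.compCLMOfAntilipschitz ℂ (hasTemperateGrowth_pair_left x) (antilipschitz_pair_left x)

@[simp] theorem sliceLeft_apply (x : E) (f : 𝓢(E × Y, ℂ)) (y : Y) :
    sliceLeft x f y = f (x, y) := rfl

/-- The contraction `f ↦ (y ↦ u(f(·, y)))`. -/
def contract (u : 𝓢(E, ℂ) →L[ℂ] ℂ) : 𝓢(E × Y, ℂ) →L[ℂ] 𝓢(Y, ℂ) :=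
  -- A functional is an operator into the Schwartz functions on a point, so contraction is a case of
  -- `tens`.
  sliceLeft (0 : Fin 0 → ℝ) ∘L tens Y (u.smulRight schwartzOne)

@[simp] theorem contract_apply (u : 𝓢(E, ℂ) →L[ℂ] ℂ) (f : 𝓢(E × Y, ℂ)) (y : Y) :
    contract u f y = u (sliceAt y f) := by
  have h : ∀ p, schwartzOne p = 1 := fun _ => rfl
  simp [contract, h]

theorem dirDeriv_contract (u : 𝓢(E, ℂ) →L[ℂ] ℂ) (f : 𝓢(E × Y, ℂ)) (w : Y) :
    dirDeriv w (contract u f) = contract u (dirDeriv ((0 : E), w) f) := by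
  ext y
  refine (hasDerivAt_line_zero _ y w).unique ?_
  have := hasDerivAt_of_tendsto_slope u
    (γ := fun s : ℝ => sliceAt (y + s • w) f) (by simpa using tendsto_slope_sliceAt f y w)
  simpa using this

theorem mulForm_contract (u : 𝓢(E, ℂ) →L[ℂ] ℂ) (f : 𝓢(E × Y, ℂ)) (c : Y →L[ℝ] ℝ) :
    mulForm c (contract u f) = contract u (mulForm (c ∘L ContinuousLinearMap.snd ℝ E Y) f) := by
  ext y
  have : sliceAt y (mulForm (c ∘L ContinuousLinearMap.snd ℝ E Y) f) =
      (c y : ℂ) • sliceAt y f := by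
    ext x; simp [mulForm_apply]
  simp [mulForm_apply, this]

theorem schwartzClosed_contract {Θ : Type*} (u : Θ → 𝓢(E, ℂ) →L[ℂ] ℂ) (f : Θ → 𝓢(E × Y, ℂ))
    {n : ℕ} (e : Fin n → Y) (c : Fin n → Y →L[ℝ] ℝ) :
    SchwartzClosed e c {g | ∃ B : 𝓢(E × Y, ℂ) →L[ℂ] 𝓢(E × Y, ℂ),
      g = fun θ => contract (u θ) (B (f θ))} := by
  refine ⟨?_, ?_⟩
  · rintro _ ⟨B, rfl⟩ i
    exact ⟨dirDeriv ((0 : E), e i) ∘L B, funext fun θ => dirDeriv_contract _ _ _⟩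
  · rintro _ ⟨B, rfl⟩ i
    exact ⟨mulForm (c i ∘L ContinuousLinearMap.snd ℝ E Y) ∘L B,
      funext fun θ => mulForm_contract _ _ _⟩

/-- The operator `𝓢' → 𝓢` with kernel `f`: `u ↦ (y ↦ u(f(·, y)))`. -/
def kernelOp (f : 𝓢(E × Y, ℂ)) : (𝓢(E, ℂ) →L[ℂ] ℂ) →L[ℂ] 𝓢(Y, ℂ) where
  toFun u := contract u f
  map_add' u v := by ext y; simp
  map_smul' r u := by ext y; simp
  cont := by
    let L : (𝓢(E, ℂ) →L[ℂ] ℂ) →ₗ[ℂ] 𝓢(Y, ℂ) :=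
      { toFun := fun u => contract u f
        map_add' := fun u v => by ext y; simp
        map_smul' := fun r u => by ext y; simp }
    refine continuous_of_continuousAt_zero L ?_
    rw [ContinuousAt, map_zero]
    obtain ⟨n, e, c, hrep⟩ := exists_frame Y
    refine (schwartzClosed_contract (fun u => u) (fun _ => f) e c).tendsto hrep ?_ ⟨.id ℂ _, rfl⟩
    rintro _ ⟨B, rfl⟩ ε hε
    have hb : Bornology.IsVonNBounded ℂ {g : 𝓢(E, ℂ) | ∃ f' ∈ ({B f} : Set 𝓢(E × Y, ℂ)),
      ∃ y : Y, g = sliceAt y f'} := isVonNBounded_sliceAt (Bornology.isVonNBounded_singleton _)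
    filter_upwards [ContinuousLinearMap.eventually_nhds_zero_mapsTo hb
      (Metric.closedBall_mem_nhds (0 : ℂ) hε)] with u hu y
    have := hu ⟨_, rfl, y, rfl⟩
    simpa using this

@[simp] theorem kernelOp_apply (f : 𝓢(E × Y, ℂ)) (u : 𝓢(E, ℂ) →L[ℂ] ℂ) (y : Y) :
    kernelOp f u y = u (sliceAt y f) := contract_apply u f y

/-- `kernelOp` as a continuous linear map. -/
def kernelOpCLM (E Y : Type*) [NormedAddCommGroup E] [NormedSpace ℝ E] [FiniteDimensional ℝ E]
    [NormedAddCommGroup Y] [NormedSpace ℝ Y] [FiniteDimensional ℝ Y] :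
    𝓢(E × Y, ℂ) →L[ℂ] ((𝓢(E, ℂ) →L[ℂ] ℂ) →L[ℂ] 𝓢(Y, ℂ)) where
  toFun := kernelOp
  map_add' f g := by ext u y; simp
  map_smul' r f := by ext u y; simp
  cont := by
    let L : 𝓢(E × Y, ℂ) →ₗ[ℂ] ((𝓢(E, ℂ) →L[ℂ] ℂ) →L[ℂ] 𝓢(Y, ℂ)) :=
      { toFun := kernelOp
        map_add' := fun f g => by ext u y; simp
        map_smul' := fun r f => by ext u y; simp }
    -- Schwartz space is first countable, so it suffices that bounded sets are mapped to bounded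
    -- sets.
    refine LinearMap.continuous_of_locally_bounded (𝕜 := ℂ) (𝕜' := ℂ) (σ := RingHom.id ℂ)
      (E := 𝓢(E × Y, ℂ)) (F := (𝓢(E, ℂ) →L[ℂ] ℂ) →L[ℂ] 𝓢(Y, ℂ)) L fun S hS => ?_
    rw [ContinuousLinearMap.isVonNBounded_iff]
    intro U hU
    obtain ⟨n, e, c, hrep⟩ := exists_frame Y
    have h := (schwartzClosed_contract (fun p : U × S => (p.1 : 𝓢(E, ℂ) →L[ℂ] ℂ))
      (fun p => (p.2 : 𝓢(E × Y, ℂ))) e c).isVonNBounded hrep ?_ ⟨.id ℂ _, rfl⟩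
    · refine h.subset ?_
      rintro _ ⟨_, ⟨f, hf, rfl⟩, u, hu, rfl⟩
      exact ⟨(⟨u, hu⟩, ⟨f, hf⟩), rfl⟩
    · rintro _ ⟨B, rfl⟩
      have h1 : Bornology.IsVonNBounded ℂ {g : 𝓢(E, ℂ) | ∃ f' ∈ B '' S,
        ∃ y : Y, g = sliceAt y f'} := isVonNBounded_sliceAt (hS.image B)
      have h2 := ContinuousLinearMap.isVonNBounded_image2_apply hU h1
      rw [NormedSpace.isVonNBounded_iff] at h2
      obtain ⟨M, hM⟩ := h2.exists_norm_le
      refine ⟨M, fun p y => hM _ ?_⟩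
      exact ⟨_, p.1.2, _, ⟨_, ⟨_, p.2.2, rfl⟩, y, rfl⟩, (contract_apply _ _ _).symm⟩

@[simp] theorem kernelOpCLM_apply (f : 𝓢(E × Y, ℂ)) : kernelOpCLM E Y f = kernelOp f := rfl

end Contraction

/-! ### Dirac masses in the strong dual and Schwartz kernels of operators -/

section Kernel

variable {E F Y : Type*} [NormedAddCommGroup E] [NormedSpace ℝ E] [FiniteDimensional ℝ E]
  [NormedAddCommGroup F] [NormedSpace ℝ F] [FiniteDimensional ℝ F]
  [NormedAddCommGroup Y] [NormedSpace ℝ Y] [FiniteDimensional ℝ Y]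

theorem seminorm_le_of_isVonNBounded {B : Set 𝓢(E, ℂ)} (hB : Bornology.IsVonNBounded ℂ B)
    (k n : ℕ) : ∃ C : ℝ, 0 ≤ C ∧ ∀ f ∈ B, SchwartzMap.seminorm ℂ k n f ≤ C := by
  rw [(schwartz_withSeminorms ℂ E ℂ).isVonNBounded_iff_seminorm_bddAbove] at hB
  obtain ⟨C, hC⟩ := hB (k, n)
  exact ⟨max 0 C, le_max_left _ _, fun f hf => le_max_of_le_right (hC ⟨f, hf, rfl⟩)⟩

theorem sup_le_of_isVonNBounded {B : Set 𝓢(E, ℂ)} (hB : Bornology.IsVonNBounded ℂ B) :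
    ∃ C : ℝ, 0 ≤ C ∧ ∀ f ∈ B, ∀ x, ‖f x‖ ≤ C := by
  obtain ⟨C, hC, h⟩ := seminorm_le_of_isVonNBounded hB 0 0
  exact ⟨C, hC, fun f hf x => (SchwartzMap.norm_le_seminorm ℂ f x).trans (h f hf)⟩

/-- Convergence to zero in the strong dual: uniform convergence on bounded sets. -/
theorem tendsto_strongDual_zero {Θ : Type*} {l : Filter Θ} {u : Θ → 𝓢(E, ℂ) →L[ℂ] ℂ}
    (h : ∀ B : Set 𝓢(E, ℂ), Bornology.IsVonNBounded ℂ B → ∀ ε : ℝ, 0 < ε →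
      ∀ᶠ θ in l, ∀ f ∈ B, ‖u θ f‖ ≤ ε) : Filter.Tendsto u l (𝓝 0) := by
  rw [(ContinuousLinearMap.hasBasis_nhds_zero_of_basis
    (Metric.nhds_basis_closedBall (x := (0 : ℂ)))).tendsto_right_iff]
  rintro ⟨B, ε⟩ ⟨hB, hε⟩
  filter_upwards [h B hB ε hε] with θ hθ f hf
  simpa using hθ f hf

theorem isVonNBounded_range_dirac : Bornology.IsVonNBounded ℂ (Set.range (dirac (E := E))) := by
  rw [ContinuousLinearMap.isVonNBounded_iff]
  intro B hB
  rw [NormedSpace.isVonNBounded_iff]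
  obtain ⟨C, -, h⟩ := sup_le_of_isVonNBounded hB
  refine isBounded_iff_forall_norm_le.2 ⟨C, ?_⟩
  rintro _ ⟨_, ⟨x, rfl⟩, f, hf, rfl⟩
  exact h f hf x

theorem continuous_dirac : Continuous (dirac (E := E)) := by
  rw [continuous_iff_continuousAt]
  intro y
  have h : Filter.Tendsto (fun y' => dirac y' - dirac y) (𝓝 y) (𝓝 0) := by
    refine tendsto_strongDual_zero fun B hB ε hε => ?_
    obtain ⟨C, hC, h⟩ := seminorm_le_of_isVonNBounded hB 0 1
    have h1 : Filter.Tendsto (fun y' => C * ‖y' - y‖) (𝓝 y) (𝓝 0) := by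
      have : Continuous fun y' => C * ‖y' - y‖ := by fun_prop
      simpa using this.tendsto y
    filter_upwards [h1.eventually_le_const hε] with y' hy' f hf
    refine le_trans ?_ hy'
    refine (norm_sub_le_seminorm f y' y).trans ?_
    gcongr
    exact h f hf
  have h2 := h.add_const (dirac y)
  simpa [ContinuousAt] using h2

/-- The Taylor remainder is controlled by the second derivative, uniformly over a bounded set of
test functions, so y ↦ δ_y is differentiable for the strong topology. -/
theorem tendsto_slope_dirac (y w : E) :
    Filter.Tendsto (fun s : ℝ => s⁻¹ • (dirac (y + s • w) - dirac y)) (𝓝[≠] 0)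
      (𝓝 (dirac y ∘L dirDeriv w)) := by
  have h : Filter.Tendsto (fun s : ℝ => s⁻¹ • (dirac (y + s • w) - dirac y) -
      dirac y ∘L dirDeriv w) (𝓝[≠] 0) (𝓝 0) := by
    refine tendsto_strongDual_zero fun B hB ε hε => ?_
    obtain ⟨C, hC, h⟩ := sup_le_of_isVonNBounded (hB.image (dirDeriv w ∘L dirDeriv w))
    have h1 : Filter.Tendsto (fun s : ℝ => C * |s|) (𝓝[≠] 0) (𝓝 0) := by
      have : Continuous fun s : ℝ => C * |s| := by fun_prop
      have h0 := this.tendsto 0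
      simp only [abs_zero, mul_zero] at h0
      exact h0.mono_left nhdsWithin_le_nhds
    filter_upwards [h1.eventually_le_const hε, self_mem_nhdsWithin] with s hs hs0 f hf
    refine le_trans ?_ hs
    have hs0 : s ≠ 0 := hs0
    have h2 := norm_taylor_le f w (h _ ⟨f, hf, rfl⟩) y s
    have h3 : (s⁻¹ • (dirac (y + s • w) - dirac y) - dirac y ∘L dirDeriv w) f =
        s⁻¹ • (f (y + s • w) - f y - s • dirDeriv w f y) := by
      simp only [sub_apply, smul_apply, dirac_apply, smul_sub, inv_smul_smul₀ hs0,
        ContinuousLinearMap.comp_apply]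
    rw [h3, norm_smul]
    calc ‖s⁻¹‖ * _ ≤ ‖s⁻¹‖ * (C * s ^ 2) := by gcongr
      _ = C * |s| := by
        rw [norm_inv, Real.norm_eq_abs, ← sq_abs]
        field_simp
  have h2 := h.add_const (dirac y ∘L dirDeriv w)
  simpa using h2

/-- The transpose `u ↦ u ∘ B`. -/
abbrev transposeOp (B : 𝓢(E, ℂ) →L[ℂ] 𝓢(F, ℂ)) : (𝓢(F, ℂ) →L[ℂ] ℂ) →L[ℂ] (𝓢(E, ℂ) →L[ℂ] ℂ) :=
  ContinuousLinearMap.precomp ℂ B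

theorem hasDerivAt_kernel (T : (𝓢(Y, ℂ) →L[ℂ] ℂ) →L[ℂ] 𝓢(E, ℂ)) (x : E) (y w : Y) :
    HasDerivAt (fun s : ℝ => T (dirac (y + s • w)) x)
      ((T ∘L transposeOp (dirDeriv w)) (dirac y) x) 0 :=
  hasDerivAt_of_tendsto_slope (dirac x ∘L T) (γ := fun s : ℝ => dirac (y + s • w))
    (by simpa using tendsto_slope_dirac y w)

theorem transpose_mulForm_dirac (c : Y →L[ℝ] ℝ) (y : Y) :
    transposeOp (mulForm c) (dirac y) = (c y : ℂ) • dirac y := by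
  ext f
  exact mulForm_apply c f y

/-- The functions (x, y) ↦ T(δ_y)(x), over all T, form a closed class: operations in x are composed
on the left of T, and operations in y on the right, because ∂δ_y and y δ_y are transposes applied to
δ_y. Boundedness holds because the Dirac masses are a bounded set in the strong dual. -/
theorem exists_kernel (T : (𝓢(Y, ℂ) →L[ℂ] ℂ) →L[ℂ] 𝓢(E, ℂ)) :
    ∃ g : 𝓢(E × Y, ℂ), ∀ z, g z = T (dirac z.2) z.1 := by
  obtain ⟨n, e, c, hrep⟩ := exists_frame E
  obtain ⟨m, e', c', hrep'⟩ := exists_frame Y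
  let G : Set (Unit → E × Y → ℂ) := {g | ∃ T : (𝓢(Y, ℂ) →L[ℂ] ℂ) →L[ℂ] 𝓢(E, ℂ),
    g = fun _ z => T (dirac z.2) z.1}
  have hG : DerivClosed (Sum.elim (fun i => (e i, (0 : Y))) (fun j => ((0 : E), e' j)))
      (Sum.elim (fun i => c i ∘L ContinuousLinearMap.fst ℝ E Y)
      (fun j => c' j ∘L ContinuousLinearMap.snd ℝ E Y)) G := by
    refine ⟨?_, ?_, ?_⟩
    · rintro _ ⟨T, rfl⟩ _
      exact continuous_schwartz_eval
        (T.continuous.comp (continuous_dirac.comp continuous_snd)) continuous_fst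
    · rintro _ ⟨T, rfl⟩ (i | j)
      · refine ⟨_, ⟨dirDeriv (e i) ∘L T, rfl⟩, fun _ z => ?_⟩
        simpa using hasDerivAt_line_zero (T (dirac z.2)) z.1 (e i)
      · refine ⟨_, ⟨T ∘L transposeOp (dirDeriv (e' j)), rfl⟩, fun _ z => ?_⟩
        simpa using hasDerivAt_kernel T z.1 z.2 (e' j)
    · rintro _ ⟨T, rfl⟩ (i | j)
      · exact ⟨_, ⟨mulForm (c i) ∘L T, rfl⟩, fun _ z => by simp [mulForm_apply]⟩
      · refine ⟨_, ⟨T ∘L transposeOp (mulForm (c' j)), rfl⟩, fun _ z => ?_⟩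
        rw [ContinuousLinearMap.comp_apply, transpose_mulForm_dirac]
        simp
  refine hG.exists_schwartz (prod_frame hrep hrep') ?_ ⟨T, rfl⟩ ()
  rintro _ ⟨T, rfl⟩ _
  obtain ⟨C, -, hC⟩ := sup_le_of_isVonNBounded (isVonNBounded_range_dirac.image T)
  exact ⟨C, fun z => hC _ ⟨_, ⟨z.2, rfl⟩, rfl⟩ z.1⟩

/-- The kernel of an operator `𝓢' → 𝓢` as a Schwartz function. -/
def kernelLM (E Y : Type*) [NormedAddCommGroup E] [NormedSpace ℝ E] [FiniteDimensional ℝ E]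
    [NormedAddCommGroup Y] [NormedSpace ℝ Y] [FiniteDimensional ℝ Y] :
    ((𝓢(Y, ℂ) →L[ℂ] ℂ) →L[ℂ] 𝓢(E, ℂ)) →ₗ[ℂ] 𝓢(E × Y, ℂ) where
  toFun T := Classical.choose (exists_kernel T)
  map_add' T S := by
    ext z
    rw [add_apply, Classical.choose_spec (exists_kernel (T + S)),
      Classical.choose_spec (exists_kernel T), Classical.choose_spec (exists_kernel S)]
    simp
  map_smul' r T := by
    ext z
    rw [RingHom.id_apply, smul_apply, Classical.choose_spec (exists_kernel (r • T)),
      Classical.choose_spec (exists_kernel T)]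
    simp

theorem kernelLM_apply (T : (𝓢(Y, ℂ) →L[ℂ] ℂ) →L[ℂ] 𝓢(E, ℂ)) (z : E × Y) :
    kernelLM E Y T z = T (dirac z.2) z.1 := Classical.choose_spec (exists_kernel T) z

theorem dirDeriv_kernelLM_left (T : (𝓢(Y, ℂ) →L[ℂ] ℂ) →L[ℂ] 𝓢(E, ℂ)) (v : E) :
    dirDeriv (v, (0 : Y)) (kernelLM E Y T) = kernelLM E Y (dirDeriv v ∘L T) := by
  ext z
  refine (hasDerivAt_line_zero _ z (v, (0 : Y))).unique ?_
  simpa [kernelLM_apply] using hasDerivAt_line_zero (T (dirac z.2)) z.1 v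

theorem dirDeriv_kernelLM_right (T : (𝓢(Y, ℂ) →L[ℂ] ℂ) →L[ℂ] 𝓢(E, ℂ)) (w : Y) :
    dirDeriv ((0 : E), w) (kernelLM E Y T) = kernelLM E Y (T ∘L transposeOp (dirDeriv w)) := by
  ext z
  refine (hasDerivAt_line_zero _ z ((0 : E), w)).unique ?_
  simpa [kernelLM_apply] using hasDerivAt_kernel T z.1 z.2 w

theorem mulForm_kernelLM_left (T : (𝓢(Y, ℂ) →L[ℂ] ℂ) →L[ℂ] 𝓢(E, ℂ)) (c : E →L[ℝ] ℝ) :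
    mulForm (c ∘L ContinuousLinearMap.fst ℝ E Y) (kernelLM E Y T) =
      kernelLM E Y (mulForm c ∘L T) := by
  ext z
  simp [mulForm_apply, kernelLM_apply]

theorem mulForm_kernelLM_right (T : (𝓢(Y, ℂ) →L[ℂ] ℂ) →L[ℂ] 𝓢(E, ℂ)) (c : Y →L[ℝ] ℝ) :
    mulForm (c ∘L ContinuousLinearMap.snd ℝ E Y) (kernelLM E Y T) =
      kernelLM E Y (T ∘L transposeOp (mulForm c)) := by
  ext z
  rw [kernelLM_apply, ContinuousLinearMap.comp_apply T, transpose_mulForm_dirac]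
  simp [mulForm_apply, kernelLM_apply]

/-- The kernel map as a continuous linear map. -/
def kernelCLM (E Y : Type*) [NormedAddCommGroup E] [NormedSpace ℝ E] [FiniteDimensional ℝ E]
    [NormedAddCommGroup Y] [NormedSpace ℝ Y] [FiniteDimensional ℝ Y] :
    ((𝓢(Y, ℂ) →L[ℂ] ℂ) →L[ℂ] 𝓢(E, ℂ)) →L[ℂ] 𝓢(E × Y, ℂ) where
  toLinearMap := kernelLM E Y
  cont := by
    refine continuous_of_continuousAt_zero (kernelLM E Y) ?_
    rw [ContinuousAt, map_zero]
    obtain ⟨n, e, c, hrep⟩ := exists_frame E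
    obtain ⟨m, e', c', hrep'⟩ := exists_frame Y
    let G : Set (((𝓢(Y, ℂ) →L[ℂ] ℂ) →L[ℂ] 𝓢(E, ℂ)) → 𝓢(E × Y, ℂ)) :=
      {g | ∃ (A : 𝓢(E, ℂ) →L[ℂ] 𝓢(E, ℂ)) (B : 𝓢(Y, ℂ) →L[ℂ] 𝓢(Y, ℂ)),
        g = fun T => kernelLM E Y (A ∘L T ∘L transposeOp B)}
    have hG : SchwartzClosed (Sum.elim (fun i => (e i, (0 : Y))) (fun j => ((0 : E), e' j)))
        (Sum.elim (fun i => c i ∘L ContinuousLinearMap.fst ℝ E Y)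
        (fun j => c' j ∘L ContinuousLinearMap.snd ℝ E Y)) G := by
      refine ⟨?_, ?_⟩
      · rintro _ ⟨A, B, rfl⟩ (i | j)
        · exact ⟨dirDeriv (e i) ∘L A, B, funext fun T => dirDeriv_kernelLM_left _ (e i)⟩
        · exact ⟨A, dirDeriv (e' j) ∘L B, funext fun T => dirDeriv_kernelLM_right _ (e' j)⟩
      · rintro _ ⟨A, B, rfl⟩ (i | j)
        · exact ⟨mulForm (c i) ∘L A, B, funext fun T => mulForm_kernelLM_left _ (c i)⟩
        · exact ⟨A, mulForm (c' j) ∘L B, funext fun T => mulForm_kernelLM_right _ (c' j)⟩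
    refine hG.tendsto (prod_frame hrep hrep') ?_ ⟨.id ℂ _, .id ℂ _, rfl⟩
    rintro _ ⟨A, B, rfl⟩ ε hε
    have hA : Filter.Tendsto A (𝓝 0) (𝓝 0) := by
      simpa using A.continuous.tendsto 0
    have hB := isVonNBounded_range_dirac.image (transposeOp B)
    filter_upwards [ContinuousLinearMap.eventually_nhds_zero_mapsTo hB
      (hA.eventually (eventually_sup_le hε))] with T hT z
    rw [kernelLM_apply]
    exact hT ⟨_, ⟨z.2, rfl⟩, rfl⟩ z.1

@[simp] theorem kernelCLM_apply (T : (𝓢(Y, ℂ) →L[ℂ] ℂ) →L[ℂ] 𝓢(E, ℂ)) (z : E × Y) :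
    kernelCLM E Y T z = T (dirac z.2) z.1 := kernelLM_apply T z

end Kernel

/-! ### Weak integrals of Dirac masses and partial integration -/

section WeakIntegral

variable {E F Y : Type*} [NormedAddCommGroup E] [NormedSpace ℝ E] [FiniteDimensional ℝ E]
  [NormedAddCommGroup F] [NormedSpace ℝ F] [FiniteDimensional ℝ F]
  [NormedAddCommGroup Y] [NormedSpace ℝ Y] [FiniteDimensional ℝ Y]

/-- A linear functional dominated by a linear map into a Banach space commutes with integrals. -/
theorem integral_comm_of_norm_le {X W T : Type*} [AddCommGroup X] [Module ℂ X]
    [NormedAddCommGroup W] [NormedSpace ℂ W] [CompleteSpace W] [MeasurableSpace T]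
    {μ : MeasureTheory.Measure T} (φ : X →ₗ[ℂ] ℂ) (L : X →ₗ[ℂ] W) {C : ℝ}
    (h : ∀ x, ‖φ x‖ ≤ C * ‖L x‖) {k : T → X} (hk : MeasureTheory.Integrable (fun y => L (k y)) μ)
    {x₀ : X} (hx₀ : L x₀ = ∫ y, L (k y) ∂μ) : φ x₀ = ∫ y, φ (k y) ∂μ := by
  -- By the bound, φ vanishes on the kernel of L and factors through its range. Hahn–Banach extends
  -- the factor to W, where continuous functionals commute with Bochner integrals.
  obtain ⟨ψ, hψ⟩ : ∃ ψ : LinearMap.range L →ₗ[ℂ] ℂ, ∀ x, ψ ⟨L x, x, rfl⟩ = φ x := by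
    obtain ⟨r, hr⟩ := L.rangeRestrict.exists_rightInverse_of_surjective L.range_rangeRestrict
    refine ⟨φ ∘ₗ r, fun x => ?_⟩
    have h1 : L (r ⟨L x, x, rfl⟩) = L x := by
      have := LinearMap.congr_fun hr ⟨L x, x, rfl⟩
      exact congrArg Subtype.val this
    have h2 := h (r ⟨L x, x, rfl⟩ - x)
    rw [map_sub, map_sub, h1, sub_self, norm_zero, mul_zero] at h2
    exact sub_eq_zero.1 (norm_le_zero_iff.1 h2)
  obtain ⟨Ψ, hΨ, -⟩ := exists_extension_norm_eq (LinearMap.range L) (ψ.mkContinuous C (by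
    rintro ⟨_, x, rfl⟩
    rw [hψ]
    exact h x))
  have h3 : ∀ x, Ψ (L x) = φ x := fun x => (hΨ ⟨L x, x, rfl⟩).trans (hψ x)
  rw [← h3, hx₀, ← Ψ.integral_comp_comm hk]
  simp only [h3]

/-- Every continuous functional on the strong dual is bounded by a supremum over a bounded set. -/
theorem exists_bounded_of_continuous (φ : (𝓢(Y, ℂ) →L[ℂ] ℂ) →L[ℂ] ℂ) :
    ∃ B : Set 𝓢(Y, ℂ), Bornology.IsVonNBounded ℂ B ∧ ∃ C : ℝ, ∀ (u : 𝓢(Y, ℂ) →L[ℂ] ℂ) (M : ℝ), 0 ≤ M →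
      (∀ f ∈ B, ‖u f‖ ≤ M) → ‖φ u‖ ≤ C * M := by
  have h0 : φ ⁻¹' Metric.closedBall 0 1 ∈ 𝓝 0 :=
    φ.continuous.continuousAt.preimage_mem_nhds (by
      rw [map_zero]; exact Metric.closedBall_mem_nhds _ one_pos)
  obtain ⟨⟨B, ε⟩, ⟨hB, hε⟩, h⟩ := (ContinuousLinearMap.hasBasis_nhds_zero_of_basis
    (Metric.nhds_basis_closedBall (x := (0 : ℂ)))).mem_iff.1 h0
  replace hε : 0 < ε := hε
  have key : ∀ (u : 𝓢(Y, ℂ) →L[ℂ] ℂ) (M : ℝ), 0 < M → (∀ f ∈ B, ‖u f‖ ≤ M) → ‖φ u‖ ≤ ε⁻¹ * M := by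
    intro u M hM hu
    have h1 : (((ε / M : ℝ) : ℂ) • u) ∈ φ ⁻¹' Metric.closedBall 0 1 := h (by
      intro f hf
      have := hu f hf
      simp only [mem_closedBall_zero_iff, smul_apply, norm_smul, Complex.norm_real,
        Real.norm_eq_abs, abs_of_pos (div_pos hε hM)]
      calc ε / M * ‖u f‖ ≤ ε / M * M := by gcongr
        _ = ε := by field_simp)
    simp only [Set.mem_preimage, map_smul, mem_closedBall_zero_iff, norm_smul, Complex.norm_real,
      Real.norm_eq_abs, abs_of_pos (div_pos hε hM)] at h1
    calc ‖φ u‖ = (ε⁻¹ * M) * (ε / M * ‖φ u‖) := by field_simp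
      _ ≤ (ε⁻¹ * M) * 1 := by gcongr
      _ = _ := mul_one _
  refine ⟨B, hB, ε⁻¹, fun u M hM hu => ?_⟩
  refine le_of_forall_pos_le_add fun δ hδ => ?_
  -- The rescaling in `key` needs a positive bound, so M is enlarged by ε * δ and δ is arbitrary.
  have := key u (M + ε * δ) (by positivity) fun f hf => (hu f hf).trans (by nlinarith)
  calc ‖φ u‖ ≤ ε⁻¹ * (M + ε * δ) := this
    _ = _ := by field_simp

theorem exists_decay_bound {B : Set 𝓢(Y, ℂ)} (hB : Bornology.IsVonNBounded ℂ B) (r : ℕ) :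
    ∃ C : ℝ, 0 ≤ C ∧ ∀ f ∈ B, ∀ y, ‖f y‖ ≤ C * (1 + ‖y‖) ^ (-(r : ℝ)) := by
  have h := ((schwartz_withSeminorms ℂ Y ℂ).isVonNBounded_iff_finset_seminorm_bounded.1 hB)
    (Finset.Iic (r, 0))
  obtain ⟨C, hC, h⟩ := h
  refine ⟨2 ^ r * C, by positivity, fun f hf y => ?_⟩
  have h1 := SchwartzMap.one_add_le_sup_seminorm_apply (𝕜 := ℂ) (m := (r, 0)) le_rfl le_rfl f y
  rw [norm_iteratedFDeriv_zero] at h1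
  have h2 : (0 : ℝ) < (1 + ‖y‖) ^ r := by positivity
  rw [Real.rpow_neg (by positivity), Real.rpow_natCast, ← div_eq_mul_inv, le_div_iff₀ h2, mul_comm]
  refine h1.trans ?_
  exact mul_le_mul_of_nonneg_left (h f hf).le (by positivity)

variable [MeasureTheory.MeasureSpace Y] [BorelSpace Y]
  [(MeasureTheory.volume : MeasureTheory.Measure Y).IsAddHaarMeasure]

/-- Integration. -/
def integralDual (Y : Type*) [NormedAddCommGroup Y] [NormedSpace ℝ Y] [FiniteDimensional ℝ Y]
    [MeasureTheory.MeasureSpace Y] [BorelSpace Y]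
    [(MeasureTheory.volume : MeasureTheory.Measure Y).IsAddHaarMeasure] : 𝓢(Y, ℂ) →L[ℂ] ℂ :=
  SchwartzMap.integralCLM ℂ MeasureTheory.volume

@[simp] theorem integralDual_apply (f : 𝓢(Y, ℂ)) : integralDual Y f = ∫ y, f y :=
  SchwartzMap.integralCLM_apply ℂ f

/-- Integration is the weak integral of the Dirac masses in the strong dual. -/
theorem apply_integralDual (φ : (𝓢(Y, ℂ) →L[ℂ] ℂ) →L[ℂ] ℂ) :
    φ (integralDual Y) = ∫ y, φ (dirac y) := by
  obtain ⟨B, hB, C, hC⟩ := exists_bounded_of_continuous φ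
  have hbd : ∀ u : 𝓢(Y, ℂ) →L[ℂ] ℂ, ∃ M, ∀ f ∈ B, ‖u f‖ ≤ M := by
    intro u
    have h1 := hB.image u
    rw [NormedSpace.isVonNBounded_iff, isBounded_iff_forall_norm_le] at h1
    obtain ⟨M, hM⟩ := h1
    exact ⟨M, fun f hf => hM _ ⟨f, hf, rfl⟩⟩
  choose M hM using hbd
  -- The strong dual is not normed. Restriction to the bounded set B that controls φ maps it into a
  -- Banach space, in which y ↦ δ_y has a Bochner integral.
  let L : (𝓢(Y, ℂ) →L[ℂ] ℂ) →ₗ[ℂ] BoundedContinuousFunction B ℂ :=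
    { toFun := fun u => BoundedContinuousFunction.ofNormedAddCommGroup (fun f : B => u f)
        (u.continuous.comp continuous_subtype_val) (M u) fun f => hM u f f.2
      map_add' := fun u v => by ext f; rfl
      map_smul' := fun r u => by ext f; rfl }
  have hL : ∀ u f, L u f = u f := fun u f => rfl
  -- Decay of order one above the dimension, uniform over B, makes y ↦ δ_y integrable.
  obtain ⟨D, hD, hdec⟩ := exists_decay_bound hB (Module.finrank ℝ Y + 1)
  obtain ⟨D', hD', hlip⟩ := seminorm_le_of_isVonNBounded hB 0 1
  have hcont : Continuous fun y => L (dirac y) := by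
    refine (LipschitzWith.of_dist_le_mul (K := ⟨D', hD'⟩) fun y y' => ?_).continuous
    refine (BoundedContinuousFunction.dist_le (mul_nonneg hD' dist_nonneg)).2 fun f => ?_
    rw [hL, hL, dirac_apply, dirac_apply, dist_eq_norm, dist_eq_norm]
    refine (norm_sub_le_seminorm _ y y').trans ?_
    exact mul_le_mul_of_nonneg_right (hlip f f.2) (norm_nonneg _)
  have hint : MeasureTheory.Integrable fun y => L (dirac y) := by
    refine MeasureTheory.Integrable.mono' ((integrable_one_add_norm
      (r := ((Module.finrank ℝ Y + 1 : ℕ) : ℝ)) (by push_cast; linarith)).const_mul D)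
      hcont.aestronglyMeasurable (Filter.Eventually.of_forall fun y => ?_)
    exact (BoundedContinuousFunction.norm_le (by positivity)).2 fun f => hdec f f.2 y
  refine integral_comm_of_norm_le φ.toLinearMap L (C := C)
    (fun u => hC u _ (norm_nonneg _) fun f hf => (L u).norm_coe_le_norm ⟨f, hf⟩) hint ?_
  ext f
  have h2 := (BoundedContinuousFunction.evalCLM ℂ f).integral_comp_comm hint
  simp only [BoundedContinuousFunction.evalCLM_apply] at h2
  rw [← h2, hL, integralDual_apply]
  rfl

/-- Swapping the variables. -/
def swapVars (E Y : Type*) [NormedAddCommGroup E] [NormedSpace ℝ E]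
    [NormedAddCommGroup Y] [NormedSpace ℝ Y] : 𝓢(E × Y, ℂ) →L[ℂ] 𝓢(Y × E, ℂ) :=
  SchwartzMap.compCLMOfContinuousLinearEquiv ℂ (ContinuousLinearEquiv.prodComm ℝ Y E)

@[simp] theorem swapVars_apply (f : 𝓢(E × Y, ℂ)) (z : Y × E) : swapVars E Y f z = f (z.2, z.1) := rfl

/-- The integral of a Schwartz function of two variables over the second one. -/
def integralRight (E Y : Type*) [NormedAddCommGroup E] [NormedSpace ℝ E] [FiniteDimensional ℝ E]
    [NormedAddCommGroup Y] [NormedSpace ℝ Y] [FiniteDimensional ℝ Y]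
    [MeasureTheory.MeasureSpace Y] [BorelSpace Y]
    [(MeasureTheory.volume : MeasureTheory.Measure Y).IsAddHaarMeasure] :
    𝓢(E × Y, ℂ) →L[ℂ] 𝓢(E, ℂ) := contract (integralDual Y) ∘L swapVars E Y

@[simp] theorem integralRight_apply (f : 𝓢(E × Y, ℂ)) (x : E) :
    integralRight E Y f x = ∫ y, f (x, y) := by
  simp [integralRight]

/-- Continuous linear functionals commute with partial integrals. -/
theorem apply_integralRight (v : 𝓢(E, ℂ) →L[ℂ] ℂ) (f : 𝓢(E × Y, ℂ)) :
    v (integralRight E Y f) = ∫ y, v (sliceAt y f) := by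
  -- The partial integral is the operator with kernel f applied to the distribution 1, so v composed
  -- with that operator is a functional on the strong dual.
  have h := apply_integralDual (v ∘L kernelOp (swapVars E Y f))
  have h1 : ∀ y, kernelOp (swapVars E Y f) (dirac y) = sliceAt y f := by
    intro y; ext x; simp [kernelOp_apply]
  have h2 : kernelOp (swapVars E Y f) (integralDual Y) = integralRight E Y f := by
    ext x; simp [kernelOp_apply]
  simpa [h1, h2] using h

/-- Continuous linear operators commute with partial integrals. -/
theorem map_integralRight (A : 𝓢(E, ℂ) →L[ℂ] 𝓢(F, ℂ)) (f : 𝓢(E × Y, ℂ)) (x : F) :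
    A (integralRight E Y f) x = ∫ y, A (sliceAt y f) x :=
  apply_integralRight (dirac x ∘L A) f

end WeakIntegral

/-! ### Density of the span of the Dirac masses -/

section Dense

variable {E Y : Type*} [NormedAddCommGroup E] [NormedSpace ℝ E] [FiniteDimensional ℝ E]
  [NormedAddCommGroup Y] [NormedSpace ℝ Y] [FiniteDimensional ℝ Y]

/-- `f ↦ ((x, y) ↦ f(x) g(y))`. -/
def tensorRight (g : 𝓢(Y, ℂ)) : 𝓢(E, ℂ) →L[ℂ] 𝓢(E × Y, ℂ) :=
  -- f is viewed on a point times E, and the operator sending a value at the point to a multiple of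
  -- g is tensored with the identity on E.
  swapVars Y E ∘L tens E ((dirac (0 : Fin 0 → ℝ)).smulRight g) ∘L
    SchwartzMap.compCLMOfContinuousLinearEquiv ℂ
      ((ContinuousLinearEquiv.prodComm ℝ (Fin 0 → ℝ) E).trans
        (ContinuousLinearEquiv.prodUnique ℝ E (Fin 0 → ℝ)))

@[simp] theorem tensorRight_apply (g : 𝓢(Y, ℂ)) (f : 𝓢(E, ℂ)) (z : E × Y) :
    tensorRight g f z = f z.1 * g z.2 := by
  change tens E ((dirac (0 : Fin 0 → ℝ)).smulRight g) _ (z.2, z.1) = _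
  rw [tens_apply]
  rfl

/-- A smooth compactly supported function as a Schwartz function. -/
theorem exists_schwartz_of_contDiff {h : E → ℝ} (hs : ContDiff ℝ ∞ h) (hc : HasCompactSupport h) :
    ∃ f : 𝓢(E, ℂ), ∀ x, f x = h x :=
  ⟨HasCompactSupport.toSchwartzMap (f := fun x => (h x : ℂ))
    (hc.comp_left (g := fun r : ℝ => (r : ℂ)) rfl) (Complex.ofRealCLM.contDiff.comp hs), fun _ => rfl⟩

theorem exists_bump (x : E) {r : ℝ} (hr : 0 < r) : ∃ f : 𝓢(E, ℂ), f x = 1 ∧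
    ∀ y, r ≤ dist y x → f y = 0 := by
  let b : ContDiffBump x := ⟨r / 2, r, by linarith, by linarith⟩
  obtain ⟨f, hf⟩ := exists_schwartz_of_contDiff (h := b) b.contDiff b.hasCompactSupport
  refine ⟨f, ?_, fun y hy => ?_⟩
  · rw [hf, b.one_of_mem_closedBall (Metric.mem_closedBall_self b.rIn_pos.le)]
    simp
  · rw [hf, b.zero_of_le_dist hy]
    simp

variable [MeasureTheory.MeasureSpace E] [BorelSpace E]
  [(MeasureTheory.volume : MeasureTheory.Measure E).IsAddHaarMeasure]

theorem eq_zero_of_integral_mul {ψ : E → ℂ} (hψ : Continuous ψ)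
    (h : ∀ f : 𝓢(E, ℂ), ∫ x, f x * ψ x = 0) (x : E) : ψ x = 0 := by
  have h1 := ae_eq_zero_of_integral_contDiff_smul_eq_zero
    (μ := MeasureTheory.volume) hψ.locallyIntegrable (fun g hg hc => by
      obtain ⟨f, hf⟩ := exists_schwartz_of_contDiff hg hc
      simpa [hf] using h f)
  exact congrFun ((hψ.ae_eq_iff_eq MeasureTheory.volume continuous_zero).1 h1) x

/-- `(x, y) ↦ (x - y, y)`. -/
def shear (E : Type*) [NormedAddCommGroup E] [NormedSpace ℝ E] : (E × E) ≃L[ℝ] (E × E) :=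
  ContinuousLinearEquiv.equivOfInverse
    ((ContinuousLinearMap.fst ℝ E E - ContinuousLinearMap.snd ℝ E E).prod
      (ContinuousLinearMap.snd ℝ E E))
    ((ContinuousLinearMap.fst ℝ E E + ContinuousLinearMap.snd ℝ E E).prod
      (ContinuousLinearMap.snd ℝ E E)) (fun x => by simp) (fun x => by simp)

/-- The Dirac masses span a dense subspace of the strong dual. -/
theorem apply_eq_zero_of_dirac (φ : (𝓢(E, ℂ) →L[ℂ] ℂ) →L[ℂ] ℂ) (hφ : ∀ y, φ (dirac y) = 0)
    (v : 𝓢(E, ℂ) →L[ℂ] ℂ) : φ v = 0 := by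
  let S : 𝓢(E × E, ℂ) →L[ℂ] 𝓢(E × E, ℂ) := SchwartzMap.compCLMOfContinuousLinearEquiv ℂ (shear E)
  have hS : ∀ F (z : E × E), S F z = F (z.1 - z.2, z.2) := fun F z => rfl
  -- J g f (y) = g(y) v(f(· - y)) and K g f (y) = f(y) v(g(· - y)); both integrate to v(f * g).
  let J : 𝓢(E, ℂ) → 𝓢(E, ℂ) →L[ℂ] 𝓢(E, ℂ) := fun g => contract v ∘L S ∘L tensorRight g
  let K : 𝓢(E, ℂ) → 𝓢(E, ℂ) →L[ℂ] 𝓢(E, ℂ) := fun g =>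
    contract v ∘L S ∘L swapVars E E ∘L tensorRight g
  have hJK : ∀ g, integralDual E ∘L J g = integralDual E ∘L K g := by
    intro g
    ext f
    simp only [J, K, ContinuousLinearMap.comp_apply, integralDual_apply, contract_apply]
    rw [← apply_integralRight, ← apply_integralRight]
    congr 1
    ext x
    simp only [integralRight_apply, hS, tensorRight_apply, swapVars_apply]
    rw [← MeasureTheory.integral_sub_left_eq_self _ _ x]
    simp
  have hK : ∀ g, φ (integralDual E ∘L K g) = 0 := by
    intro g
    have h1 := apply_integralDual (φ ∘L transposeOp (K g))
    change φ (integralDual E ∘L K g) = ∫ y, φ (dirac y ∘L K g) at h1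
    rw [h1]
    refine MeasureTheory.integral_eq_zero_of_ae (Filter.Eventually.of_forall fun y => ?_)
    -- δ_y ∘ K g is v(g(· - y)) times δ_y, on which φ vanishes. The bump, equal to 1 at y, only
    -- serves to write the translate of g as a slice.
    obtain ⟨ρ, hρy, -⟩ := exists_bump y one_pos
    let gy : 𝓢(E, ℂ) := sliceAt y (S (tensorRight ρ g))
    have h2 : dirac y ∘L K g = v gy • dirac y := by
      ext f
      simp only [K, ContinuousLinearMap.comp_apply, dirac_apply, contract_apply,
        smul_apply, smul_eq_mul]
      rw [mul_comm, ← smul_eq_mul, ← map_smul]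
      congr 1
      ext x
      simp [hS, gy, hρy, mul_comm]
    simp [h2, hφ]
  obtain ⟨ρ, hρ, -⟩ := exists_bump (0 : E) one_pos
  -- With g = h ρ the continuous function z ↦ φ(δ_z ∘ J ρ) integrates to zero against every h, so it
  -- vanishes; at z = 0 it equals φ(v) because ρ(0) = 1.
  have hψ : ∀ z, φ (dirac z ∘L J ρ) = 0 := by
    refine eq_zero_of_integral_mul ?_ fun h => ?_
    · exact (φ ∘L transposeOp (J ρ)).continuous.comp continuous_dirac
    · let g : 𝓢(E, ℂ) := SchwartzMap.smulLeftCLM ℂ h ρ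
      have hg : ∀ z, g z = h z * ρ z := fun z => by
        simp only [g]
        rw [SchwartzMap.smulLeftCLM_apply_apply h.hasTemperateGrowth, smul_eq_mul]
      have h1 := apply_integralDual (φ ∘L transposeOp (J g))
      change φ (integralDual E ∘L J g) = ∫ y, φ (dirac y ∘L J g) at h1
      rw [hJK, hK] at h1
      rw [h1]
      congr 1
      ext z
      have h2 : dirac z ∘L J g = h z • dirac z ∘L J ρ := by
        ext f
        simp only [J, ContinuousLinearMap.comp_apply, dirac_apply, contract_apply,
          smul_apply, smul_eq_mul]
        rw [← smul_eq_mul, ← map_smul]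
        congr 1
        ext x
        simp only [sliceAt_apply, hS, tensorRight_apply, smul_apply, hg, smul_eq_mul]
        ring
      rw [h2, map_smul, smul_eq_mul]
  have h3 : dirac 0 ∘L J ρ = v := by
    ext f
    simp only [J, ContinuousLinearMap.comp_apply, dirac_apply, contract_apply]
    congr 1
    ext x
    simp [hS, hρ]
  rw [← h3, hψ]

end Dense

/-! ### Pullbacks and restriction to the diagonal -/

section Diagonal

variable {E : Type*} [NormedAddCommGroup E] [NormedSpace ℝ E] [FiniteDimensional ℝ E]

/-- Pullback along an injective linear map. -/
theorem exists_antilipschitz {E F : Type*} [NormedAddCommGroup E] [NormedSpace ℝ E]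
    [FiniteDimensional ℝ E] [NormedAddCommGroup F] [NormedSpace ℝ F] (L : E →L[ℝ] F)
    (hL : Function.Injective L) : ∃ K, AntilipschitzWith K L :=
  ⟨_, (L.exists_antilipschitzWith (LinearMap.ker_eq_bot.2 hL)).choose_spec.2⟩

/-- Pullback of Schwartz functions along an injective linear map. -/
def pullback {E F : Type*} [NormedAddCommGroup E] [NormedSpace ℝ E]
    [FiniteDimensional ℝ E] [NormedAddCommGroup F] [NormedSpace ℝ F] (L : E →L[ℝ] F)
    (hL : Function.Injective L) : 𝓢(F, ℂ) →L[ℂ] 𝓢(E, ℂ) :=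
  SchwartzMap.compCLMOfAntilipschitz ℂ (by fun_prop : (⇑L).HasTemperateGrowth)
    (exists_antilipschitz L hL).choose_spec

@[simp] theorem pullback_apply {E F : Type*} [NormedAddCommGroup E] [NormedSpace ℝ E]
    [FiniteDimensional ℝ E] [NormedAddCommGroup F] [NormedSpace ℝ F] (L : E →L[ℝ] F)
    (hL : Function.Injective L) (f : 𝓢(F, ℂ)) (x : E) : pullback L hL f x = f (L x) := rfl

theorem dirDeriv_pullback {E F : Type*} [NormedAddCommGroup E] [NormedSpace ℝ E]
    [FiniteDimensional ℝ E] [NormedAddCommGroup F] [NormedSpace ℝ F] (L : E →L[ℝ] F)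
    (hL : Function.Injective L) (f : 𝓢(F, ℂ)) (v : E) :
    dirDeriv v (pullback L hL f) = pullback L hL (dirDeriv (L v) f) := by
  ext x
  refine (hasDerivAt_line_zero _ x v).unique ?_
  simpa using hasDerivAt_line_zero f (L x) (L v)

/-- Restriction to the diagonal. -/
def diagonal (E : Type*) [NormedAddCommGroup E] [NormedSpace ℝ E] [FiniteDimensional ℝ E] :
    𝓢(E × E, ℂ) →L[ℂ] 𝓢(E, ℂ) :=
  pullback ((ContinuousLinearMap.id ℝ E).prod (ContinuousLinearMap.id ℝ E))
    fun _ _ h => congrArg Prod.fst h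

@[simp] theorem diagonal_apply (f : 𝓢(E × E, ℂ)) (x : E) : diagonal E f x = f (x, x) := rfl

theorem dirDeriv_diagonal (f : 𝓢(E × E, ℂ)) (v : E) :
    dirDeriv v (diagonal E f) = diagonal E (dirDeriv (v, v) f) :=
  dirDeriv_pullback _ _ f v

variable [MeasureTheory.MeasureSpace E] [BorelSpace E]
  [(MeasureTheory.volume : MeasureTheory.Measure E).IsAddHaarMeasure]

theorem integral_dirDeriv_eq_zero (f : 𝓢(E, ℂ)) (v : E) : ∫ x, dirDeriv v f x = 0 := by
  have h := integral_mul_fderiv_eq_neg_fderiv_mul_of_integrable (𝕜 := ℂ)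
    (μ := MeasureTheory.volume) (f := fun _ : E => (1 : ℂ)) (g := f) (v := v)
    (by simp) (by simpa [← dirDeriv_apply] using (dirDeriv v f).integrable) (by simpa using f.integrable)
    (fun x _ => differentiableAt_const _) (fun x _ => f.differentiableAt)
  simpa [← dirDeriv_apply] using h

end Diagonal

/-! ### Operators determined by their kernels; cyclicity of the trace -/

namespace SmoothOp

variable {d k : ℕ}

theorem kernel_eq (T : SmoothOp d k) (x x' : Cfg d k) :
    T.kernel x x' = kernelCLM (Cfg d k) (Cfg d k) T (x, x') := (kernelCLM_apply T (x, x')).symm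

/-- An operator with Schwartz kernel is determined by its kernel. -/
theorem ext_kernel {T S : SmoothOp d k} (h : ∀ x x', T.kernel x x' = S.kernel x x') : T = S := by
  refine sub_eq_zero.1 ?_
  ext u x
  refine apply_eq_zero_of_dirac (dirac x ∘L (T - S)) (fun y => ?_) u
  exact sub_eq_zero.2 (h x y)

/-- The operator with a given kernel. -/
def ofKernel (d k : ℕ) : 𝓢(Cfg d k × Cfg d k, ℂ) →L[ℂ] SmoothOp d k :=
  kernelOpCLM (Cfg d k) (Cfg d k) ∘L swapVars (Cfg d k) (Cfg d k)

@[simp] theorem ofKernel_kernel (K : 𝓢(Cfg d k × Cfg d k, ℂ)) (x x' : Cfg d k) :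
    (ofKernel d k K).kernel x x' = K (x, x') := by
  simp [kernel, ofKernel, kernelOpCLM_apply, kernelOp_apply]
  rfl

theorem ofKernel_apply (K : 𝓢(Cfg d k × Cfg d k, ℂ)) (u : SchDual d k) (x : Cfg d k) :
    ofKernel d k K u x = u (sliceLeft x K) := by
  simp only [ofKernel, ContinuousLinearMap.comp_apply, kernelOpCLM_apply, kernelOp_apply]
  rfl

theorem ofKernel_kernelCLM (T : SmoothOp d k) :
    ofKernel d k (kernelCLM (Cfg d k) (Cfg d k) T) = T :=
  ext_kernel fun x x' => by rw [ofKernel_kernel, kernel_eq]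

theorem apply_eq (T : SmoothOp d k) (u : SchDual d k) (x : Cfg d k) :
    T u x = u (sliceLeft x (kernelCLM (Cfg d k) (Cfg d k) T)) := by
  conv_lhs => rw [← ofKernel_kernelCLM T]
  rw [ofKernel_apply]

/-- The trace as a continuous linear functional. -/
def traceCLM (d k : ℕ) : SmoothOp d k →L[ℂ] ℂ :=
  integralDual (Cfg d k) ∘L diagonal (Cfg d k) ∘L kernelCLM (Cfg d k) (Cfg d k)

theorem traceCLM_apply (T : SmoothOp d k) : traceCLM d k T = T.trace := by
  simp only [traceCLM, ContinuousLinearMap.comp_apply, integralDual_apply, diagonal_apply, trace,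
    kernel_eq]

/-- The derivative along v of the kernel on the diagonal is its derivative along (v, v), hence the
sum of the diagonal kernels of the two operators; the integral of a derivative vanishes. -/
theorem trace_dirDeriv_comp (T : SmoothOp d k) (v : Cfg d k) :
    trace (dirDeriv v ∘L T) = -trace (T ∘L ContinuousLinearMap.precomp ℂ (dirDeriv v)) := by
  rw [eq_neg_iff_add_eq_zero, ← traceCLM_apply, ← traceCLM_apply, ← map_add,
    ← integral_dirDeriv_eq_zero (diagonal (Cfg d k) (kernelCLM (Cfg d k) (Cfg d k) T)) v]
  simp only [traceCLM, ContinuousLinearMap.comp_apply, integralDual_apply]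
  congr 1
  ext x
  rw [dirDeriv_diagonal, diagonal_apply, diagonal_apply, map_add, add_apply]
  have h1 := dirDeriv_kernelLM_left T v
  have h2 := dirDeriv_kernelLM_right T v
  have h3 : dirDeriv ((v, v) : Cfg d k × Cfg d k) = dirDeriv (v, 0) + dirDeriv (0, v) := by
    ext f z
    simp only [add_apply, dirDeriv_apply, ← map_add]
    simp
  change _ = dirDeriv (v, v) (kernelLM _ _ T) _
  rw [h3, add_apply, h1, h2]
  rfl

/-- Each second derivative is moved across by two integrations by parts, whose signs cancel. -/
theorem trace_laplacian_comp (T : SmoothOp d k) :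
    trace (totalLaplacian d k ∘L T) =
      trace (T ∘L ContinuousLinearMap.precomp ℂ (totalLaplacian d k)) := by
  have h : ∀ v, traceCLM d k ((dirDeriv v ∘L dirDeriv v) ∘L T) =
      traceCLM d k (T ∘L ContinuousLinearMap.precomp ℂ (dirDeriv v ∘L dirDeriv v)) := by
    intro v
    rw [traceCLM_apply, traceCLM_apply, ContinuousLinearMap.comp_assoc, trace_dirDeriv_comp,
      ContinuousLinearMap.comp_assoc, trace_dirDeriv_comp, neg_neg]
    rfl
  have h1 : totalLaplacian d k = ∑ j : Fin k, ∑ a : Fin d,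
      dirDeriv (Pi.single j (EuclideanSpace.single a (1 : ℝ)) : Cfg d k) ∘L
        dirDeriv (Pi.single j (EuclideanSpace.single a (1 : ℝ)) : Cfg d k) := rfl
  have h2 : totalLaplacian d k ∘L T = ∑ j : Fin k, ∑ a : Fin d,
      (dirDeriv (Pi.single j (EuclideanSpace.single a (1 : ℝ)) : Cfg d k) ∘L
        dirDeriv (Pi.single j (EuclideanSpace.single a (1 : ℝ)) : Cfg d k)) ∘L T := by
    ext u x
    simp [h1]
  have h3 : T ∘L ContinuousLinearMap.precomp ℂ (totalLaplacian d k) = ∑ j : Fin k, ∑ a : Fin d,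
      T ∘L ContinuousLinearMap.precomp ℂ
        (dirDeriv (Pi.single j (EuclideanSpace.single a (1 : ℝ)) : Cfg d k) ∘L
        dirDeriv (Pi.single j (EuclideanSpace.single a (1 : ℝ)) : Cfg d k)) := by
    ext u x
    have h4 : ∀ u : SchDual d k, ContinuousLinearMap.precomp ℂ (totalLaplacian d k) u =
      ∑ j : Fin k, ∑ a : Fin d, ContinuousLinearMap.precomp ℂ
        (dirDeriv (Pi.single j (EuclideanSpace.single a (1 : ℝ)) : Cfg d k) ∘L
        dirDeriv (Pi.single j (EuclideanSpace.single a (1 : ℝ)) : Cfg d k)) u := by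
      intro u
      ext f
      simp [h1]
    simp [h4, -ContinuousLinearMap.precomp_apply]
  rw [← traceCLM_apply, ← traceCLM_apply, h2, h3]
  simp only [map_sum, h]

/-- Multiplication operators act on kernels by multiplication. -/
theorem kernel_mul_comp {m : Cfg d k → ℂ} (hm : m.HasTemperateGrowth) (T : SmoothOp d k)
    (x x' : Cfg d k) :
    kernel (SchwartzMap.smulLeftCLM ℂ m ∘L T) x x' = m x * T.kernel x x' := by
  simp [kernel, SchwartzMap.smulLeftCLM_apply_apply hm]

theorem kernel_comp_mul {m : Cfg d k → ℂ} (hm : m.HasTemperateGrowth) (T : SmoothOp d k)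
    (x x' : Cfg d k) :
    kernel (T ∘L ContinuousLinearMap.precomp ℂ (SchwartzMap.smulLeftCLM ℂ m)) x x' =
      m x' * T.kernel x x' := by
  have h : ContinuousLinearMap.precomp ℂ (SchwartzMap.smulLeftCLM ℂ m) (diracAt x') =
      m x' • diracAt x' := by
    ext f
    exact SchwartzMap.smulLeftCLM_apply_apply hm f x'
  rw [kernel, ContinuousLinearMap.comp_apply, h, map_smul]
  rfl

theorem trace_mul_comp {m : Cfg d k → ℂ} (hm : m.HasTemperateGrowth) (T : SmoothOp d k) :
    trace (SchwartzMap.smulLeftCLM ℂ m ∘L T) =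
      trace (T ∘L ContinuousLinearMap.precomp ℂ (SchwartzMap.smulLeftCLM ℂ m)) := by
  simp only [trace, kernel_mul_comp hm, kernel_comp_mul hm]

end SmoothOp

/-! ### The partial trace as a continuous map -/

section PartialTrace

variable {d k : ℕ}

/-- `(x, y) ↦ (x_1, …, x_k, y)`. -/
def snocL (d k : ℕ) : (Cfg d k × EuclideanSpace ℝ (Fin d)) →L[ℝ] Cfg d (k + 1) :=
  LinearMap.toContinuousLinearMap
    { toFun := fun z => Fin.snoc (α := fun _ => EuclideanSpace ℝ (Fin d)) z.1 z.2
      map_add' := fun z w => by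
        funext i
        refine Fin.lastCases ?_ (fun i => ?_) i <;> simp
      map_smul' := fun c z => by
        funext i
        refine Fin.lastCases ?_ (fun i => ?_) i <;> simp }

@[simp] theorem snocL_apply (x : Cfg d k) (y : EuclideanSpace ℝ (Fin d)) :
    snocL d k (x, y) = Fin.snoc (α := fun _ => EuclideanSpace ℝ (Fin d)) x y := rfl

theorem snocL_injective : Function.Injective (snocL d k) := by
  rintro ⟨x, y⟩ ⟨x', y'⟩ h
  simp only [snocL_apply] at h
  have h1 : x = x' := by
    funext i
    simpa using congrFun h i.castSucc
  have h2 : y = y' := by simpa using congrFun h (Fin.last k)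
  rw [h1, h2]

/-- `((x, x'), y) ↦ ((x, y), (x', y))`. -/
def snocPair (d k : ℕ) : ((Cfg d k × Cfg d k) × EuclideanSpace ℝ (Fin d)) →L[ℝ]
    (Cfg d (k + 1) × Cfg d (k + 1)) :=
  (snocL d k ∘L (((ContinuousLinearMap.fst ℝ _ _) ∘L ContinuousLinearMap.fst ℝ _ _).prod
    (ContinuousLinearMap.snd ℝ _ _))).prod
  (snocL d k ∘L (((ContinuousLinearMap.snd ℝ _ _) ∘L ContinuousLinearMap.fst ℝ _ _).prod
    (ContinuousLinearMap.snd ℝ _ _)))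

theorem snocPair_injective : Function.Injective (snocPair d k) := by
  rintro ⟨⟨x, x'⟩, y⟩ ⟨⟨z, z'⟩, w⟩ h
  have h1 : ((x, y) : Cfg d k × EuclideanSpace ℝ (Fin d)) = (z, w) :=
    snocL_injective (congrArg Prod.fst h)
  have h2 : ((x', y) : Cfg d k × EuclideanSpace ℝ (Fin d)) = (z', w) :=
    snocL_injective (congrArg Prod.snd h)
  simp only [Prod.mk.injEq] at h1 h2 ⊢
  exact ⟨⟨h1.1, h2.1⟩, h1.2⟩

namespace SmoothOp

/-- The partial trace as a continuous linear map. -/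
def partialTraceCLM (d k : ℕ) : SmoothOp d (k + 1) →L[ℂ] SmoothOp d k :=
  ofKernel d k ∘L integralRight (Cfg d k × Cfg d k) (EuclideanSpace ℝ (Fin d)) ∘L
    pullback (snocPair d k) snocPair_injective ∘L kernelCLM (Cfg d (k + 1)) (Cfg d (k + 1))

theorem kernel_partialTraceCLM (T : SmoothOp d (k + 1)) (x x' : Cfg d k) :
    (partialTraceCLM d k T).kernel x x' = ∫ y : EuclideanSpace ℝ (Fin d),
        T.kernel (Fin.snoc (α := fun _ => EuclideanSpace ℝ (Fin d)) x y)
          (Fin.snoc (α := fun _ => EuclideanSpace ℝ (Fin d)) x' y) := by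
  rw [partialTraceCLM, ContinuousLinearMap.comp_apply, ofKernel_kernel,
    ContinuousLinearMap.comp_apply, integralRight_apply]
  simp only [kernel_eq]
  rfl

/-- The explicit operator satisfies the defining kernel identity, and kernels determine operators,
so the choice in the definition is forced. -/
theorem partialTrace_eq (T : SmoothOp d (k + 1)) : T.partialTrace = partialTraceCLM d k T := by
  have h := Classical.epsilon_spec (p := fun R : SmoothOp d k =>
    ∀ x x' : Cfg d k, R.kernel x x' =
      ∫ y : EuclideanSpace ℝ (Fin d),
        T.kernel (Fin.snoc (α := fun _ => EuclideanSpace ℝ (Fin d)) x y)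
          (Fin.snoc (α := fun _ => EuclideanSpace ℝ (Fin d)) x' y))
    ⟨_, kernel_partialTraceCLM T⟩
  exact ext_kernel fun x x' => (h x x').trans (kernel_partialTraceCLM T x x').symm

theorem hasTemperateGrowth_pair {U : EuclideanSpace ℝ (Fin d) → ℝ} (hU : U.HasTemperateGrowth)
    (i j : Fin k) : (fun x : Cfg d k => ((U (x i - x j) : ℝ) : ℂ)).HasTemperateGrowth := by
  have h1 : (fun x : Cfg d k => x i - x j).HasTemperateGrowth := by
    exact ((ContinuousLinearMap.proj i : Cfg d k →L[ℝ] EuclideanSpace ℝ (Fin d)) -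
      ContinuousLinearMap.proj j).hasTemperateGrowth
  have h2 : (fun r : ℝ => (r : ℂ)).HasTemperateGrowth := Complex.ofRealCLM.hasTemperateGrowth
  exact h2.comp (hU.comp h1)

end SmoothOp

end PartialTrace

/-! ### The projection onto bosonic functions -/

section Symmetrization

variable {d k : ℕ}

/-- `f ↦ f(x_{π(1)}, …, x_{π(k)})`. -/
def permOp (π : Equiv.Perm (Fin k)) : Sch d k →L[ℂ] Sch d k :=
  pullback (LinearMap.toContinuousLinearMap
    { toFun := fun (x : Cfg d k) i => x (π i)
      map_add' := fun _ _ => rfl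
      map_smul' := fun _ _ => rfl })
    fun x y h => funext fun i => by
      have := congrFun h (π.symm i)
      simpa using this

@[simp] theorem permOp_apply (π : Equiv.Perm (Fin k)) (f : Sch d k) (x : Cfg d k) :
    permOp π f x = f (fun i => x (π i)) := rfl

theorem permOp_mul (π σ : Equiv.Perm (Fin k)) (f : Sch d k) :
    permOp π (permOp σ f) = permOp (π * σ) f := rfl

theorem permOp_of_mem (π : Equiv.Perm (Fin k)) (f : BSch d k) :
    permOp π (f : Sch d k) = f := by
  ext x
  exact f.2 π x

theorem mem_symSch_of_permOp {f : Sch d k} (h : ∀ π, permOp π f = f) : f ∈ symSch d k :=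
  fun π x => DFunLike.congr_fun (h π) x

/-- The inclusion of the bosonic Schwartz space. -/
abbrev inclB (d k : ℕ) : BSch d k →L[ℂ] Sch d k := (symSch d k).subtypeL

/-- The symmetrization `f ↦ (k!)⁻¹ ∑_π f(x_{π(1)}, …, x_{π(k)})`. -/
def symmetrize (d k : ℕ) : Sch d k →L[ℂ] BSch d k :=
  (((Nat.factorial k : ℕ) : ℂ)⁻¹ • ∑ π : Equiv.Perm (Fin k), permOp π).codRestrict (symSch d k)
    fun f => mem_symSch_of_permOp fun σ => by
      simp only [smul_apply, sum_apply, map_smul, map_sum, permOp_mul]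
      congr 1
      exact Fintype.sum_equiv (Equiv.mulLeft σ) _ _ fun π => rfl

theorem symmetrize_coe (f : Sch d k) : (symmetrize d k f : Sch d k) =
    ((Nat.factorial k : ℕ) : ℂ)⁻¹ • ∑ π : Equiv.Perm (Fin k), permOp π f := by
  change ((((Nat.factorial k : ℕ) : ℂ)⁻¹ • ∑ π : Equiv.Perm (Fin k), permOp π) f : Sch d k) = _
  simp

theorem symmetrize_of_permOp {f : Sch d k} (h : ∀ π, permOp π f = f) :
    (symmetrize d k f : Sch d k) = f := by
  rw [symmetrize_coe]
  simp only [h, Finset.sum_const, Finset.card_univ, Fintype.card_perm, Fintype.card_fin]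
  rw [← Nat.cast_smul_eq_nsmul ℂ, smul_smul, inv_mul_cancel₀ (Nat.cast_ne_zero.2 (Nat.factorial_ne_zero k)), one_smul]

@[simp] theorem symmetrize_incl (f : BSch d k) : symmetrize d k (f : Sch d k) = f :=
  Subtype.ext (symmetrize_of_permOp fun π => permOp_of_mem π f)

@[simp] theorem symmetrize_permOp (π : Equiv.Perm (Fin k)) (f : Sch d k) :
    symmetrize d k (permOp π f) = symmetrize d k f := by
  refine Subtype.ext ?_
  rw [symmetrize_coe, symmetrize_coe]
  simp only [permOp_mul]
  congr 1
  exact Fintype.sum_equiv (Equiv.mulRight π) _ _ fun σ => rfl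

theorem volume_preserving_perm (π : Equiv.Perm (Fin k)) :
    MeasureTheory.MeasurePreserving (fun (x : Cfg d k) i => x (π i) : Cfg d k → Cfg d k) := by
  have h := MeasureTheory.volume_measurePreserving_piCongrLeft
    (fun _ : Fin k => EuclideanSpace ℝ (Fin d)) π.symm
  suffices h3 : (fun (x : Cfg d k) i => x (π i)) = ⇑(MeasurableEquiv.piCongrLeft
      (fun _ : Fin k => EuclideanSpace ℝ (Fin d)) π.symm) by
    rw [h3]
    exact h
  funext x i
  have h2 := MeasurableEquiv.piCongrLeft_apply_apply (β := fun _ : Fin k => EuclideanSpace ℝ (Fin d))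
    π.symm x (π i)
  rw [Equiv.symm_apply_apply] at h2
  exact h2.symm

theorem integral_comp_perm (π : Equiv.Perm (Fin k)) (f : Cfg d k → ℂ) :
    ∫ x : Cfg d k, f (fun i => x (π i)) = ∫ x, f x := by
  have hm : MeasurableEmbedding (fun (x : Cfg d k) i => x (π i) : Cfg d k → Cfg d k) := by
    let e : Cfg d k ≃ᵐ Cfg d k :=
      { toFun := fun x i => x (π i)
        invFun := fun x i => x (π.symm i)
        left_inv := fun x => by funext i; simp
        right_inv := fun x => by funext i; simp
        measurable_toFun := (volume_preserving_perm π).measurable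
        measurable_invFun := (volume_preserving_perm π.symm).measurable }
    exact e.measurableEmbedding
  exact (volume_preserving_perm π).integral_comp hm f

theorem l2inner_permOp (π : Equiv.Perm (Fin k)) (f g : Sch d k) :
    l2inner (permOp π f) g = l2inner f (permOp π⁻¹ g) := by
  rw [l2inner, l2inner, ← integral_comp_perm π⁻¹]
  simp

theorem l2inner_csmul_right (c : ℂ) (f g : Sch d k) : l2inner f (c • g) = c * l2inner f g := by
  simp only [l2inner, smul_apply, smul_eq_mul, mul_left_comm _ c]
  exact MeasureTheory.integral_const_mul _ _

theorem l2inner_conj_symm (f g : Sch d k) : (starRingEnd ℂ) (l2inner f g) = l2inner g f := by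
  rw [l2inner, ← integral_conj, l2inner]
  simp [mul_comm]

theorem l2inner_csmul_left (c : ℂ) (f g : Sch d k) :
    l2inner (c • f) g = (starRingEnd ℂ) c * l2inner f g := by
  rw [← l2inner_conj_symm, l2inner_csmul_right, map_mul, l2inner_conj_symm]

/-- The inner product as a linear functional of the second argument. -/
def l2innerRight (f : Sch d k) : Sch d k →ₗ[ℂ] ℂ where
  toFun g := l2inner f g
  map_add' := l2inner_add_right f
  map_smul' c g := l2inner_csmul_right c f g

theorem l2inner_sum_right {α : Type*} (s : Finset α) (f : Sch d k) (g : α → Sch d k) :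
    l2inner f (∑ a ∈ s, g a) = ∑ a ∈ s, l2inner f (g a) := map_sum (l2innerRight f) g s

theorem l2inner_sum_left {α : Type*} (s : Finset α) (f : α → Sch d k) (g : Sch d k) :
    l2inner (∑ a ∈ s, f a) g = ∑ a ∈ s, l2inner (f a) g := by
  rw [← l2inner_conj_symm, l2inner_sum_right, map_sum]
  simp only [l2inner_conj_symm]

/-- Permutations preserve Lebesgue measure, and passing to inverses only reorders the average. -/
theorem l2inner_symmetrize (f g : Sch d k) :
    l2inner (symmetrize d k f : Sch d k) g = l2inner f (symmetrize d k g : Sch d k) := by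
  rw [symmetrize_coe, symmetrize_coe, l2inner_csmul_left, l2inner_csmul_right, l2inner_sum_left,
    l2inner_sum_right]
  simp only [l2inner_permOp, map_inv₀, map_natCast]
  congr 1
  exact Fintype.sum_equiv (Equiv.inv _) _ _ fun π => rfl

theorem l2inner_symmetrize_left (f : Sch d k) (g : BSch d k) :
    l2inner (symmetrize d k f : Sch d k) g = l2inner f (g : Sch d k) := by
  rw [l2inner_symmetrize, symmetrize_incl]

theorem l2inner_symmetrize_right (f : BSch d k) (g : Sch d k) :
    l2inner (f : Sch d k) (symmetrize d k g : Sch d k) = l2inner (f : Sch d k) g := by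
  rw [← l2inner_symmetrize, symmetrize_incl]

/-- The complex conjugate of a Schwartz function. -/
def conjS {E : Type*} [NormedAddCommGroup E] [NormedSpace ℝ E] (f : 𝓢(E, ℂ)) : 𝓢(E, ℂ) :=
  SchwartzMap.postcompCLM (𝕜 := ℝ) (Complex.conjCLE : ℂ →L[ℝ] ℂ) f

@[simp] theorem conjS_apply {E : Type*} [NormedAddCommGroup E] [NormedSpace ℝ E] (f : 𝓢(E, ℂ))
    (x : E) : conjS f x = (starRingEnd ℂ) (f x) := rfl

theorem eq_of_l2inner {f g : Sch d k} (h : ∀ u : Sch d k, l2inner u f = l2inner u g) : f = g := by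
  ext x
  rw [← sub_eq_zero]
  refine eq_zero_of_integral_mul (ψ := fun x => f x - g x) (by fun_prop) (fun u => ?_) x
  have h1 := h (conjS u)
  rw [← sub_eq_zero, l2inner, l2inner, ← MeasureTheory.integral_sub (l2inner_integrable _ _)
    (l2inner_integrable _ _)] at h1
  simpa [mul_sub] using h1

theorem eq_of_l2inner_bosonic {f g : BSch d k}
    (h : ∀ u : BSch d k, l2inner (u : Sch d k) f = l2inner (u : Sch d k) g) : f = g := by
  refine Subtype.ext (eq_of_l2inner fun u => ?_)
  rw [← l2inner_symmetrize_left u f, ← l2inner_symmetrize_left u g, h]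

end Symmetrization

/-! ### Operators acting in a group of labels, and their symmetrization -/

section Act

variable {d k l N : ℕ}

/-- The labels that are not used by `J`. -/
abbrev Rest (J : Fin k ↪ Fin N) : Type := {i : Fin N // ∀ a, J a ≠ i}

open Classical in
/-- Configurations split into the particles labelled by `J` and the other ones. -/
def splitL (d : ℕ) (J : Fin k ↪ Fin N) :
    Cfg d N ≃L[ℝ] (Cfg d k × (Rest J → EuclideanSpace ℝ (Fin d))) :=
  LinearEquiv.toContinuousLinearEquiv
    { toFun := fun x => (fun a => x (J a), fun i => x i)
      map_add' := fun _ _ => rfl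
      map_smul' := fun _ _ => rfl
      invFun := fun p i => if h : ∃ a, J a = i then p.1 h.choose else p.2 ⟨i, fun a ha => h ⟨a, ha⟩⟩
      left_inv := fun x => by
        funext i
        by_cases h : ∃ a, J a = i
        · simp only [dif_pos h]
          rw [h.choose_spec]
        · simp only [dif_neg h]
      right_inv := fun p => by
        refine Prod.ext (funext fun a => ?_) (funext fun i => ?_)
        · have h : ∃ b, J b = J a := ⟨a, rfl⟩
          simp only [dif_pos h]
          rw [J.injective h.choose_spec]
        · have h : ¬ ∃ b, J b = i := fun ⟨b, hb⟩ => i.2 b hb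
          simp only [dif_neg h] }

theorem splitL_apply (J : Fin k ↪ Fin N) (x : Cfg d N) :
    splitL d J x = (fun a => x (J a), fun i : Rest J => x i) := rfl

theorem splitL_symm_apply (J : Fin k ↪ Fin N) (y : Cfg d k) (x : Cfg d N) :
    (splitL d J).symm (y, fun i : Rest J => x i) = Function.extend J y x := by
  rw [ContinuousLinearEquiv.symm_apply_eq, splitL_apply]
  refine Prod.ext (funext fun a => ?_) (funext fun i => ?_)
  · exact (J.injective.extend_apply y x a).symm
  · exact (Function.extend_apply' _ _ _ fun ⟨b, hb⟩ => i.2 b hb).symm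

/-- `f` as a function of the variables labelled by `J`. -/
def sliceE (J : Fin k ↪ Fin N) (x : Cfg d N) : Sch d N →L[ℂ] Sch d k :=
  SchwartzMap.compCLMOfAntilipschitz ℂ (extend_hasTemperateGrowth x J) (extend_antilipschitz x J)

@[simp] theorem sliceE_apply (J : Fin k ↪ Fin N) (x : Cfg d N) (f : Sch d N) (y : Cfg d k) :
    sliceE J x f y = f (Function.extend J y x) := rfl

/-- The operator `D` acting in the variables labelled by `J`. -/
def act (J : Fin k ↪ Fin N) (D : Sch d k →L[ℂ] Sch d k) : Sch d N →L[ℂ] Sch d N :=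
  SchwartzMap.compCLMOfContinuousLinearEquiv ℂ (splitL d J) ∘L tens _ D ∘L
    SchwartzMap.compCLMOfContinuousLinearEquiv ℂ (splitL d J).symm

theorem act_apply (J : Fin k ↪ Fin N) (D : Sch d k →L[ℂ] Sch d k) (f : Sch d N) (x : Cfg d N) :
    act J D f x = D (sliceE J x f) fun a => x (J a) := by
  change tens _ D _ (splitL d J x) = _
  rw [tens_apply]
  congr 2
  ext y
  rw [sliceAt_apply, sliceE_apply, ← splitL_symm_apply]
  rfl

theorem extend_comp_self (J : Fin k ↪ Fin N) (y : Cfg d k) (x : Cfg d N) :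
    (fun a => Function.extend J y x (J a)) = y :=
  funext fun a => J.injective.extend_apply y x a

theorem extend_self (J : Fin k ↪ Fin N) (x : Cfg d N) :
    Function.extend J (fun a => x (J a)) x = x := by
  funext i
  by_cases h : ∃ a, J a = i
  · obtain ⟨a, rfl⟩ := h
    rw [J.injective.extend_apply]
  · rw [Function.extend_apply' _ _ _ h]

theorem extend_extend (J : Fin k ↪ Fin N) (y y' : Cfg d k) (x : Cfg d N) :
    Function.extend J y' (Function.extend J y x) = Function.extend J y' x := by
  funext i
  by_cases h : ∃ a, J a = i
  · obtain ⟨a, rfl⟩ := h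
    rw [J.injective.extend_apply, J.injective.extend_apply]
  · rw [Function.extend_apply' _ _ _ h, Function.extend_apply' _ _ _ h,
      Function.extend_apply' _ _ _ h]

/-- Slicing an operator acting in the sliced variables. -/
theorem sliceE_act (J : Fin k ↪ Fin N) (D : Sch d k →L[ℂ] Sch d k) (f : Sch d N) (x : Cfg d N) :
    sliceE J x (act J D f) = D (sliceE J x f) := by
  ext y
  rw [sliceE_apply, act_apply, extend_comp_self]
  congr 2
  ext y'
  rw [sliceE_apply, sliceE_apply, extend_extend]

theorem act_comp (J : Fin k ↪ Fin N) (D D' : Sch d k →L[ℂ] Sch d k) :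
    act J (D ∘L D') = act J D ∘L act J D' := by
  ext f x
  rw [ContinuousLinearMap.comp_apply, act_apply, act_apply, sliceE_act]
  rfl

theorem act_sub (J : Fin k ↪ Fin N) (D D' : Sch d k →L[ℂ] Sch d k) :
    act J (D - D') = act J D - act J D' := by
  ext f x
  simp [act_apply]

theorem act_add (J : Fin k ↪ Fin N) (D D' : Sch d k →L[ℂ] Sch d k) :
    act J (D + D') = act J D + act J D' := by
  ext f x
  simp [act_apply]

theorem act_smul (J : Fin k ↪ Fin N) (c : ℂ) (D : Sch d k →L[ℂ] Sch d k) :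
    act J (c • D) = c • act J D := by
  ext f x
  simp [act_apply]

theorem act_sum {α : Type*} (s : Finset α) (J : Fin k ↪ Fin N) (D : α → Sch d k →L[ℂ] Sch d k) :
    act J (∑ a ∈ s, D a) = ∑ a ∈ s, act J (D a) := by
  ext f x
  simp [act_apply]

theorem act_act (J : Fin l ↪ Fin k) (J' : Fin k ↪ Fin N) (D : Sch d l →L[ℂ] Sch d l) :
    act J' (act J D) = act (J.trans J') D := by
  ext f x
  rw [act_apply, act_apply, act_apply]
  congr 2
  ext y
  rw [sliceE_apply, sliceE_apply, sliceE_apply]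
  congr 1
  funext i
  by_cases h : ∃ a, J' a = i
  · obtain ⟨a, rfl⟩ := h
    rw [J'.injective.extend_apply]
    by_cases h : ∃ b, J b = a
    · obtain ⟨b, rfl⟩ := h
      rw [J.injective.extend_apply]
      exact ((J.trans J').injective.extend_apply y x b).symm
    · rw [Function.extend_apply' _ _ _ h, Function.extend_apply']
      rintro ⟨b, hb⟩
      exact h ⟨b, J'.injective hb⟩
  · rw [Function.extend_apply' _ _ _ h, Function.extend_apply']
    rintro ⟨b, hb⟩
    exact h ⟨J b, hb⟩

theorem permOp_act (σ : Equiv.Perm (Fin N)) (J : Fin k ↪ Fin N) (D : Sch d k →L[ℂ] Sch d k)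
    (f : Sch d N) : permOp σ (act J D f) = act (J.trans σ.toEmbedding) D (permOp σ f) := by
  ext x
  rw [permOp_apply, act_apply, act_apply]
  congr 2
  ext y
  rw [sliceE_apply, sliceE_apply, permOp_apply]
  congr 1
  funext i
  by_cases h : ∃ a, J a = i
  · obtain ⟨a, rfl⟩ := h
    rw [J.injective.extend_apply]
    exact ((J.trans σ.toEmbedding).injective.extend_apply y x a).symm
  · rw [Function.extend_apply' _ _ _ h, Function.extend_apply']
    rintro ⟨b, hb⟩
    exact h ⟨b, σ.injective hb⟩

theorem act_permOp (τ : Equiv.Perm (Fin k)) (J : Fin k ↪ Fin N) :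
    act (d := d) J (permOp τ) = permOp (τ.viaEmbedding J) := by
  ext f x
  rw [act_apply, permOp_apply, permOp_apply, sliceE_apply]
  congr 1
  funext i
  by_cases h : ∃ a, J a = i
  · obtain ⟨a, rfl⟩ := h
    rw [J.injective.extend_apply, Equiv.Perm.viaEmbedding_apply]
  · rw [Function.extend_apply' _ _ _ h, Equiv.Perm.viaEmbedding_apply_of_notMem]
    simpa using h

/-- The bijection between the two ranges extends to a permutation of the finite set of labels. -/
theorem exists_perm_comp_eq (J J' : Fin k ↪ Fin N) :
    ∃ σ : Equiv.Perm (Fin N), J.trans σ.toEmbedding = J' := by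
  classical
  let e : {i // i ∈ Set.range J} ≃ {i // i ∈ Set.range J'} :=
    (Equiv.ofInjective J J.injective).symm.trans (Equiv.ofInjective J' J'.injective)
  refine ⟨e.extendSubtype, ?_⟩
  ext a
  have h := e.extendSubtype_apply_of_mem (J a) ⟨a, rfl⟩
  have h2 : (Equiv.ofInjective J J.injective).symm ⟨J a, a, rfl⟩ = a :=
    (Equiv.symm_apply_eq _).2 rfl
  simp only [Function.Embedding.trans_apply, Equiv.coe_toEmbedding, h, e, Equiv.trans_apply, h2]
  rfl

/-- The symmetrized action of an operator of `k` variables on `N` particles. -/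
def symAct (J : Fin k ↪ Fin N) (M : Sch d k →L[ℂ] Sch d k) : BSch d N →L[ℂ] BSch d N :=
  symmetrize d N ∘L act J M ∘L inclB d N

theorem symAct_apply (J : Fin k ↪ Fin N) (M : Sch d k →L[ℂ] Sch d k) (f : BSch d N) :
    symAct J M f = symmetrize d N (act J M f) := rfl

/-- A permutation moves the labels of the action, fixes the bosonic input, and is absorbed by the
symmetrization of the output. -/
theorem symAct_trans_perm (σ : Equiv.Perm (Fin N)) (J : Fin k ↪ Fin N)
    (M : Sch d k →L[ℂ] Sch d k) : symAct (J.trans σ.toEmbedding) M = symAct J M := by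
  ext1 f
  rw [symAct_apply, symAct_apply, ← symmetrize_permOp σ (act J M _), permOp_act, permOp_of_mem]

/-- The symmetrized action does not depend on the labels. -/
theorem symAct_eq (J J' : Fin k ↪ Fin N) (M : Sch d k →L[ℂ] Sch d k) :
    symAct J M = symAct J' M := by
  obtain ⟨σ, rfl⟩ := exists_perm_comp_eq J J'
  rw [symAct_trans_perm]

theorem symAct_permOp_comp (τ : Equiv.Perm (Fin k)) (J : Fin k ↪ Fin N)
    (M : Sch d k →L[ℂ] Sch d k) : symAct J (permOp τ ∘L M) = symAct J M := by
  ext1 f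
  rw [symAct_apply, symAct_apply, act_comp, act_permOp]
  exact symmetrize_permOp _ _

theorem symAct_comp_permOp (τ : Equiv.Perm (Fin k)) (J : Fin k ↪ Fin N)
    (M : Sch d k →L[ℂ] Sch d k) : symAct J (M ∘L permOp τ) = symAct J M := by
  ext1 f
  rw [symAct_apply, symAct_apply, act_comp, act_permOp, ContinuousLinearMap.comp_apply,
    permOp_of_mem]

theorem symAct_smul (J : Fin k ↪ Fin N) (c : ℂ) (M : Sch d k →L[ℂ] Sch d k) :
    symAct J (c • M) = c • symAct J M := by
  ext1 f
  simp [symAct_apply, act_smul]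

theorem symAct_add (J : Fin k ↪ Fin N) (M M' : Sch d k →L[ℂ] Sch d k) :
    symAct J (M + M') = symAct J M + symAct J M' := by
  ext1 f
  simp [symAct_apply, act_add]

theorem symAct_sub (J : Fin k ↪ Fin N) (M M' : Sch d k →L[ℂ] Sch d k) :
    symAct J (M - M') = symAct J M - symAct J M' := by
  ext1 f
  simp [symAct_apply, act_sub]

theorem symAct_sum {α : Type*} (s : Finset α) (J : Fin k ↪ Fin N)
    (M : α → Sch d k →L[ℂ] Sch d k) : symAct J (∑ a ∈ s, M a) = ∑ a ∈ s, symAct J (M a) := by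
  ext1 f
  simp [symAct_apply, act_sum]

/-- The symmetrization as an operator on `𝓢`. -/
abbrev symOp (d k : ℕ) : Sch d k →L[ℂ] Sch d k := inclB d k ∘L symmetrize d k

theorem symOp_eq : symOp d k = ((Nat.factorial k : ℕ) : ℂ)⁻¹ • ∑ π : Equiv.Perm (Fin k), permOp π := by
  ext1 f
  exact (symmetrize_coe f).trans (by simp)

theorem factorial_inv_mul_card (k : ℕ) : ((Nat.factorial k : ℕ) : ℂ)⁻¹ *
    (Fintype.card (Equiv.Perm (Fin k)) : ℂ) = 1 := by
  rw [Fintype.card_perm, Fintype.card_fin,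
    inv_mul_cancel₀ (Nat.cast_ne_zero.2 (Nat.factorial_ne_zero k))]

/-- A permutation of the k variables becomes a permutation of N labels, which the outer
symmetrization absorbs; so the inner average has no effect. -/
theorem symAct_symOp_comp (J : Fin k ↪ Fin N) (M : Sch d k →L[ℂ] Sch d k) :
    symAct J (symOp d k ∘L M) = symAct J M := by
  have h : symOp d k ∘L M = ((Nat.factorial k : ℕ) : ℂ)⁻¹ •
      ∑ π : Equiv.Perm (Fin k), permOp π ∘L M := by
    rw [symOp_eq]
    ext1 f
    simp
  rw [h, symAct_smul, symAct_sum]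
  simp only [symAct_permOp_comp, Finset.sum_const, Finset.card_univ]
  rw [← Nat.cast_smul_eq_nsmul ℂ, smul_smul, factorial_inv_mul_card, one_smul]

theorem symAct_comp_symOp (J : Fin k ↪ Fin N) (M : Sch d k →L[ℂ] Sch d k) :
    symAct J (M ∘L symOp d k) = symAct J M := by
  have h : M ∘L symOp d k = ((Nat.factorial k : ℕ) : ℂ)⁻¹ •
      ∑ π : Equiv.Perm (Fin k), M ∘L permOp π := by
    rw [symOp_eq]
    ext1 f
    simp
  rw [h, symAct_smul, symAct_sum]
  simp only [symAct_comp_permOp, Finset.sum_const, Finset.card_univ]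
  rw [← Nat.cast_smul_eq_nsmul ℂ, smul_smul, factorial_inv_mul_card, one_smul]

/-- An operator on bosonic functions as an operator on `𝓢`. -/
def liftB (A : BSch d k →L[ℂ] BSch d k) : Sch d k →L[ℂ] Sch d k :=
  inclB d k ∘L A ∘L symmetrize d k

/-- The intermediate symmetrizations are absorbed on both sides. This identifies ε of an observable
that is itself a compression. -/
theorem symAct_liftB_symAct (J : Fin l ↪ Fin k) (J' : Fin k ↪ Fin N)
    (M : Sch d l →L[ℂ] Sch d l) :
    symAct J' (liftB (symAct J M)) = symAct (J.trans J') M := by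
  have h : liftB (symAct J M) = symOp d k ∘L (act J M ∘L symOp d k) := rfl
  rw [h, symAct_symOp_comp, symAct_comp_symOp]
  ext1 f
  rw [symAct_apply, symAct_apply, act_act]

/-- Skew-adjoint operators on `𝓢`. -/
def IsSkew (M : Sch d k →L[ℂ] Sch d k) : Prop :=
  ∀ f g, l2inner (M f) g = -l2inner f (M g)

theorem isSkew_liftB (A : Obs d k) : IsSkew (liftB A.1) := by
  intro f g
  change l2inner (A.1 (symmetrize d k f) : Sch d k) g =
    -l2inner f (A.1 (symmetrize d k g) : Sch d k)
  rw [← l2inner_symmetrize_right, A.2, ← l2inner_symmetrize_left f]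

end Act

/-! ### Fubini for a group of labels and skew-adjointness -/

section Fubini

variable {d k N : ℕ}

/-- The image of Lebesgue measure under `splitL` is a Haar measure, hence a multiple of the product
measure. The constant is irrelevant: the identity is used on both sides of a skew-adjointness
relation. -/
theorem exists_integral_splitL (d : ℕ) (J : Fin k ↪ Fin N) : ∃ c : ℝ, ∀ F : Sch d N,
    ∫ x, F x = c • ∫ z : Rest J → EuclideanSpace ℝ (Fin d), ∫ y : Cfg d k,
      F ((splitL d J).symm (y, z)) := by
  have h1 : (MeasureTheory.Measure.map (splitL d J) MeasureTheory.volume).IsAddHaarMeasure :=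
    (splitL d J).isAddHaarMeasure_map _
  have h3 : (MeasureTheory.volume :
      MeasureTheory.Measure (Rest J → EuclideanSpace ℝ (Fin d))).IsAddHaarMeasure :=
    inferInstanceAs ((MeasureTheory.Measure.pi fun _ : Rest J =>
      (MeasureTheory.volume : MeasureTheory.Measure (EuclideanSpace ℝ (Fin d)))).IsAddHaarMeasure)
  have h2 : (MeasureTheory.volume : MeasureTheory.Measure (Cfg d k ×
      (Rest J → EuclideanSpace ℝ (Fin d)))).IsAddHaarMeasure :=
    MeasureTheory.Measure.prod.instIsAddHaarMeasure MeasureTheory.volume MeasureTheory.volume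
  have h := MeasureTheory.Measure.isAddLeftInvariant_eq_smul
    (MeasureTheory.Measure.map (splitL d J) MeasureTheory.volume) MeasureTheory.volume
  obtain ⟨c, hc⟩ : ∃ c : NNReal, MeasureTheory.Measure.map (splitL d J) MeasureTheory.volume =
      c • MeasureTheory.volume := by
    exact ⟨_, h⟩
  refine ⟨c, fun F => ?_⟩
  have h4 : ∫ x, F x = ∫ p, F ((splitL d J).symm p)
      ∂(MeasureTheory.Measure.map (splitL d J) MeasureTheory.volume) := by
    have h5 : MeasurableEmbedding (splitL d J) := (splitL d J).toHomeomorph.measurableEmbedding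
    rw [h5.integral_map]
    simp
  let F' : 𝓢(Cfg d k × (Rest J → EuclideanSpace ℝ (Fin d)), ℂ) :=
    SchwartzMap.compCLMOfContinuousLinearEquiv ℂ (splitL d J).symm F
  rw [h4, hc, MeasureTheory.integral_smul_nnreal_measure]
  congr 1
  exact MeasureTheory.integral_prod_symm (fun p => F ((splitL d J).symm p)) F'.integrable

/-- The pointwise product of Schwartz functions. -/
def mulS {E : Type*} [NormedAddCommGroup E] [NormedSpace ℝ E] (f g : 𝓢(E, ℂ)) : 𝓢(E, ℂ) :=
  SchwartzMap.pairing (ContinuousLinearMap.mul ℂ ℂ) f g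

@[simp] theorem mulS_apply {E : Type*} [NormedAddCommGroup E] [NormedSpace ℝ E] (f g : 𝓢(E, ℂ))
    (x : E) : mulS f g x = f x * g x := rfl

theorem l2inner_eq_integral_mulS (f g : Sch d k) : l2inner f g = ∫ x, mulS (conjS f) g x := rfl

theorem extend_splitL_symm (J : Fin k ↪ Fin N) (y y' : Cfg d k)
    (z : Rest J → EuclideanSpace ℝ (Fin d)) :
    Function.extend J y' ((splitL d J).symm (y, z)) = (splitL d J).symm (y', z) := by
  rw [← splitL_symm_apply]
  congr 2
  have := (splitL d J).apply_symm_apply (y, z)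
  exact congrArg Prod.snd this

theorem splitL_symm_comp (J : Fin k ↪ Fin N) (y : Cfg d k)
    (z : Rest J → EuclideanSpace ℝ (Fin d)) :
    (fun a => (splitL d J).symm (y, z) (J a)) = y :=
  congrArg Prod.fst ((splitL d J).apply_symm_apply (y, z))

/-- With the variables outside J frozen at z, the skew-adjointness of M applies to the slices; it
remains to integrate over z. -/
theorem isSkew_act (J : Fin k ↪ Fin N) {M : Sch d k →L[ℂ] Sch d k} (hM : IsSkew M) :
    IsSkew (act J M) := by
  intro f g
  obtain ⟨c, hc⟩ := exists_integral_splitL d J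
  rw [l2inner_eq_integral_mulS, l2inner_eq_integral_mulS, hc, hc, ← smul_neg,
    ← MeasureTheory.integral_neg]
  congr 2
  funext z
  have h : ∀ (f : Sch d N) (y : Cfg d k), act J M f ((splitL d J).symm (y, z)) =
      M (sliceE J ((splitL d J).symm (0, z)) f) y := by
    intro f y
    rw [act_apply, splitL_symm_comp]
    congr 2
    ext y'
    rw [sliceE_apply, sliceE_apply, extend_splitL_symm, extend_splitL_symm]
  have h' : ∀ (f : Sch d N) (y : Cfg d k), f ((splitL d J).symm (y, z)) =
      sliceE J ((splitL d J).symm (0, z)) f y := by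
    intro f y
    rw [sliceE_apply, extend_splitL_symm]
  simp only [mulS_apply, conjS_apply, h]
  simp only [h']
  exact hM _ _

theorem isSkew_symAct (J : Fin k ↪ Fin N) {M : Sch d k →L[ℂ] Sch d k} (hM : IsSkew M) :
    symAct J M ∈ observables d N := by
  intro f g
  rw [symAct_apply, symAct_apply, l2inner_symmetrize_left, isSkew_act J hM,
    l2inner_symmetrize_right]

end Fubini

/-! ### The embedding ε as a symmetrized action -/

section Eps

variable {d k l N : ℕ}

theorem slice_coe (f : BSch d N) (x : Cfg d N) (J : Fin k ↪ Fin N) :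
    (slice f x J : Sch d k) = sliceE J x (f : Sch d N) := rfl

theorem act_liftB_apply (J : Fin k ↪ Fin N) (A : BSch d k →L[ℂ] BSch d k) (f : BSch d N)
    (x : Cfg d N) : act J (liftB A) (f : Sch d N) x = (A (slice f x J) : Sch d k) fun a => x (J a) := by
  rw [act_apply, ← slice_coe]
  simp [liftB]

/-- The average over all labels is the symmetrized action. -/
theorem symAct_liftB_coe (hk : k ≤ N) (J : Fin k ↪ Fin N) (A : BSch d k →L[ℂ] BSch d k)
    (f : BSch d N) (x : Cfg d N) : (symAct J (liftB A) f : Sch d N) x =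
      ((N.descFactorial k : ℕ) : ℂ)⁻¹ *
        ∑ j : Fin k ↪ Fin N, (A (slice f x j) : Sch d k) fun i => x (j i) := by
  -- The sum over all labellings is permutation invariant, so it equals its own symmetrization,
  -- which is `N.descFactorial k` copies of the symmetrized action.
  have h1 : ∀ π : Equiv.Perm (Fin N), permOp π (∑ j : Fin k ↪ Fin N, act j (liftB A) (f : Sch d N)) =
      ∑ j : Fin k ↪ Fin N, act j (liftB A) (f : Sch d N) := by
    intro π
    rw [map_sum]
    simp only [permOp_act, permOp_of_mem]
    let e : (Fin k ↪ Fin N) ≃ (Fin k ↪ Fin N) :=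
      { toFun := fun j => j.trans π.toEmbedding
        invFun := fun j => j.trans π.symm.toEmbedding
        left_inv := fun j => by ext a; simp
        right_inv := fun j => by ext a; simp }
    exact Fintype.sum_equiv e _ _ fun j => rfl
  have h2 := symmetrize_of_permOp h1
  have h3 : symmetrize d N (∑ j : Fin k ↪ Fin N, act j (liftB A) (f : Sch d N)) =
      (N.descFactorial k) • symAct J (liftB A) f := by
    have h6 : ∀ j : Fin k ↪ Fin N, symmetrize d N (act j (liftB A) (f : Sch d N)) =
        symAct J (liftB A) f := fun j => congrArg (fun B => B f) (symAct_eq j J (liftB A))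
    rw [map_sum, Finset.sum_congr rfl fun j _ => h6 j, Finset.sum_const, Finset.card_univ, Fintype.card_embedding_eq, Fintype.card_fin,
      Fintype.card_fin]
  rw [h3] at h2
  have h4 := DFunLike.congr_fun h2 x
  have h5 : ((N.descFactorial k : ℕ) : ℂ) ≠ 0 :=
    Nat.cast_ne_zero.2 (Nat.descFactorial_pos.2 hk).ne'
  rw [eq_inv_mul_iff_mul_eq₀ h5]
  simp only [sum_apply, act_liftB_apply] at h4
  rw [← h4, ← Nat.cast_smul_eq_nsmul ℂ]
  rfl

/-- `ε_{k,N} A` is the symmetrized action of `A`. -/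
theorem eps_val (hk : k ≤ N) (J : Fin k ↪ Fin N) (A : Obs d k) :
    (eps k N A).1 = symAct J (liftB A.1) := by
  have h := Classical.epsilon_spec (p := fun B : Obs d N =>
    ∀ (f : BSch d N) (x : Cfg d N),
      (B.1 f : Sch d N) x = ((N.descFactorial k : ℕ) : ℂ)⁻¹ *
        ∑ j : Fin k ↪ Fin N, (A.1 (slice f x j) : Sch d k) fun i => x (j i))
    ⟨⟨symAct J (liftB A.1), isSkew_symAct J (isSkew_liftB A)⟩,
      fun f x => symAct_liftB_coe hk J A.1 f x⟩
  ext f x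
  rw [symAct_liftB_coe hk J]
  exact h f x

theorem eps_val_of_symAct {K : ℕ} (hk : k ≤ N) (J : Fin K ↪ Fin k) (J' : Fin K ↪ Fin N) (A : Obs d k)
    {M : Sch d K →L[ℂ] Sch d K} (hA : A.1 = symAct J M) : (eps k N A).1 = symAct J' M := by
  rw [eps_val hk (Fin.castLEEmb hk) A, hA, symAct_liftB_symAct]
  exact symAct_eq _ _ _

end Eps

/-! ### Integration over the last particle -/

section Fubini

variable {d k : ℕ}

theorem integral_snoc (F : Sch d (k + 1)) : ∫ w, F w = ∫ x : Cfg d k,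
    ∫ y : EuclideanSpace ℝ (Fin d), F (Fin.snoc (α := fun _ => EuclideanSpace ℝ (Fin d)) x y) := by
  have h := MeasureTheory.volume_preserving_piFinSuccAbove
    (fun _ : Fin (k + 1) => EuclideanSpace ℝ (Fin d)) (Fin.last k)
  let e := MeasurableEquiv.piFinSuccAbove (fun _ : Fin (k + 1) => EuclideanSpace ℝ (Fin d)) (Fin.last k)
  have he : ∀ p, e.symm p = Fin.snoc (α := fun _ => EuclideanSpace ℝ (Fin d)) p.2 p.1 := by
    intro p
    exact Fin.insertNth_last' p.1 p.2
  have h1 := h.symm.integral_comp e.symm.measurableEmbedding (fun w => F w)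
  have h2 : MeasureTheory.Integrable (fun p => F (e.symm p)) :=
    (h.symm.integrable_comp_emb e.symm.measurableEmbedding).2 F.integrable
  rw [← h1]
  exact (MeasureTheory.integral_prod_symm (fun p => F (e.symm p)) h2).trans (by simp only [he])

end Fubini

/-! ### Duality of the partial trace; symmetric and Hermitian operators -/

namespace SmoothOp

variable {d k : ℕ}

theorem kernel_comp (B : Sch d k →L[ℂ] Sch d k) (T : SmoothOp d k) (x x' : Cfg d k) :
    kernel (B ∘L T) x x' = B (T (dirac x')) x := rfl

/-- `(z, y) ↦ K(z, y; x, y)`. -/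
def partialKernel (T : SmoothOp d (k + 1)) (x : Cfg d k) :
    𝓢(Cfg d k × EuclideanSpace ℝ (Fin d), ℂ) :=
  sliceAt x (SchwartzMap.compCLMOfContinuousLinearEquiv ℂ
    (D := (Cfg d k × EuclideanSpace ℝ (Fin d)) × Cfg d k)
    (ContinuousLinearEquiv.equivOfInverse
      ((((ContinuousLinearMap.fst ℝ _ _) ∘L (ContinuousLinearMap.fst ℝ _ _)).prod
        (ContinuousLinearMap.snd ℝ _ _)).prod
          ((ContinuousLinearMap.snd ℝ _ _) ∘L (ContinuousLinearMap.fst ℝ _ _)))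
      ((((ContinuousLinearMap.fst ℝ _ _) ∘L (ContinuousLinearMap.fst ℝ _ _)).prod
        (ContinuousLinearMap.snd ℝ _ _)).prod
          ((ContinuousLinearMap.snd ℝ _ _) ∘L (ContinuousLinearMap.fst ℝ _ _)))
      (fun _ => rfl) (fun _ => rfl))
    (pullback (snocPair d k) snocPair_injective (kernelCLM (Cfg d (k + 1)) (Cfg d (k + 1)) T)))

theorem partialKernel_apply (T : SmoothOp d (k + 1)) (x z : Cfg d k)
    (y : EuclideanSpace ℝ (Fin d)) : partialKernel T x (z, y) =
      T.kernel (Fin.snoc (α := fun _ => EuclideanSpace ℝ (Fin d)) z y)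
        (Fin.snoc (α := fun _ => EuclideanSpace ℝ (Fin d)) x y) := by
  rw [kernel_eq]
  rfl

theorem integralRight_partialKernel (T : SmoothOp d (k + 1)) (x : Cfg d k) :
    integralRight _ _ (partialKernel T x) = T.partialTrace (dirac x) := by
  ext z
  rw [integralRight_apply, partialTrace_eq]
  refine Eq.trans ?_ (kernel_partialTraceCLM T z x).symm
  simp only [partialKernel_apply]

theorem extend_castSucc (y x : Cfg d k) (w : EuclideanSpace ℝ (Fin d)) :
    Function.extend (Fin.castSuccEmb : Fin k ↪ Fin (k + 1)) y
      (Fin.snoc (α := fun _ => EuclideanSpace ℝ (Fin d)) x w) =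
      Fin.snoc (α := fun _ => EuclideanSpace ℝ (Fin d)) y w := by
  funext i
  refine Fin.lastCases ?_ (fun i => ?_) i
  · rw [Function.extend_apply']
    · simp
    · rintro ⟨a, ha⟩
      exact (Fin.castSucc_lt_last a).ne ha
  · refine (Fin.castSuccEmb.injective.extend_apply _ _ i).trans ?_
    simp

/-- The partial trace is dual to acting in the first variables. -/
theorem trace_act_comp (D : Sch d k →L[ℂ] Sch d k) (T : SmoothOp d (k + 1)) :
    trace (act Fin.castSuccEmb D ∘L T) = trace (D ∘L T.partialTrace) := by
  have h1 := integral_snoc (diagonal _ (kernelCLM _ _ (act Fin.castSuccEmb D ∘L T)))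
  simp only [diagonal_apply, ← kernel_eq] at h1
  rw [trace, h1, trace]
  congr 1
  funext x
  -- Tr_{k+1} T applied to δ_x is an integral over y of Schwartz functions, and D commutes with this
  -- integral.
  rw [kernel_comp, ← integralRight_partialKernel, map_integralRight]
  congr 1
  funext y
  rw [kernel_comp, act_apply]
  have h2 : (fun a => (Fin.snoc (α := fun _ => EuclideanSpace ℝ (Fin d)) x y : Cfg d (k + 1))
      (Fin.castSuccEmb a)) = x := by
    funext a
    simp
  rw [h2]
  congr 2
  ext z
  rw [sliceE_apply, sliceAt_apply, partialKernel_apply, extend_castSucc]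
  rfl

/-- Symmetric operators. -/
structure IsSymm (T : SmoothOp d k) : Prop where
  left : ∀ π : Equiv.Perm (Fin k), permOp π ∘L T = T
  right : ∀ π : Equiv.Perm (Fin k), T ∘L ContinuousLinearMap.precomp ℂ (permOp π) = T

theorem IsSymm.kernel_left {T : SmoothOp d k} (hT : T.IsSymm) (π : Equiv.Perm (Fin k))
    (x x' : Cfg d k) : T.kernel (fun i => x (π i)) x' = T.kernel x x' := by
  conv_rhs => rw [← hT.left π]
  rfl

theorem IsSymm.kernel_right {T : SmoothOp d k} (hT : T.IsSymm) (π : Equiv.Perm (Fin k))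
    (x x' : Cfg d k) : T.kernel x (fun i => x' (π i)) = T.kernel x x' := by
  conv_rhs => rw [← hT.right π]
  rfl

theorem isSymm_of_kernel {T : SmoothOp d k}
    (h1 : ∀ (π : Equiv.Perm (Fin k)) x x', T.kernel (fun i => x (π i)) x' = T.kernel x x')
    (h2 : ∀ (π : Equiv.Perm (Fin k)) x x', T.kernel x (fun i => x' (π i)) = T.kernel x x') :
    T.IsSymm :=
  ⟨fun π => ext_kernel fun x x' => h1 π x x', fun π => ext_kernel fun x x' => h2 π x x'⟩

theorem IsSymm.add {T S : SmoothOp d k} (hT : T.IsSymm) (hS : S.IsSymm) : (T + S).IsSymm :=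
  ⟨fun π => by rw [ContinuousLinearMap.comp_add, hT.left, hS.left],
    fun π => by rw [ContinuousLinearMap.add_comp, hT.right, hS.right]⟩

theorem IsSymm.smul {T : SmoothOp d k} (c : ℂ) (hT : T.IsSymm) : (c • T).IsSymm :=
  ⟨fun π => by rw [ContinuousLinearMap.comp_smul, hT.left],
    fun π => by
      ext1 u
      exact congrArg (fun S : SmoothOp d k => c • S u) (hT.right π)⟩

theorem IsSymm.sub {T S : SmoothOp d k} (hT : T.IsSymm) (hS : S.IsSymm) : (T - S).IsSymm :=
  ⟨fun π => by rw [ContinuousLinearMap.comp_sub, hT.left, hS.left],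
    fun π => by rw [ContinuousLinearMap.sub_comp, hT.right, hS.right]⟩

/-- Operators that commute with permutations preserve symmetry. -/
theorem IsSymm.commutator {T : SmoothOp d k} (hT : T.IsSymm) {B : Sch d k →L[ℂ] Sch d k}
    (hB : ∀ π : Equiv.Perm (Fin k), permOp π ∘L B = B ∘L permOp π) :
    (SmoothOp.commutator B T).IsSymm := by
  refine IsSymm.sub ⟨fun π => ?_, fun π => ?_⟩ ⟨fun π => ?_, fun π => ?_⟩
  · rw [← ContinuousLinearMap.comp_assoc, hB, ContinuousLinearMap.comp_assoc, hT.left]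
  · rw [ContinuousLinearMap.comp_assoc, hT.right]
  · rw [← ContinuousLinearMap.comp_assoc, hT.left]
  · have h : (ContinuousLinearMap.precomp ℂ B : SchDual d k →L[ℂ] SchDual d k) ∘L
          ContinuousLinearMap.precomp ℂ (permOp π) =
        (ContinuousLinearMap.precomp ℂ (permOp π) : SchDual d k →L[ℂ] SchDual d k) ∘L
          ContinuousLinearMap.precomp ℂ B := by
      ext1 u
      change (u ∘L permOp π) ∘L B = (u ∘L B) ∘L permOp π
      rw [ContinuousLinearMap.comp_assoc, hB, ContinuousLinearMap.comp_assoc]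
    rw [ContinuousLinearMap.comp_assoc, h, ← ContinuousLinearMap.comp_assoc, hT.right]

/-- Symmetrizing on the left does not change the trace of an operator that is symmetric on the
right. -/
theorem trace_symOp_comp {S : SmoothOp d k}
    (hS : ∀ π : Equiv.Perm (Fin k), S ∘L ContinuousLinearMap.precomp ℂ (permOp π) = S) :
    trace (symOp d k ∘L S) = trace S := by
  -- Right symmetry lets the permutation act on both variables of the kernel at once, and the
  -- integral over the diagonal is invariant.
  have h1 : ∀ π : Equiv.Perm (Fin k), traceCLM d k (permOp π ∘L S) = traceCLM d k S := by
    intro π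
    rw [traceCLM_apply, traceCLM_apply, trace, trace, ← integral_comp_perm π (fun x => S.kernel x x)]
    congr 1
    funext x
    conv_lhs => rw [← hS π]
    rfl
  have h : symOp d k ∘L S = ((Nat.factorial k : ℕ) : ℂ)⁻¹ •
      ∑ π : Equiv.Perm (Fin k), permOp π ∘L S := by
    rw [symOp_eq]
    ext1 f
    simp
  rw [← traceCLM_apply, ← traceCLM_apply, h, map_smul, map_sum]
  simp only [h1, Finset.sum_const, Finset.card_univ]
  rw [← Nat.cast_smul_eq_nsmul ℂ, smul_smul, factorial_inv_mul_card, one_smul]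

/-- The compression of an operator to bosonic functions. -/
def ofOp (T : SmoothOp d k) : BSmoothOp d k :=
  symmetrize d k ∘L T ∘L ContinuousLinearMap.precomp ℂ (symmetrize d k)

theorem ofOp_apply (T : SmoothOp d k) (u : BSchDual d k) :
    ofOp T u = symmetrize d k (T (u ∘L symmetrize d k)) := rfl

theorem toOp_apply (T : BSmoothOp d k) (u : SchDual d k) :
    BSmoothOp.toOp T u = (T (u ∘L inclB d k) : Sch d k) := rfl

theorem ofOp_toOp (T : BSmoothOp d k) : ofOp T.toOp = T := by
  ext1 u
  rw [ofOp_apply, toOp_apply, symmetrize_incl]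
  congr 1
  ext f
  simp

theorem toOp_injective : Function.Injective (BSmoothOp.toOp (d := d) (k := k)) :=
  Function.LeftInverse.injective ofOp_toOp

theorem isSymm_toOp (T : BSmoothOp d k) : T.toOp.IsSymm := by
  refine ⟨fun π => ?_, fun π => ?_⟩
  · ext1 u
    exact permOp_of_mem π _
  · ext1 u
    change (T ((u ∘L permOp π) ∘L inclB d k) : Sch d k) = (T (u ∘L inclB d k) : Sch d k)
    congr 2
    ext f
    exact congrArg u (permOp_of_mem π f)

theorem IsSymm.symOp_comp {T : SmoothOp d k} (hT : T.IsSymm) : symOp d k ∘L T = T := by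
  ext1 u
  refine symmetrize_of_permOp fun π => ?_
  exact congrArg (fun S : SmoothOp d k => S u) (hT.left π)

theorem IsSymm.comp_symOp {T : SmoothOp d k} (hT : T.IsSymm) :
    T ∘L ContinuousLinearMap.precomp ℂ (symOp d k) = T := by
  have h : T ∘L ContinuousLinearMap.precomp ℂ (symOp d k) = ((Nat.factorial k : ℕ) : ℂ)⁻¹ •
      ∑ π : Equiv.Perm (Fin k), T ∘L ContinuousLinearMap.precomp ℂ (permOp π) := by
    ext1 u
    have h1 : ContinuousLinearMap.precomp ℂ (symOp d k) u = ((Nat.factorial k : ℕ) : ℂ)⁻¹ •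
      ∑ π : Equiv.Perm (Fin k), ContinuousLinearMap.precomp ℂ (permOp π) u := by
      rw [symOp_eq]
      ext f
      simp
    rw [ContinuousLinearMap.comp_apply, h1, map_smul, map_sum]
    simp
  rw [h]
  simp only [hT.right, Finset.sum_const, Finset.card_univ]
  rw [← Nat.cast_smul_eq_nsmul ℂ, smul_smul, factorial_inv_mul_card, one_smul]

theorem toOp_ofOp {T : SmoothOp d k} (hT : T.IsSymm) : (ofOp T).toOp = T := by
  have h : (ofOp T).toOp = symOp d k ∘L (T ∘L ContinuousLinearMap.precomp ℂ (symOp d k)) := rfl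
  rw [h, hT.comp_symOp, hT.symOp_comp]

/-- The trace of a bosonic observable against a bosonic density. -/
theorem trace_toOp_symAct (M : Sch d k →L[ℂ] Sch d k) (γ : BSmoothOp d k) :
    trace (BSmoothOp.toOp ((symmetrize d k ∘L M ∘L inclB d k) ∘L γ)) = trace (M ∘L γ.toOp) := by
  have h : BSmoothOp.toOp ((symmetrize d k ∘L M ∘L inclB d k) ∘L γ) =
      symOp d k ∘L (M ∘L γ.toOp) := rfl
  rw [h, trace_symOp_comp]
  intro π
  rw [ContinuousLinearMap.comp_assoc, (isSymm_toOp γ).right]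

theorem toOp_comp (A : BSch d k →L[ℂ] BSch d k) (γ : BSmoothOp d k) :
    BSmoothOp.toOp (A ∘L γ) = liftB A ∘L γ.toOp := by
  ext1 u
  change (A (γ _) : Sch d k) = (A (symmetrize d k (γ _ : Sch d k)) : Sch d k)
  rw [symmetrize_incl]

/-- Operators with Hermitian kernel. -/
def IsHerm (T : SmoothOp d k) : Prop :=
  ∀ x x', (starRingEnd ℂ) (T.kernel x x') = T.kernel x' x

/-- Operators that commute with complex conjugation. -/
def IsRealOp (B : Sch d k →L[ℂ] Sch d k) : Prop := ∀ f, conjS (B f) = B (conjS f)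

theorem IsHerm.sliceLeft {T : SmoothOp d k} (hT : T.IsHerm) (x : Cfg d k) :
    conjS (T (dirac x)) = _root_.sliceLeft x (kernelCLM (Cfg d k) (Cfg d k) T) := by
  ext x'
  refine (hT x' x).trans ?_
  rw [kernel_eq]
  rfl

theorem IsHerm.conj_kernel_comp {T : SmoothOp d k} (hT : T.IsHerm) {B : Sch d k →L[ℂ] Sch d k}
    (hB : IsRealOp B) (x x' : Cfg d k) : (starRingEnd ℂ) (kernel (B ∘L T) x x') =
      kernel (T ∘L ContinuousLinearMap.precomp ℂ B) x' x := by
  have h1 : kernel (T ∘L ContinuousLinearMap.precomp ℂ B) x' x = T (dirac x ∘L B) x' := rfl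
  rw [h1, apply_eq, ← hT.sliceLeft, kernel_comp, ← conjS_apply, hB]
  rfl

theorem IsHerm.add {T S : SmoothOp d k} (hT : T.IsHerm) (hS : S.IsHerm) : (T + S).IsHerm :=
  fun x x' => (map_add (starRingEnd ℂ) (T.kernel x x') (S.kernel x x')).trans (by
    rw [hT, hS]; rfl)

theorem IsHerm.smul {T : SmoothOp d k} (c : ℝ) (hT : T.IsHerm) : ((c : ℂ) • T).IsHerm :=
  fun x x' => by
    have h : ∀ x x', kernel ((c : ℂ) • T) x x' = c * T.kernel x x' := fun x x' => rfl
    rw [h, h, map_mul, hT, Complex.conj_ofReal]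

theorem kernel_smul (c : ℂ) (T : SmoothOp d k) (x x' : Cfg d k) :
    kernel (c • T) x x' = c * T.kernel x x' := rfl

theorem kernel_sub (T S : SmoothOp d k) (x x' : Cfg d k) :
    kernel (T - S) x x' = T.kernel x x' - S.kernel x x' := rfl

/-- Conjugation exchanges the two terms of the commutator, which gives the sign; an imaginary factor
restores the Hermitian property. -/
theorem IsHerm.commutator {T : SmoothOp d k} (hT : T.IsHerm) {B : Sch d k →L[ℂ] Sch d k}
    (hB : IsRealOp B) (x x' : Cfg d k) :
    (starRingEnd ℂ) ((SmoothOp.commutator B T).kernel x x') =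
      -(SmoothOp.commutator B T).kernel x' x := by
  have h1 := hT.conj_kernel_comp hB x x'
  have h2 := congrArg (starRingEnd ℂ) (hT.conj_kernel_comp hB x' x)
  rw [Complex.conj_conj] at h2
  rw [SmoothOp.commutator, kernel_sub, map_sub, h1, ← h2, kernel_sub, neg_sub]

/-- Conjugation turns the trace of BT into that of T composed with the transpose of B, and `hc`
identifies the two. This is the reality of the Hamiltonian. -/
theorem IsHerm.conj_trace_comp {T : SmoothOp d k} (hT : T.IsHerm) {B : Sch d k →L[ℂ] Sch d k}
    (hB : IsRealOp B) (hc : trace (B ∘L T) = trace (T ∘L ContinuousLinearMap.precomp ℂ B)) :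
    (starRingEnd ℂ) (trace (B ∘L T)) = trace (B ∘L T) := by
  conv_rhs => rw [hc]
  rw [trace, ← integral_conj]
  simp only [hT.conj_kernel_comp hB]
  rfl

/-- `h` as a distribution. -/
def toDual (h : Sch d k) : SchDual d k :=
  SchwartzMap.integralCLM ℂ MeasureTheory.volume ∘L
    SchwartzMap.pairing (ContinuousLinearMap.mul ℂ ℂ) h

theorem toDual_apply (h f : Sch d k) : toDual h f = ∫ x, h x * f x :=
  SchwartzMap.integralCLM_apply ℂ _

theorem toBDual_apply (h f : BSch d k) : toBDual h f = l2inner (conjS (h : Sch d k)) f := by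
  refine (toDual_apply (h : Sch d k) f).trans ?_
  simp [l2inner]

theorem toDual_eq (h f : Sch d k) : toDual h f = l2inner (conjS h) f := by
  rw [toDual_apply]
  simp [l2inner]

theorem conjS_symmetrize (f : Sch d k) :
    conjS (symmetrize d k f : Sch d k) = symmetrize d k (conjS f) := by
  ext x
  rw [symmetrize_coe, symmetrize_coe]
  simp

theorem toBDual_comp_symmetrize (h : BSch d k) :
    toBDual h ∘L symmetrize d k = toDual (h : Sch d k) := by
  ext f
  rw [ContinuousLinearMap.comp_apply, toBDual_apply, toDual_eq, ← l2inner_symmetrize,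
    ← conjS_symmetrize, symmetrize_incl]

theorem toDual_comp_incl (h : Sch d k) : toDual h ∘L inclB d k = toBDual (symmetrize d k h) := by
  ext f
  rw [toBDual_apply, conjS_symmetrize, l2inner_symmetrize_left, ContinuousLinearMap.comp_apply,
    toDual_eq]
  rfl

theorem apply_toDual (T : SmoothOp d k) (h : Sch d k) (x : Cfg d k) :
    T (toDual h) x = ∫ y, h y * T.kernel x y := by
  rw [apply_eq, toDual_apply]
  simp [kernel_eq]

theorem l2inner_apply_toDual (T : SmoothOp d k) (f g : Sch d k) :
    l2inner f (T (toDual g)) = ∫ x, ∫ y, (starRingEnd ℂ) (f x) * g y * T.kernel x y := by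
  rw [l2inner]
  congr 1
  funext x
  rw [apply_toDual, ← MeasureTheory.integral_const_mul]
  simp only [mul_assoc]

instance instCfgProdHaar (d k l : ℕ) : (MeasureTheory.volume :
    MeasureTheory.Measure (Cfg d k × Cfg d l)).IsAddHaarMeasure :=
  MeasureTheory.Measure.prod.instIsAddHaarMeasure MeasureTheory.volume MeasureTheory.volume

theorem integral_kernel_swap (T : SmoothOp d k) (f g : Sch d k) :
    ∫ x, ∫ y, (starRingEnd ℂ) (f x) * g y * T.kernel x y =
      ∫ y, ∫ x, (starRingEnd ℂ) (f x) * g y * T.kernel x y := by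
  refine MeasureTheory.integral_integral_swap ?_
  have h := (mulS (tensorRight g (conjS f)) (kernelCLM (Cfg d k) (Cfg d k) T)).integrable
    (μ := MeasureTheory.volume)
  refine h.congr (Filter.Eventually.of_forall fun z => ?_)
  simp [kernel_eq, Function.uncurry]

theorem IsHerm.l2inner {T : SmoothOp d k} (hT : T.IsHerm) (f g : Sch d k) :
    l2inner (T (toDual f)) g = l2inner f (T (toDual g)) := by
  rw [l2inner_apply_toDual, ← l2inner_conj_symm, l2inner_apply_toDual, integral_kernel_swap,
    ← integral_conj]
  congr 1
  funext x
  rw [← integral_conj]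
  congr 1
  funext y
  rw [map_mul, map_mul, Complex.conj_conj, hT]
  ring

/-- The operator T' with the conjugate transposed kernel is the formal adjoint. By hypothesis it
agrees with T on Schwartz functions, and testing against all of them identifies the kernels. -/
theorem isHerm_of_l2inner {T : SmoothOp d k}
    (h : ∀ f g, _root_.l2inner (T (toDual f)) g = _root_.l2inner f (T (toDual g))) : T.IsHerm := by
  let T' : SmoothOp d k := ofKernel d k (conjS (swapVars _ _ (kernelCLM (Cfg d k) (Cfg d k) T)))
  have hT' : ∀ x x', T'.kernel x x' = (starRingEnd ℂ) (T.kernel x' x) := by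
    intro x x'
    rw [ofKernel_kernel, conjS_apply, swapVars_apply, kernel_eq]
  have h1 : ∀ f g, _root_.l2inner f (T' (toDual g)) = _root_.l2inner (T (toDual f)) g := by
    intro f g
    rw [l2inner_apply_toDual, ← l2inner_conj_symm, l2inner_apply_toDual, integral_kernel_swap,
      ← integral_conj]
    congr 1
    funext x
    rw [← integral_conj]
    congr 1
    funext y
    rw [map_mul, map_mul, Complex.conj_conj, hT']
    ring
  have h2 : ∀ g, T' (toDual g) = T (toDual g) := fun g =>
    eq_of_l2inner fun f => (h1 f g).trans (h f g)
  intro x x'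
  rw [← hT', ← sub_eq_zero]
  refine eq_zero_of_integral_mul (ψ := fun z => T'.kernel x' z - T.kernel x' z) ?_ (fun g => ?_) x
  · simp only [kernel_eq]
    fun_prop
  · have h3 := DFunLike.congr_fun (h2 g) x'
    rw [apply_toDual, apply_toDual, ← sub_eq_zero, ← MeasureTheory.integral_sub] at h3
    · simpa [mul_sub] using h3
    · exact (mulS g (_root_.sliceLeft x' (kernelCLM (Cfg d k) (Cfg d k) T'))).integrable.congr
        (Filter.Eventually.of_forall fun z => by simp [kernel_eq])
    · exact (mulS g (_root_.sliceLeft x' (kernelCLM (Cfg d k) (Cfg d k) T))).integrable.congr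
        (Filter.Eventually.of_forall fun z => by simp [kernel_eq])

/-- Hermitian operators compress to density matrices. -/
theorem IsHerm.ofOp_mem {T : SmoothOp d k} (hT : T.IsHerm) : ofOp T ∈ densityMatrices d k := by
  intro f g
  rw [ofOp_apply, ofOp_apply, toBDual_comp_symmetrize, toBDual_comp_symmetrize,
    l2inner_symmetrize_left, l2inner_symmetrize_right, hT.l2inner]

theorem isHerm_toOp (γ : DM d k) : (BSmoothOp.toOp γ.1).IsHerm := by
  refine isHerm_of_l2inner fun f g => ?_
  rw [toOp_apply, toOp_apply, toDual_comp_incl, toDual_comp_incl, ← l2inner_symmetrize_right,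
    γ.2, ← l2inner_symmetrize_left f]

end SmoothOp

/-! ### Commutators of symmetrized observables with the Laplacian and the interaction -/

section Commutators

variable {d k l N : ℕ}

/-- The commutator of operators on `𝓢`. -/
def opComm (A B : Sch d k →L[ℂ] Sch d k) : Sch d k →L[ℂ] Sch d k := A ∘L B - B ∘L A

theorem opComm_apply (A B : Sch d k →L[ℂ] Sch d k) (f : Sch d k) :
    opComm A B f = A (B f) - B (A f) := rfl

theorem opComm_sum {α : Type*} (s : Finset α) (A : Sch d k →L[ℂ] Sch d k)
    (B : α → Sch d k →L[ℂ] Sch d k) : opComm A (∑ a ∈ s, B a) = ∑ a ∈ s, opComm A (B a) := by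
  ext1 f
  simp [opComm_apply]

theorem opComm_zero (A : Sch d k →L[ℂ] Sch d k) : opComm A 0 = 0 := by
  ext1 f
  simp [opComm_apply]

theorem act_opComm (J : Fin k ↪ Fin N) (A B : Sch d k →L[ℂ] Sch d k) :
    act J (opComm A B) = opComm (act J A) (act J B) := by
  rw [opComm, act_sub, act_comp, act_comp]
  rfl

/-- Sums over all labels split into the labels used by `J` and the other ones. -/
theorem sum_split {R : Type*} [AddCommMonoid R] (J : Fin k ↪ Fin N) (F : Fin N → R) :
    ∑ i, F i = ∑ a, F (J a) + ∑ i : Rest J, F i := by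
  classical
  rw [← Fintype.sum_subtype_add_sum_subtype (fun i => ∀ a, J a ≠ i) F, add_comm]
  congr 1
  let e : Fin k ≃ {i // ¬ ∀ a, J a ≠ i} := Equiv.ofBijective
    (fun a => ⟨J a, fun h => h a rfl⟩) ⟨fun a b h => J.injective (congrArg Subtype.val h), by
      rintro ⟨i, hi⟩
      push Not at hi
      obtain ⟨a, ha⟩ := hi
      exact ⟨a, Subtype.ext ha⟩⟩
  exact (Fintype.sum_equiv e _ _ fun a => rfl).symm

theorem card_rest (J : Fin k ↪ Fin N) : (Fintype.card (Rest J) : ℂ) = N - k := by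
  have h := sum_split J fun _ => (1 : ℂ)
  simp only [Finset.sum_const, Finset.card_univ, Fintype.card_fin, nsmul_eq_mul, mul_one] at h
  rw [h]
  ring

/-! ### Interactions -/

variable {U : EuclideanSpace ℝ (Fin d) → ℝ}

theorem pairMul_apply (hU : U.HasTemperateGrowth) (i j : Fin k) (f : Sch d k) (x : Cfg d k) :
    pairMul U i j f x = U (x i - x j) * f x :=
  SchwartzMap.smulLeftCLM_apply_apply (SmoothOp.hasTemperateGrowth_pair hU i j) f x

theorem pairMul_swap (hU : U.HasTemperateGrowth) (he : ∀ x, U (-x) = U x) (i j : Fin k) :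
    pairMul U i j = pairMul U j i := by
  ext f x
  rw [pairMul_apply hU, pairMul_apply hU, ← he (x i - x j), neg_sub]

theorem permOp_pairMul (hU : U.HasTemperateGrowth) (σ : Equiv.Perm (Fin k)) (i j : Fin k)
    (f : Sch d k) : permOp σ (pairMul U i j f) = pairMul U (σ i) (σ j) (permOp σ f) := by
  ext x
  rw [permOp_apply, pairMul_apply hU, pairMul_apply hU, permOp_apply]

theorem act_pairMul (hU : U.HasTemperateGrowth) (J : Fin k ↪ Fin N) (a b : Fin k) :
    act J (pairMul U a b) = pairMul U (J a) (J b) := by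
  ext f x
  rw [act_apply, pairMul_apply hU, pairMul_apply hU, sliceE_apply, extend_self]

/-- With both particles outside J, the potential is a scalar on the slice on which M acts. -/
theorem opComm_act_pairMul_rest (hU : U.HasTemperateGrowth) (J : Fin k ↪ Fin N)
    (M : Sch d k →L[ℂ] Sch d k) (i j : Rest J) :
    opComm (act J M) (pairMul U (i : Fin N) j) = 0 := by
  ext f x
  have hi : ∀ y : Cfg d k, (Function.extend J y x : Cfg d N) i = x i := fun y =>
    Function.extend_apply' _ _ _ fun ⟨b, hb⟩ => i.2 b hb
  have hj : ∀ y : Cfg d k, (Function.extend J y x : Cfg d N) j = x j := fun y =>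
    Function.extend_apply' _ _ _ fun ⟨b, hb⟩ => j.2 b hb
  have h : sliceE J x (pairMul U (i : Fin N) j f) = (U (x i - x j) : ℂ) • sliceE J x f := by
    ext y
    rw [sliceE_apply, pairMul_apply hU, hi, hj]
    rfl
  rw [opComm_apply, sub_apply, act_apply, pairMul_apply hU, act_apply, h, map_smul]
  simp

/-- The sum of the interactions over all ordered pairs of distinct particles. -/
def pairTotal (U : EuclideanSpace ℝ (Fin d) → ℝ) (k : ℕ) : Sch d k →L[ℂ] Sch d k :=
  ∑ i : Fin k, ∑ j : Fin k, if i = j then 0 else pairMul U i j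

/-- Operators that commute with permutations of the particles. -/
def CommPerm (B : Sch d k →L[ℂ] Sch d k) : Prop :=
  ∀ π : Equiv.Perm (Fin k), permOp π ∘L B = B ∘L permOp π

theorem commPerm_pairTotal (hU : U.HasTemperateGrowth) : CommPerm (pairTotal U k) := by
  intro π
  ext1 f
  simp only [ContinuousLinearMap.comp_apply, pairTotal, sum_apply, map_sum]
  refine Fintype.sum_equiv π _ _ fun i => Fintype.sum_equiv π _ _ fun j => ?_
  by_cases h : i = j
  · simp [h]
  · rw [if_neg h, if_neg fun h' => h (π.injective h'), permOp_pairMul hU]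

/-! ### Laplacians -/

theorem dirDeriv_permOp (π : Equiv.Perm (Fin k)) (v : Cfg d k) (f : Sch d k) :
    dirDeriv v (permOp π f) = permOp π (dirDeriv (fun i => v (π i)) f) :=
  dirDeriv_pullback _ _ f v

theorem laplacianAt_apply (j : Fin k) (f : Sch d k) : laplacianAt d k j f =
    ∑ a : Fin d, dirDeriv (Pi.single j (EuclideanSpace.single a (1 : ℝ)) : Cfg d k)
      (dirDeriv (Pi.single j (EuclideanSpace.single a (1 : ℝ)) : Cfg d k) f) := by
  rw [laplacianAt, sum_apply]
  rfl

theorem single_comp_perm (π : Equiv.Perm (Fin k)) (j : Fin k) (w : EuclideanSpace ℝ (Fin d)) :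
    (fun i => (Pi.single (π j) w : Cfg d k) (π i)) = Pi.single j w := by
  funext i
  by_cases h : i = j
  · subst h
    simp
  · rw [Pi.single_eq_of_ne h, Pi.single_eq_of_ne fun h' => h (π.injective h')]

theorem permOp_laplacianAt (π : Equiv.Perm (Fin k)) (j : Fin k) (f : Sch d k) :
    permOp π (laplacianAt d k j f) = laplacianAt d k (π j) (permOp π f) := by
  rw [laplacianAt_apply, laplacianAt_apply, map_sum]
  refine Finset.sum_congr rfl fun a _ => ?_
  rw [dirDeriv_permOp, single_comp_perm, dirDeriv_permOp, single_comp_perm]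

theorem totalLaplacian_apply (f : Sch d k) :
    totalLaplacian d k f = ∑ j, laplacianAt d k j f := by
  rw [totalLaplacian, sum_apply]

theorem commPerm_totalLaplacian : CommPerm (totalLaplacian d k) := by
  intro π
  ext1 f
  simp only [ContinuousLinearMap.comp_apply, totalLaplacian_apply, map_sum]
  exact Fintype.sum_equiv π _ _ fun j => permOp_laplacianAt π j f

theorem dirDeriv_comp_splitL (J : Fin k ↪ Fin N) (v : Cfg d N)
    (F : 𝓢(Cfg d k × (Rest J → EuclideanSpace ℝ (Fin d)), ℂ)) :
    dirDeriv v (SchwartzMap.compCLMOfContinuousLinearEquiv ℂ (splitL d J) F) =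
      SchwartzMap.compCLMOfContinuousLinearEquiv ℂ (splitL d J) (dirDeriv (splitL d J v) F) := by
  ext x
  refine (hasDerivAt_line_zero _ x v).unique ?_
  simpa using hasDerivAt_line_zero F (splitL d J x) (splitL d J v)

theorem dirDeriv_comp_splitL_symm (J : Fin k ↪ Fin N) (v : Cfg d N) (f : Sch d N) :
    dirDeriv (splitL d J v) (SchwartzMap.compCLMOfContinuousLinearEquiv ℂ (splitL d J).symm f) =
      SchwartzMap.compCLMOfContinuousLinearEquiv ℂ (splitL d J).symm (dirDeriv v f) := by
  ext x
  refine (hasDerivAt_line_zero _ x (splitL d J v)).unique ?_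
  simpa using hasDerivAt_line_zero f ((splitL d J).symm x) v

/-- In the split coordinates the direction has no component in J, and such a derivative of M ⊗ 1
falls on the argument. -/
theorem dirDeriv_act_rest (J : Fin k ↪ Fin N) (M : Sch d k →L[ℂ] Sch d k) (i : Rest J)
    (w : EuclideanSpace ℝ (Fin d)) (f : Sch d N) :
    dirDeriv (Pi.single (i : Fin N) w : Cfg d N) (act J M f) =
      act J M (dirDeriv (Pi.single (i : Fin N) w : Cfg d N) f) := by
  have h : splitL d J (Pi.single (i : Fin N) w) =
      (0, fun j : Rest J => (Pi.single (i : Fin N) w : Cfg d N) j) := by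
    rw [splitL_apply]
    refine Prod.ext (funext fun a => ?_) rfl
    exact Pi.single_eq_of_ne (i.2 a) _
  change dirDeriv _ (SchwartzMap.compCLMOfContinuousLinearEquiv ℂ (splitL d J)
    (tensLM _ M (SchwartzMap.compCLMOfContinuousLinearEquiv ℂ (splitL d J).symm f))) = _
  rw [dirDeriv_comp_splitL, h, dirDeriv_tensLM_right, ← h, dirDeriv_comp_splitL_symm]
  rfl

theorem opComm_act_laplacianAt_rest (J : Fin k ↪ Fin N) (M : Sch d k →L[ℂ] Sch d k) (i : Rest J) :
    opComm (act J M) (laplacianAt d N i) = 0 := by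
  ext1 f
  rw [opComm_apply, laplacianAt_apply, laplacianAt_apply, map_sum, zero_apply, sub_eq_zero]
  simp only [dirDeriv_act_rest]

theorem act_dirDeriv (J : Fin k ↪ Fin N) (a : Fin k) (w : EuclideanSpace ℝ (Fin d)) :
    act J (dirDeriv (Pi.single a w : Cfg d k)) = dirDeriv (Pi.single (J a) w : Cfg d N) := by
  ext f x
  rw [act_apply]
  refine (hasDerivAt_line_zero (sliceE J x f) (fun a => x (J a)) (Pi.single a w)).unique ?_
  have h := hasDerivAt_line_zero f x (Pi.single (J a) w)
  refine h.congr_of_eventuallyEq (Filter.Eventually.of_forall fun s => ?_)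
  simp only [sliceE_apply]
  congr 1
  funext i
  by_cases hi : ∃ b, J b = i
  · obtain ⟨b, rfl⟩ := hi
    rw [J.injective.extend_apply]
    by_cases hb : b = a
    · subst hb
      simp
    · simp [Pi.single_eq_of_ne hb, Pi.single_eq_of_ne fun h' => hb (J.injective h')]
  · rw [Function.extend_apply' _ _ _ hi]
    have : i ≠ J a := fun h' => hi ⟨a, h'.symm⟩
    simp [Pi.single_eq_of_ne this]

theorem act_laplacianAt (J : Fin k ↪ Fin N) (a : Fin k) :
    act J (laplacianAt d k a) = laplacianAt d N (J a) := by
  have h : laplacianAt d k a = ∑ b : Fin d,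
      dirDeriv (Pi.single a (EuclideanSpace.single b (1 : ℝ)) : Cfg d k) ∘L
        dirDeriv (Pi.single a (EuclideanSpace.single b (1 : ℝ)) : Cfg d k) := rfl
  rw [h, act_sum]
  simp only [act_comp, act_dirDeriv]
  rfl

/-- The Laplacians of particles outside J commute with an action in J, and the others are themselves
actions in J. -/
theorem opComm_act_totalLaplacian (J : Fin k ↪ Fin N) (M : Sch d k →L[ℂ] Sch d k) :
    opComm (act J M) (totalLaplacian d N) = act J (opComm M (totalLaplacian d k)) := by
  rw [totalLaplacian, opComm_sum, sum_split J, Finset.sum_eq_zero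
    (fun i _ => opComm_act_laplacianAt_rest J M i) (s := (Finset.univ : Finset (Rest J))), add_zero,
    totalLaplacian, opComm_sum, act_sum]
  simp only [act_opComm, act_laplacianAt]

/-! ### Bosonic operators -/

/-- An operator on `𝓢` compressed to bosonic functions. -/
def bos (B : Sch d k →L[ℂ] Sch d k) : BSch d k →L[ℂ] BSch d k :=
  symmetrize d k ∘L B ∘L inclB d k

theorem bos_apply (B : Sch d k →L[ℂ] Sch d k) (f : BSch d k) :
    bos B f = symmetrize d k (B f) := rfl

theorem symAct_eq_bos (J : Fin k ↪ Fin N) (M : Sch d k →L[ℂ] Sch d k) :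
    symAct J M = bos (act J M) := rfl

theorem CommPerm.bos_coe {B : Sch d k →L[ℂ] Sch d k} (hB : CommPerm B) (f : BSch d k) :
    (bos B f : Sch d k) = B f :=
  symmetrize_of_permOp fun π => by
    have h := congrArg (fun S : Sch d k →L[ℂ] Sch d k => S f) (hB π)
    refine h.trans ?_
    rw [ContinuousLinearMap.comp_apply, permOp_of_mem]
    rfl

theorem CommPerm.bos_symmetrize {B : Sch d k →L[ℂ] Sch d k} (hB : CommPerm B) (f : Sch d k) :
    bos B (symmetrize d k f) = symmetrize d k (B f) := by
  have h : ∀ π : Equiv.Perm (Fin k), B (permOp π f) = permOp π (B f) := fun π =>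
    (congrArg (fun S : Sch d k →L[ℂ] Sch d k => S f) (hB π)).symm
  rw [bos_apply, symmetrize_coe, map_smul, map_sum, map_smul, map_sum]
  simp only [h, symmetrize_permOp, Finset.sum_const, Finset.card_univ]
  rw [← Nat.cast_smul_eq_nsmul ℂ, smul_smul, factorial_inv_mul_card, one_smul]

/-- B preserves bosonic functions and commutes with the symmetrization, so compression is
multiplicative when one factor is B. -/
theorem CommPerm.comm_bos {B : Sch d k →L[ℂ] Sch d k} (hB : CommPerm B)
    (A : Sch d k →L[ℂ] Sch d k) : bos A ∘L bos B - bos B ∘L bos A = bos (opComm A B) := by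
  ext1 f
  simp only [sub_apply, ContinuousLinearMap.comp_apply]
  rw [bos_apply A f, hB.bos_symmetrize, bos_apply A, hB.bos_coe, bos_apply, opComm_apply, map_sub]

theorem bos_smul (c : ℂ) (A : Sch d k →L[ℂ] Sch d k) : bos (c • A) = c • bos A := by
  ext1 f
  simp [bos_apply]

theorem bos_zero : bos (0 : Sch d k →L[ℂ] Sch d k) = 0 := by
  ext1 f
  simp [bos_apply]

theorem bos_sum {α : Type*} (s : Finset α) (A : α → Sch d k →L[ℂ] Sch d k) :
    bos (∑ a ∈ s, A a) = ∑ a ∈ s, bos (A a) := by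
  ext1 f
  simp [bos_apply]

theorem comm_symAct_totalLaplacian (J : Fin k ↪ Fin N) (M : Sch d k →L[ℂ] Sch d k) :
    symAct J M ∘L bos (totalLaplacian d N) - bos (totalLaplacian d N) ∘L symAct J M =
      symAct J (opComm M (totalLaplacian d k)) := by
  rw [symAct_eq_bos, commPerm_totalLaplacian.comm_bos, opComm_act_totalLaplacian]
  rfl

/-- The commutator with an interaction with an external particle does not depend on the label of
that particle. -/
theorem bos_opComm_act_pairMul (hU : U.HasTemperateGrowth) (J : Fin k ↪ Fin N)
    (M : Sch d k →L[ℂ] Sch d k) (a : Fin k) (i j : Rest J) :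
    bos (opComm (act J M) (pairMul U (J a) i)) = bos (opComm (act J M) (pairMul U (J a) j)) := by
  -- The transposition of i and j fixes the labels in J and the bosonic input, and the
  -- symmetrization absorbs it.
  let σ : Equiv.Perm (Fin N) := Equiv.swap i j
  have hσ : ∀ b, σ (J b) = J b := fun b => Equiv.swap_apply_of_ne_of_ne (i.2 b) (j.2 b)
  have hJ : J.trans σ.toEmbedding = J := by
    ext b
    simp [hσ]
  ext1 f
  rw [bos_apply, bos_apply, ← symmetrize_permOp σ]
  congr 1
  rw [opComm_apply, map_sub, permOp_act, hJ, permOp_pairMul hU, permOp_pairMul hU, permOp_act, hJ,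
    permOp_of_mem, hσ, Equiv.swap_apply_left, opComm_apply]

/-- Ordered pairs are split according to which labels lie in J. Pairs inside give the commutator in
k variables and pairs outside commute. For fixed a, the mixed pairs, in either order and for each of
the N - k outer labels, all give the operator with outer label m; hence the factor 2 (N - k). -/
theorem comm_symAct_pairTotal (hU : U.HasTemperateGrowth) (he : ∀ x, U (-x) = U x)
    (J : Fin k ↪ Fin N) (m : Rest J) (M : Sch d k →L[ℂ] Sch d k) :
    symAct J M ∘L bos (pairTotal U N) - bos (pairTotal U N) ∘L symAct J M =
      symAct J (opComm M (pairTotal U k)) +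
        (2 * ((N : ℂ) - k)) • ∑ a, bos (opComm (act J M) (pairMul U (J a) m)) := by
  rw [symAct_eq_bos, (commPerm_pairTotal hU).comm_bos]
  let g : Fin N → Fin N → BSch d N →L[ℂ] BSch d N := fun i j =>
    bos (opComm (act J M) (if i = j then 0 else pairMul U i j))
  have hg : bos (opComm (act J M) (pairTotal U N)) = ∑ i, ∑ j, g i j := by
    simp only [pairTotal, opComm_sum, bos_sum, g]
  have h1 : ∀ a b, g (J a) (J b) = symAct J (opComm M (if a = b then 0 else pairMul U a b)) := by
    intro a b
    rw [symAct_eq_bos, act_opComm]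
    by_cases h : a = b
    · simp only [g, h, if_true, opComm_zero]
      have : act (d := d) J 0 = 0 := by
        ext f x
        simp [act_apply]
      rw [this, opComm_zero]
    · simp only [g, if_neg h, if_neg fun h' => h (J.injective h'), act_pairMul hU]
  have h2 : ∀ a (j : Rest J), g (J a) j = bos (opComm (act J M) (pairMul U (J a) m)) := by
    intro a j
    simp only [g, if_neg (j.2 a)]
    exact bos_opComm_act_pairMul hU J M a j m
  have h3 : ∀ (i : Rest J) b, g i (J b) = bos (opComm (act J M) (pairMul U (J b) m)) := by
    intro i b
    have hne : (i : Fin N) ≠ J b := fun h' => i.2 b h'.symm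
    simp only [g, if_neg hne]
    rw [pairMul_swap hU he]
    exact bos_opComm_act_pairMul hU J M b i m
  have h4 : ∀ i j : Rest J, g i j = 0 := by
    intro i j
    by_cases h : (i : Fin N) = j
    · simp only [g, if_pos h, opComm_zero, bos_zero]
    · simp only [g, if_neg h, opComm_act_pairMul_rest hU, bos_zero]
  have h5 : symAct J (opComm M (pairTotal U k)) = ∑ a, ∑ b, g (J a) (J b) := by
    simp only [pairTotal, opComm_sum, symAct_sum, h1]
  rw [hg, h5, sum_split J]
  simp only [sum_split J (fun j => g _ j), Finset.sum_add_distrib, h2, h3, h4,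
    Finset.sum_const_zero, add_zero, Finset.sum_const, Finset.card_univ, ← Nat.cast_smul_eq_nsmul ℂ,
    card_rest, ← Finset.smul_sum]
  rw [add_assoc, ← add_smul]
  congr 2
  ring

theorem act_refl (M : Sch d k →L[ℂ] Sch d k) : act (Function.Embedding.refl (Fin k)) M = M := by
  ext f x
  rw [act_apply]
  have h : sliceE (Function.Embedding.refl (Fin k)) x f = f := by
    ext y
    rw [sliceE_apply]
    congr 1
    funext i
    exact (Function.Embedding.refl (Fin k)).injective.extend_apply y x i
  rw [h]
  rfl

theorem symAct_refl (M : Sch d k →L[ℂ] Sch d k) :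
    symAct (Function.Embedding.refl (Fin k)) M = bos M := by
  rw [symAct_eq_bos, act_refl]

theorem comm_bos_pairTotal (hU : U.HasTemperateGrowth) (M : Sch d k →L[ℂ] Sch d k) :
    bos M ∘L bos (pairTotal U k) - bos (pairTotal U k) ∘L bos M =
      bos (opComm M (pairTotal U k)) := (commPerm_pairTotal hU).comm_bos M

/-- The operator of `k + 1` variables produced by one additional particle. -/
def nextOp (U : EuclideanSpace ℝ (Fin d) → ℝ) (N : ℕ) (M : Sch d k →L[ℂ] Sch d k) :
    Sch d (k + 1) →L[ℂ] Sch d (k + 1) :=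
  act Fin.castSuccEmb (opComm M (pairTotal U k)) + (2 * ((N : ℂ) - k)) •
    ∑ a : Fin k, opComm (act Fin.castSuccEmb M) (pairMul U a.castSucc (Fin.last k))

/-- The last of the k + 1 labels is taken as the external particle, so every term becomes an action
in the same k + 1 labels. -/
theorem comm_symAct_pairTotal_eq (hU : U.HasTemperateGrowth) (he : ∀ x, U (-x) = U x)
    (K : Fin (k + 1) ↪ Fin N) (M : Sch d k →L[ℂ] Sch d k) :
    symAct (Fin.castSuccEmb.trans K) M ∘L bos (pairTotal U N) -
      bos (pairTotal U N) ∘L symAct (Fin.castSuccEmb.trans K) M = symAct K (nextOp U N M) := by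
  have hm : ∀ a, (Fin.castSuccEmb.trans K : Fin k ↪ Fin N) a ≠ K (Fin.last k) := fun a h =>
    (Fin.castSucc_lt_last a).ne (K.injective h)
  have h := comm_symAct_pairTotal hU he (Fin.castSuccEmb.trans K) ⟨K (Fin.last k), hm⟩ M
  have h1 : symAct (Fin.castSuccEmb.trans K) (opComm M (pairTotal U k)) =
      symAct K (act Fin.castSuccEmb (opComm M (pairTotal U k))) := by
    rw [symAct_eq_bos K, act_act, symAct_eq_bos]
  have h2 : ∀ a : Fin k, bos (opComm (act (Fin.castSuccEmb.trans K) M)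
      (pairMul U (K a.castSucc) (K (Fin.last k)))) =
      symAct K (opComm (act Fin.castSuccEmb M) (pairMul U a.castSucc (Fin.last k))) := fun a => by
    rw [symAct_eq_bos K, act_opComm, act_act, act_pairMul hU]
  rw [h1] at h
  refine h.trans ?_
  rw [nextOp, symAct_add, symAct_smul, symAct_sum, ← Finset.sum_congr rfl fun a _ => h2 a]
  rfl

/-- The one-particle Laplacian symmetrized over `N` particles. -/
theorem smul_symAct_laplacian (J : Fin 1 ↪ Fin N) :
    (N : ℂ) • symAct (d := d) J (totalLaplacian d 1) = bos (totalLaplacian d N) := by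
  have h : ∀ i : Fin N, bos (laplacianAt d N i) = symAct J (totalLaplacian d 1) := by
    intro i
    let J' : Fin 1 ↪ Fin N := ⟨fun _ => i, fun a b _ => Subsingleton.elim a b⟩
    rw [symAct_eq J J', symAct_eq_bos, totalLaplacian, act_sum, Fin.sum_univ_one, act_laplacianAt]
    rfl
  have h' : bos (totalLaplacian d N) = ∑ i, bos (laplacianAt d N i) := bos_sum _ _
  rw [h']
  simp only [h, Finset.sum_const, Finset.card_univ, Fintype.card_fin, ← Nat.cast_smul_eq_nsmul ℂ]

/-- The pair interaction symmetrized over `N` particles. -/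
theorem smul_symAct_pairMul (hU : U.HasTemperateGrowth) (J : Fin 2 ↪ Fin N) :
    ((N : ℂ) * (N - 1)) • symAct J (pairMul U 0 1) = bos (pairTotal U N) := by
  -- All N² ordered pairs give the same operator except the N diagonal ones, which are subtracted.
  have h : ∀ i j : Fin N, bos (if i = j then 0 else pairMul U i j) =
      symAct J (pairMul U 0 1) - (if i = j then symAct J (pairMul U 0 1) else 0) := by
    intro i j
    by_cases hij : i = j
    · simp [hij, bos_zero]
    · let J' : Fin 2 ↪ Fin N := ⟨![i, j], by
        intro a b
        fin_cases a <;> fin_cases b <;> simp [hij, Ne.symm hij]⟩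
      rw [if_neg hij, if_neg hij, sub_zero, symAct_eq J J', symAct_eq_bos, act_pairMul hU]
      rfl
  rw [pairTotal, bos_sum]
  simp only [bos_sum, h, Finset.sum_sub_distrib, Finset.sum_const, Finset.card_univ,
    Fintype.card_fin, Finset.sum_ite_eq, Finset.mem_univ, if_true, ← Nat.cast_smul_eq_nsmul ℂ]
  rw [smul_smul, mul_sub, mul_one]
  exact sub_smul ((N : ℂ) * N) (N : ℂ) (symAct J (pairMul U 0 1))

end Commutators

/-! ### Injectivity of ε through tensor powers -/

section Injectivity

variable {d k N : ℕ}

theorem prod_split {R : Type*} [CommMonoid R] (J : Fin k ↪ Fin N) (F : Fin N → R) :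
    ∏ i, F i = (∏ a, F (J a)) * ∏ i : Rest J, F i :=
  sum_split (R := Additive R) J F

/-- Ryser's formula for the permanent. -/
theorem sum_neg_one_pow_mul_prod_sum {R : Type*} [CommRing R] (a : Fin k → Fin k → R) :
    ∑ T : Finset (Fin k), (-1) ^ T.card * ∏ j, ∑ i ∈ Tᶜ, a i j =
      ∑ σ : Equiv.Perm (Fin k), ∏ j, a (σ j) j := by
  classical
  -- Expanding the product gives the maps p whose image avoids T. The signed sum over T inside the
  -- complement of the image vanishes unless p is surjective, hence bijective.
  have h1 : ∀ T : Finset (Fin k), ∏ j, ∑ i ∈ Tᶜ, a i j =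
      ∑ p : Fin k → Fin k, if T ⊆ (Finset.univ.image p)ᶜ then ∏ j, a (p j) j else 0 := by
    intro T
    rw [Finset.prod_univ_sum, ← Finset.sum_filter]
    refine Finset.sum_congr ?_ fun _ _ => rfl
    ext p
    simp only [Fintype.mem_piFinset, Finset.mem_compl, Finset.mem_filter, Finset.mem_univ, true_and,
      Finset.subset_iff, Finset.mem_image, not_exists]
    exact ⟨fun h i hi j hj => h j (hj ▸ hi), fun h j hj => h hj j rfl⟩
  simp only [h1, Finset.mul_sum]
  rw [Finset.sum_comm]
  have h2 : ∀ p : Fin k → Fin k, ∑ T : Finset (Fin k), (-1) ^ T.card *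
      (if T ⊆ (Finset.univ.image p)ᶜ then ∏ j, a (p j) j else 0) =
      if Function.Bijective p then ∏ j, a (p j) j else 0 := by
    intro p
    have h3 := Finset.sum_powerset_neg_one_pow_card (x := (Finset.univ.image p)ᶜ)
    have h4 : ((Finset.univ.image p)ᶜ = ∅) ↔ Function.Bijective p := by
      rw [Finset.compl_eq_empty_iff, ← Finite.surjective_iff_bijective, Finset.eq_univ_iff_forall]
      simp [Function.Surjective]
    simp only [mul_ite, mul_zero, ← Finset.sum_filter]
    rw [← Finset.sum_mul]
    have h5 : (Finset.univ.filter fun T : Finset (Fin k) => T ⊆ (Finset.univ.image p)ᶜ) =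
        ((Finset.univ.image p)ᶜ).powerset := by
      ext T
      simp
    have h6 : (∑ T ∈ ((Finset.univ.image p)ᶜ).powerset, (-1 : R) ^ T.card) =
        if Function.Bijective p then 1 else 0 := by
      have := congrArg (Int.cast : ℤ → R) h3
      simpa [h4] using this
    rw [h5, h6, ite_mul, one_mul, zero_mul]
  simp only [h2]
  rw [← Finset.sum_filter]
  refine (Finset.sum_bij (fun (σ : Equiv.Perm (Fin k)) _ => (σ : Fin k → Fin k)) ?_ ?_ ?_ ?_).symm
  · exact fun σ _ => Finset.mem_filter.2 ⟨Finset.mem_univ _, σ.bijective⟩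
  · exact fun σ _ τ _ h => DFunLike.coe_injective h
  · exact fun p hp => ⟨Equiv.ofBijective p (Finset.mem_filter.1 hp).2, Finset.mem_univ _, rfl⟩
  · exact fun _ _ => rfl

/-- Symmetric functions of `k` variables are determined by their symmetrized products with
functions of the other `N - k` variables. -/
theorem eq_zero_of_sum_embedding {E : Type*} (hk : k ≤ N) {a : (Fin k → E) → ℂ}
    (ha : ∀ (π : Equiv.Perm (Fin k)) x, a (fun i => x (π i)) = a x) {h : E → ℂ} {y₀ : E}
    (hy₀ : h y₀ ≠ 0)
    (h0 : ∀ x : Fin N → E, ∑ J : Fin k ↪ Fin N, a (fun i => x (J i)) * ∏ i : Rest J, h (x i) = 0)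
    (z : Fin k → E) : a z = 0 := by
  classical
  -- Strong induction on the number of coordinates of z that differ from the base point y₀.
  generalize hm : (Finset.univ.filter fun i => z i ≠ y₀).card = m
  induction m using Nat.strong_induction_on generalizing z with
  | _ m ih =>
  let I : Fin k ↪ Fin N := Fin.castLEEmb hk
  -- The other N - k particles sit at y₀. A labelling that covers S contributes a z * h y₀ ^ (N - k)
  -- by symmetry of a; any other one sees fewer coordinates off y₀ and contributes zero by
  -- induction.
  let x : Fin N → E := Function.extend I z fun _ => y₀
  have hxI : ∀ i, x (I i) = z i := fun i => I.injective.extend_apply z _ i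
  let S : Finset (Fin N) := Finset.univ.filter fun i => x i ≠ y₀
  have hSI : S = (Finset.univ.filter fun i => z i ≠ y₀).map I := by
    ext i
    simp only [S, Finset.mem_filter, Finset.mem_univ, true_and, Finset.mem_map]
    constructor
    · intro hi
      by_cases hex : ∃ b, I b = i
      · obtain ⟨b, rfl⟩ := hex
        exact ⟨b, by rwa [hxI] at hi, rfl⟩
      · exact absurd (Function.extend_apply' _ _ _ hex) hi
    · rintro ⟨b, hb, rfl⟩
      rwa [hxI]
  have hS : S.card = m := by rw [hSI, Finset.card_map, hm]
  have hcard : ∀ J : Fin k ↪ Fin N, Fintype.card (Rest J) = N - k := by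
    intro J
    have := card_rest J
    rw [← Nat.cast_sub hk] at this
    exact_mod_cast this
  have hterm : ∀ J : Fin k ↪ Fin N, a (fun i => x (J i)) * ∏ i : Rest J, h (x i) =
      if (∀ i ∈ S, ∃ b, J b = i) then a z * h y₀ ^ (N - k) else 0 := by
    intro J
    split_ifs with hJ
    · have h1 : ∏ i : Rest J, h (x i) = h y₀ ^ (N - k) := by
        rw [← hcard J, ← Finset.card_univ, ← Finset.prod_const]
        refine Finset.prod_congr rfl fun i _ => ?_
        by_contra hne
        have hi : (i : Fin N) ∈ S := by
          simp only [S, Finset.mem_filter, Finset.mem_univ, true_and]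
          exact fun h' => hne (congrArg h h')
        obtain ⟨b, hb⟩ := hJ i hi
        exact i.2 b hb
      rw [h1]
      congr 1
      have h2 : ∀ b : {b // z b ≠ y₀}, ∃ c, J c = I b := fun b => hJ _ (by
        simp only [S, Finset.mem_filter, Finset.mem_univ, true_and, hxI]
        exact b.2)
      choose c hc using h2
      have h3 : ∀ b, x (J (c b)) ≠ y₀ := fun b => by
        rw [hc, hxI]
        exact b.2
      -- The coordinates off y₀ are matched; the matching extends to a permutation, and all
      -- remaining coordinates equal y₀ on both sides.
      let e : {b // z b ≠ y₀} ≃ {b // x (J b) ≠ y₀} := Equiv.ofBijective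
        (fun b => ⟨c b, h3 b⟩) ⟨fun b b' hb => by
          have := congrArg (fun t => J t.1) hb
          simp only [hc] at this
          exact Subtype.ext (I.injective this), fun t => by
          have ht : J t ∈ S := by
            simp only [S, Finset.mem_filter, Finset.mem_univ, true_and]
            exact t.2
          rw [hSI, Finset.mem_map] at ht
          obtain ⟨b, hb, hbt⟩ := ht
          refine ⟨⟨b, (Finset.mem_filter.1 hb).2⟩, Subtype.ext (J.injective ?_)⟩
          rw [← hbt]
          exact hc _⟩
      rw [← ha e.extendSubtype (fun i => x (J i))]
      congr 1
      funext b
      by_cases hb : z b = y₀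
      · have := e.extendSubtype_not_mem b (by simpa using hb)
        simp only [ne_eq, not_not] at this
        rw [this, hb]
      · rw [e.extendSubtype_apply_of_mem b hb]
        change x (J (c ⟨b, hb⟩)) = z b
        rw [hc, hxI]
    · rw [ih _ ?_ (fun i => x (J i)) rfl, zero_mul]
      rw [← hS, ← Finset.card_map J]
      push Not at hJ
      obtain ⟨i, hi, hiJ⟩ := hJ
      refine Finset.card_lt_card (Finset.ssubset_iff_of_subset ?_ |>.2 ⟨i, hi, ?_⟩)
      · intro t ht
        obtain ⟨b, hb, rfl⟩ := Finset.mem_map.1 ht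
        simpa [S] using hb
      · intro ht
        obtain ⟨b, hb, hbi⟩ := Finset.mem_map.1 ht
        exact hiJ b hbi
  have h1 := h0 x
  simp only [hterm] at h1
  rw [← Finset.sum_filter, Finset.sum_const, nsmul_eq_mul] at h1
  -- I itself covers S, so the number of contributing labellings is nonzero.
  have h2 : I ∈ Finset.univ.filter fun J : Fin k ↪ Fin N => ∀ i ∈ S, ∃ b, J b = i := by
    simp only [Finset.mem_filter, Finset.mem_univ, true_and]
    intro i hi
    rw [hSI, Finset.mem_map] at hi
    obtain ⟨b, -, hb⟩ := hi
    exact ⟨b, hb⟩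
  have h3 := Finset.card_ne_zero_of_mem h2
  rcases mul_eq_zero.1 h1 with h4 | h4
  · exact absurd (Nat.cast_eq_zero.1 h4) h3
  · exact (mul_eq_zero.1 h4).resolve_right (pow_ne_zero _ hy₀)

theorem exists_tensor (h : Fin k → 𝓢(EuclideanSpace ℝ (Fin d), ℂ)) :
    ∃ F : Sch d k, ∀ x, F x = ∏ i, h i (x i) := by
  induction k with
  | zero =>
    obtain ⟨F, hF, -⟩ := exists_bump (0 : Cfg d 0) one_pos
    exact ⟨F, fun x => by simpa [Subsingleton.elim x 0] using hF⟩
  | succ k ih =>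
    obtain ⟨F, hF⟩ := ih fun i => h i.succ
    refine ⟨SchwartzMap.compCLMOfContinuousLinearEquiv ℂ
      (Fin.consEquivL ℝ fun _ : Fin (k + 1) => EuclideanSpace ℝ (Fin d)).symm
      (tensorRight F (h 0)), fun x => ?_⟩
    rw [SchwartzMap.compCLMOfContinuousLinearEquiv_apply, Function.comp_apply, tensorRight_apply, hF,
      Fin.prod_univ_succ]
    rfl

/-- The tensor product of one-particle functions. -/
def tensorS (h : Fin k → 𝓢(EuclideanSpace ℝ (Fin d), ℂ)) : Sch d k := (exists_tensor h).choose

@[simp] theorem tensorS_apply (h : Fin k → 𝓢(EuclideanSpace ℝ (Fin d), ℂ)) (x : Cfg d k) :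
    tensorS h x = ∏ i, h i (x i) := (exists_tensor h).choose_spec x

/-- The tensor power `h ⊗ … ⊗ h`. -/
def tensorPow (k : ℕ) (h : 𝓢(EuclideanSpace ℝ (Fin d), ℂ)) : BSch d k :=
  ⟨tensorS fun _ => h, fun π x => by
    rw [tensorS_apply, tensorS_apply]
    exact Equiv.prod_comp π fun i => h (x i)⟩

theorem tensorPow_apply (h : 𝓢(EuclideanSpace ℝ (Fin d), ℂ)) (x : Cfg d k) :
    (tensorPow k h : Sch d k) x = ∏ i, h (x i) := tensorS_apply _ x

theorem slice_tensorPow (h : 𝓢(EuclideanSpace ℝ (Fin d), ℂ)) (x : Cfg d N) (J : Fin k ↪ Fin N) :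
    slice (tensorPow N h) x J = (∏ i : Rest J, h (x i)) • tensorPow k h := by
  refine Subtype.ext ?_
  ext y
  rw [slice_coe, sliceE_apply, tensorPow_apply, prod_split J, mul_comm]
  change _ = (∏ i : Rest J, h (x i)) * (tensorPow k h : Sch d k) y
  rw [tensorPow_apply]
  congr 1
  · refine Finset.prod_congr rfl fun i _ => ?_
    rw [Function.extend_apply' _ _ _ fun ⟨b, hb⟩ => i.2 b hb]
  · simp only [J.injective.extend_apply]

/-- Slices of a tensor power are multiples of the smaller tensor power by the values of h at the
outer particles, so `eq_zero_of_sum_embedding` applies. For h = 0 the tensor power vanishes only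
because k ≥ 1. -/
theorem apply_tensorPow_eq_zero (hk1 : 1 ≤ k) (hk : k ≤ N) {A : Obs d k} (hA : eps k N A = 0)
    (h : 𝓢(EuclideanSpace ℝ (Fin d), ℂ)) : A.1 (tensorPow k h) = 0 := by
  by_cases hh : ∃ y, h y ≠ 0
  · obtain ⟨y₀, hy₀⟩ := hh
    refine Subtype.ext (DFunLike.ext _ _ fun z => ?_)
    refine eq_zero_of_sum_embedding hk (a := fun z => (A.1 (tensorPow k h) : Sch d k) z)
      (fun π x => (A.1 (tensorPow k h)).2 π x) hy₀ (fun x => ?_) z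
    have h1 : (symAct (Fin.castLEEmb hk) (liftB A.1) (tensorPow N h) : Sch d N) x = 0 := by
      rw [← eps_val hk, hA]
      rfl
    rw [symAct_liftB_coe hk, mul_eq_zero] at h1
    have h2 := h1.resolve_left (inv_ne_zero (Nat.cast_ne_zero.2 (Nat.descFactorial_pos.2 hk).ne'))
    rw [← h2]
    refine Finset.sum_congr rfl fun J _ => ?_
    rw [slice_tensorPow, map_smul, mul_comm]
    rfl
  · push Not at hh
    have h1 : tensorPow k h = 0 := by
      refine Subtype.ext (DFunLike.ext _ _ fun z => ?_)
      rw [tensorPow_apply]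
      exact Finset.prod_eq_zero (Finset.mem_univ ⟨0, hk1⟩) (hh _)
    rw [h1, map_zero]

/-- Polarization: by Ryser's formula a signed sum of tensor powers of partial sums is the sum of the
permuted tensor products, and all k! of these have the same integral against a symmetric f. -/
theorem integral_tensorS_eq_zero {f : BSch d k}
    (hf : ∀ h : 𝓢(EuclideanSpace ℝ (Fin d), ℂ), ∫ x, (tensorPow k h : Sch d k) x * (f : Sch d k) x = 0)
    (h : Fin k → 𝓢(EuclideanSpace ℝ (Fin d), ℂ)) : ∫ x, tensorS h x * (f : Sch d k) x = 0 := by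
  have h1 : ∀ x : Cfg d k, ∑ T : Finset (Fin k), (-1) ^ T.card *
      ((tensorPow k (∑ i ∈ Tᶜ, h i) : Sch d k) x * (f : Sch d k) x) =
      ∑ σ : Equiv.Perm (Fin k), tensorS (fun j => h (σ j)) x * (f : Sch d k) x := by
    intro x
    have := sum_neg_one_pow_mul_prod_sum fun i j => h i (x j)
    simp only [← mul_assoc, ← Finset.sum_mul, tensorPow_apply, tensorS_apply, sum_apply]
    rw [this]
  have hint : ∀ F : Sch d k, MeasureTheory.Integrable fun x => F x * (f : Sch d k) x := fun F =>
    (mulS F (f : Sch d k)).integrable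
  have h2 := congrArg (fun u : Cfg d k → ℂ => ∫ x, u x) (funext h1)
  rw [MeasureTheory.integral_finsetSum _ fun T _ => (hint _).const_mul _,
    MeasureTheory.integral_finsetSum _ fun σ _ => hint _] at h2
  simp only [MeasureTheory.integral_const_mul, hf, mul_zero, Finset.sum_const_zero] at h2
  have h3 : ∀ σ : Equiv.Perm (Fin k), ∫ x, tensorS (fun j => h (σ j)) x * (f : Sch d k) x =
      ∫ x, tensorS h x * (f : Sch d k) x := by
    intro σ
    rw [← integral_comp_perm σ]
    congr 1
    funext x
    rw [f.2 σ x, tensorS_apply, tensorS_apply]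
    congr 1
    exact Equiv.prod_comp σ fun i => h i (x i)
  simp only [h3, Finset.sum_const, nsmul_eq_mul] at h2
  refine (mul_eq_zero.1 h2.symm).resolve_left (Nat.cast_ne_zero.2 ?_)
  simp [Nat.factorial_ne_zero, Fintype.card_perm]

/-- If f(x₀) ≠ 0, a product of squared moduli of one-particle bumps at x₀ is concentrated where Re(f
/ f(x₀)) > 0. Their product is continuous and nonnegative, equals 1 at x₀, and yet has zero
integral. -/
theorem eq_zero_of_integral_tensorS {f : Sch d k}
    (hf : ∀ h, ∫ x, tensorS h x * f x = 0) : f = 0 := by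
  ext x₀
  by_contra hne
  let c : ℂ := (f x₀)⁻¹
  have hc : (c * f x₀).re = 1 := by
    rw [inv_mul_cancel₀ hne, Complex.one_re]
  have hcont : Continuous fun x => (c * f x).re := by fun_prop
  obtain ⟨r, hr, hball⟩ := Metric.continuous_iff.1 hcont x₀ 1 one_pos
  have hpos : ∀ x, dist x x₀ < r → 0 < (c * f x).re := by
    intro x hx
    have := hball x hx
    rw [hc, Real.dist_eq, abs_lt] at this
    linarith [this.1]
  choose b hb1 hb2 using fun i : Fin k => exists_bump (x₀ i) hr
  let h : Fin k → 𝓢(EuclideanSpace ℝ (Fin d), ℂ) := fun i => mulS (conjS (b i)) (b i)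
  have hF : ∀ x, tensorS h x = ((∏ i, ‖b i (x i)‖ ^ 2 : ℝ) : ℂ) := by
    intro x
    rw [tensorS_apply]
    push_cast
    refine Finset.prod_congr rfl fun i _ => ?_
    rw [mulS_apply, conjS_apply, Complex.conj_mul']
  let G : Cfg d k → ℝ := fun x => (∏ i, ‖b i (x i)‖ ^ 2) * (c * f x).re
  have hG : ∀ x, G x = (c * (tensorS h x * f x)).re := by
    intro x
    rw [hF, mul_left_comm, Complex.re_ofReal_mul]
  have hG0 : ∀ x, 0 ≤ G x := by
    intro x
    by_cases hx : dist x x₀ < r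
    · exact mul_nonneg (Finset.prod_nonneg fun _ _ => by positivity) (hpos x hx).le
    · have : ∃ i, r ≤ dist (x i) (x₀ i) := by
        by_contra hcon
        push Not at hcon
        exact hx ((dist_pi_lt_iff hr).2 hcon)
      obtain ⟨i, hi⟩ := this
      have h0 : ∏ i, ‖b i (x i)‖ ^ 2 = 0 :=
        Finset.prod_eq_zero (Finset.mem_univ i) (by rw [hb2 i _ hi]; simp)
      simp only [G, h0, zero_mul, le_refl]
  have hint : MeasureTheory.Integrable fun x => c * (tensorS h x * f x) :=
    (mulS (tensorS h) f).integrable.const_mul c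
  have hGint : MeasureTheory.Integrable G := by
    refine hint.re.congr (Filter.Eventually.of_forall fun x => ?_)
    exact (hG x).symm
  have hGI : ∫ x, G x = 0 := by
    have h1 : ∫ x, G x = (∫ x, c * (tensorS h x * f x)).re := by
      simp only [hG]
      exact integral_re hint
    rw [h1, MeasureTheory.integral_const_mul, hf, mul_zero, Complex.zero_re]
  have hGc : Continuous G := by
    simp only [G]
    fun_prop
  have h1 := (MeasureTheory.integral_eq_zero_iff_of_nonneg hG0 hGint).1 hGI
  have h2 := congrFun ((hGc.ae_eq_iff_eq MeasureTheory.volume continuous_zero).1 h1) x₀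
  have h3 : G x₀ = 1 := by
    simp only [G, hc, hb1]
    simp
  rw [h3] at h2
  exact one_ne_zero h2

/-- A vanishes on tensor powers, so by skew-adjointness A f is orthogonal to all of them for every
f, hence to all tensor products, hence zero. Density of tensor powers in the Schwartz topology is
not needed. -/
theorem eq_zero_of_eps_eq_zero (hk1 : 1 ≤ k) (hk : k ≤ N) {A : Obs d k} (hA : eps k N A = 0) :
    A = 0 := by
  refine Subtype.ext (ContinuousLinearMap.ext fun f => ?_)
  have h1 : ∀ h : 𝓢(EuclideanSpace ℝ (Fin d), ℂ), l2inner (tensorPow k h : Sch d k) (A.1 f) = 0 := by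
    intro h
    have h2 := A.2 (tensorPow k h) f
    rw [apply_tensorPow_eq_zero hk1 hk hA] at h2
    have h3 : l2inner ((0 : BSch d k) : Sch d k) f = 0 := by simp [l2inner]
    rw [h3] at h2
    exact neg_eq_zero.1 h2.symm
  refine Subtype.ext (eq_zero_of_integral_tensorS fun h => integral_tensorS_eq_zero
    (f := A.1 f) (fun h => ?_) h)
  rw [← h1 (conjS h), l2inner]
  congr 1
  funext x
  simp [tensorPow_apply]

theorem eps_sub (hk : k ≤ N) (A B : Obs d k) : eps k N (A - B) = eps k N A - eps k N B := by
  have J := Fin.castLEEmb hk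
  have h1 := eps_val hk J (A - B)
  have h2 : liftB (A - B).1 = liftB A.1 - liftB B.1 := by
    ext1 f
    simp [liftB]
  refine Subtype.ext ?_
  rw [h1, h2, symAct_sub]
  change _ = (eps k N A).1 - (eps k N B).1
  rw [eps_val hk J, eps_val hk J]

theorem eps_injective (hk1 : 1 ≤ k) (hk : k ≤ N) : Function.Injective (eps (d := d) k N) := by
  intro A B h
  rw [← sub_eq_zero]
  exact eq_zero_of_eps_eq_zero hk1 hk ((eps_sub hk A B).trans (sub_eq_zero.2 h))

theorem epsInv_eps (hk1 : 1 ≤ k) (hk : k ≤ N) (A : Obs d k) : epsInv k N (eps k N A) = A :=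
  Function.leftInverse_invFun (eps_injective hk1 hk) A

theorem eps_zero (hk : k ≤ N) : eps (d := d) k N 0 = 0 := by
  have h0 : (0 : Obs d k) - 0 = 0 := Subtype.ext (sub_self _)
  have := eps_sub hk (0 : Obs d k) 0
  rw [h0] at this
  exact this.trans (Subtype.ext (sub_self _))

theorem epsInv_zero (hk1 : 1 ≤ k) (hk : k ≤ N) : epsInv (d := d) k N 0 = 0 := by
  rw [← eps_zero hk, epsInv_eps hk1 hk]

end Injectivity

/-! ### Real symmetric operators and the skew-adjoint observables they generate -/

section RealSymmetric

variable {d k N : ℕ}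

/-- Operators on `𝓢` that are real, symmetric, and cyclic with respect to the trace. -/
structure RealSymm (B : Sch d k →L[ℂ] Sch d k) : Prop where
  real : SmoothOp.IsRealOp B
  adj : ∀ f g, l2inner (B f) g = l2inner f (B g)
  cyclic : ∀ T : SmoothOp d k,
    SmoothOp.trace (B ∘L T) = SmoothOp.trace (T ∘L ContinuousLinearMap.precomp ℂ B)

theorem conjS_add {E : Type*} [NormedAddCommGroup E] [NormedSpace ℝ E] (f g : 𝓢(E, ℂ)) :
    conjS (f + g) = conjS f + conjS g := by
  ext x
  simp

theorem l2inner_zero_left (g : Sch d k) : l2inner 0 g = 0 := by simp [l2inner]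

theorem l2inner_zero_right (f : Sch d k) : l2inner f 0 = 0 := by simp [l2inner]

theorem RealSymm.zero : RealSymm (0 : Sch d k →L[ℂ] Sch d k) where
  real f := by
    ext x
    simp
  adj f g := by rw [zero_apply, zero_apply, l2inner_zero_left, l2inner_zero_right]
  cyclic T := by
    congr 1
    ext u
    simp

theorem RealSymm.add {B C : Sch d k →L[ℂ] Sch d k} (hB : RealSymm B) (hC : RealSymm C) :
    RealSymm (B + C) where
  real f := by rw [add_apply, conjS_add, hB.real, hC.real, add_apply]
  adj f g := by rw [add_apply, add_apply, l2inner_add_left, l2inner_add_right, hB.adj, hC.adj]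
  cyclic T := by
    have h : T ∘L ContinuousLinearMap.precomp ℂ (B + C) =
        T ∘L ContinuousLinearMap.precomp ℂ B + T ∘L ContinuousLinearMap.precomp ℂ C := by
      ext1 u
      have h' : ContinuousLinearMap.precomp ℂ (B + C) u =
          ContinuousLinearMap.precomp ℂ B u + ContinuousLinearMap.precomp ℂ C u := by
        ext f
        exact map_add u (B f) (C f)
      simp only [ContinuousLinearMap.comp_apply, add_apply, h', map_add]
    rw [h, ContinuousLinearMap.add_comp, ← SmoothOp.traceCLM_apply, ← SmoothOp.traceCLM_apply,
      map_add, map_add]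
    simp only [SmoothOp.traceCLM_apply, hB.cyclic, hC.cyclic]

theorem RealSymm.smul {B : Sch d k →L[ℂ] Sch d k} (c : ℝ) (hB : RealSymm B) :
    RealSymm ((c : ℂ) • B) where
  real f := by
    rw [smul_apply, smul_apply, ← hB.real]
    ext x
    simp
  adj f g := by
    rw [smul_apply, smul_apply, l2inner_csmul_left, l2inner_csmul_right, hB.adj,
      Complex.conj_ofReal]
  cyclic T := by
    have h : T ∘L ContinuousLinearMap.precomp ℂ ((c : ℂ) • B) =
        (c : ℂ) • (T ∘L ContinuousLinearMap.precomp ℂ B) := by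
      ext1 u
      have h' : ContinuousLinearMap.precomp ℂ ((c : ℂ) • B) u =
          (c : ℂ) • ContinuousLinearMap.precomp ℂ B u := by
        ext f
        exact map_smul u (c : ℂ) (B f)
      simp only [ContinuousLinearMap.comp_apply, smul_apply, h', map_smul]
    rw [h, ContinuousLinearMap.smul_comp, ← SmoothOp.traceCLM_apply, ← SmoothOp.traceCLM_apply,
      map_smul, map_smul]
    simp only [SmoothOp.traceCLM_apply, hB.cyclic]

theorem RealSymm.neg {B : Sch d k →L[ℂ] Sch d k} (hB : RealSymm B) : RealSymm (-B) := by
  have := hB.smul (-1)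
  simpa using this

theorem RealSymm.sum {α : Type*} {s : Finset α} {B : α → Sch d k →L[ℂ] Sch d k}
    (hB : ∀ a ∈ s, RealSymm (B a)) : RealSymm (∑ a ∈ s, B a) :=
  Finset.sum_induction _ _ (fun _ _ => RealSymm.add) RealSymm.zero hB

variable {U : EuclideanSpace ℝ (Fin d) → ℝ}

theorem realSymm_pairMul (hU : U.HasTemperateGrowth) (i j : Fin k) : RealSymm (pairMul U i j) where
  real f := by
    ext x
    simp only [conjS_apply, pairMul_apply hU, map_mul, Complex.conj_ofReal]
  adj f g := by
    rw [l2inner, l2inner]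
    congr 1
    funext x
    rw [pairMul_apply hU, pairMul_apply hU, map_mul, Complex.conj_ofReal]
    ring
  cyclic := SmoothOp.trace_mul_comp (SmoothOp.hasTemperateGrowth_pair hU i j)

theorem realSymm_pairTotal (hU : U.HasTemperateGrowth) : RealSymm (pairTotal U k) :=
  RealSymm.sum fun i _ => RealSymm.sum fun j _ => by
    split_ifs
    · exact RealSymm.zero
    · exact realSymm_pairMul hU i j

/-- The sum of the interactions of the last particle with the other ones. -/
def pairLast (U : EuclideanSpace ℝ (Fin d) → ℝ) (k : ℕ) : Sch d (k + 1) →L[ℂ] Sch d (k + 1) :=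
  ∑ a : Fin k, pairMul U a.castSucc (Fin.last k)

theorem realSymm_pairLast (hU : U.HasTemperateGrowth) : RealSymm (pairLast U k) :=
  RealSymm.sum fun _ _ => realSymm_pairMul hU _ _

theorem conjS_dirDeriv {E : Type*} [NormedAddCommGroup E] [NormedSpace ℝ E]
    [FiniteDimensional ℝ E] (v : E) (f : 𝓢(E, ℂ)) :
    conjS (dirDeriv v f) = dirDeriv v (conjS f) := by
  ext x
  exact (hasDerivAt_line_zero f x v).star.unique (hasDerivAt_line_zero (conjS f) x v)

theorem l2inner_dirDeriv (v : Cfg d k) (f g : Sch d k) :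
    l2inner (dirDeriv v f) g = -l2inner f (dirDeriv v g) := by
  have h1 : dirDeriv v (mulS (conjS f) g) =
      mulS (conjS (dirDeriv v f)) g + mulS (conjS f) (dirDeriv v g) := by
    ext x
    refine (hasDerivAt_line_zero (mulS (conjS f) g) x v).unique ?_
    have := (hasDerivAt_line_zero (conjS f) x v).mul (hasDerivAt_line_zero g x v)
    simp only [zero_smul, add_zero] at this
    rw [conjS_dirDeriv]
    exact this
  have h2 := integral_dirDeriv_eq_zero (mulS (conjS f) g) v
  rw [h1] at h2
  simp only [add_apply] at h2
  rw [MeasureTheory.integral_add (mulS (conjS (dirDeriv v f)) g).integrable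
    (mulS (conjS f) (dirDeriv v g)).integrable] at h2
  exact eq_neg_of_add_eq_zero_left h2

theorem realSymm_totalLaplacian : RealSymm (totalLaplacian d k) where
  real f := by
    simp only [totalLaplacian_apply, laplacianAt_apply]
    have hs : ∀ {n : ℕ} (F : Fin n → Sch d k), conjS (∑ j, F j) = ∑ j, conjS (F j) := by
      intro n F
      ext x
      simp [sum_apply]
    simp only [hs, conjS_dirDeriv]
  adj f g := by
    simp only [totalLaplacian_apply, laplacianAt_apply, l2inner_sum_left, l2inner_sum_right,
      l2inner_dirDeriv, neg_neg]
  cyclic := SmoothOp.trace_laplacian_comp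

/-- The operators of the BBGKY Hamiltonian. -/
theorem realSymm_bbgkyW (hU : U.HasTemperateGrowth) (κ : ℝ) : ∀ k, RealSymm (bbgkyW U κ k)
  | 0 => RealSymm.zero
  | 1 => realSymm_totalLaplacian.neg
  | 2 => (realSymm_pairMul hU 0 1).smul κ
  | _ + 3 => RealSymm.zero

/-! ### Skew-adjoint operators from commutators -/

theorem RealSymm.isSkew {B : Sch d k →L[ℂ] Sch d k} (hB : RealSymm B) (c : ℝ) :
    IsSkew ((Complex.I * c) • B) := by
  intro f g
  rw [smul_apply, smul_apply, l2inner_csmul_left, l2inner_csmul_right, hB.adj, map_mul,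
    Complex.conj_I, Complex.conj_ofReal]
  ring

theorem l2inner_sub_left (f f' g : Sch d k) :
    l2inner (f - f') g = l2inner f g - l2inner f' g := by
  rw [sub_eq_add_neg, ← neg_one_smul ℂ, l2inner_add_left, l2inner_csmul_left]
  simp [sub_eq_add_neg]

theorem l2inner_sub_right (f g g' : Sch d k) :
    l2inner f (g - g') = l2inner f g - l2inner f g' := by
  rw [sub_eq_add_neg, ← neg_one_smul ℂ, l2inner_add_right, l2inner_csmul_right]
  ring

theorem IsSkew.opComm {D B : Sch d k →L[ℂ] Sch d k} (hD : IsSkew D) (hB : RealSymm B) (c : ℝ) :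
    IsSkew ((Complex.I * c) • opComm D B) := by
  intro f g
  rw [smul_apply, smul_apply, l2inner_csmul_left, l2inner_csmul_right, opComm_apply, opComm_apply,
    l2inner_sub_left, l2inner_sub_right, hD, hB.adj, hB.adj, hD, map_mul, Complex.conj_I,
    Complex.conj_ofReal]
  ring

theorem IsSkew.add {D B : Sch d k →L[ℂ] Sch d k} (hD : IsSkew D) (hB : IsSkew B) :
    IsSkew (D + B) := by
  intro f g
  rw [add_apply, add_apply, l2inner_add_left, l2inner_add_right, hD, hB, neg_add]

theorem nextOp_eq (M : Sch d k →L[ℂ] Sch d k) : nextOp U N M =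
    act Fin.castSuccEmb (opComm M (pairTotal U k)) +
      (2 * ((N : ℂ) - k)) • opComm (act Fin.castSuccEmb M) (pairLast U k) := by
  rw [nextOp, pairLast, opComm_sum]

/-- The commutator of a skew-adjoint with a symmetric operator is symmetric, so an imaginary factor
makes it skew-adjoint; `nextOp` is a real combination of such commutators and actions of them. -/
theorem isSkew_nextOp (hU : U.HasTemperateGrowth) {D : Sch d k →L[ℂ] Sch d k} (hD : IsSkew D)
    (c : ℝ) : IsSkew ((Complex.I * c) • nextOp U N D) := by
  have h1 := isSkew_act Fin.castSuccEmb (hD.opComm (realSymm_pairTotal hU) c)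
  have h2 := (isSkew_act Fin.castSuccEmb hD).opComm (realSymm_pairLast hU) (c * (2 * ((N : ℝ) - k)))
  have h3 := h1.add h2
  rw [act_smul] at h3
  have h4 : Complex.I * c * (2 * ((N : ℂ) - k)) =
      Complex.I * ((c * (2 * ((N : ℝ) - k)) : ℝ) : ℂ) := by
    push_cast
    ring
  rw [nextOp_eq, smul_add, smul_smul, h4]
  exact h3

/-- The observable of a skew-adjoint operator on `𝓢`. -/
def obsOf (M : Sch d k →L[ℂ] Sch d k) (hM : IsSkew M) : Obs d k :=
  ⟨bos M, symAct_refl M ▸ isSkew_symAct (Function.Embedding.refl (Fin k)) hM⟩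

theorem eps_obsOf (hk : k ≤ N) (J : Fin k ↪ Fin N) {M : Sch d k →L[ℂ] Sch d k} (hM : IsSkew M) :
    (eps k N (obsOf M hM)).1 = symAct J M :=
  eps_val_of_symAct hk (Function.Embedding.refl (Fin k)) J _ (symAct_refl M).symm

/-- By injectivity of ε it suffices to exhibit one preimage. -/
theorem epsInv_eq_obsOf (hk1 : 1 ≤ k) (hk : k ≤ N) (J : Fin k ↪ Fin N) {B : Obs d N}
    {M : Sch d k →L[ℂ] Sch d k} (hM : IsSkew M) (hB : B.1 = symAct J M) :
    epsInv k N B = obsOf M hM := by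
  rw [← epsInv_eps hk1 hk (obsOf M hM)]
  congr 1
  exact Subtype.ext (hB.trans (eps_obsOf hk J hM).symm)

end RealSymmetric

/-! ### Traces of commutators; symmetry of partial traces -/

section ReducedOperators

namespace SmoothOp

variable {d k N : ℕ} {U : EuclideanSpace ℝ (Fin d) → ℝ}

theorem trace_sub (T S : SmoothOp d k) : trace (T - S) = trace T - trace S := by
  simp only [← traceCLM_apply]
  exact (traceCLM d k).map_sub T S

theorem trace_add (T S : SmoothOp d k) : trace (T + S) = trace T + trace S := by
  simp only [← traceCLM_apply]
  exact (traceCLM d k).map_add T S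

theorem trace_smul (c : ℂ) (T : SmoothOp d k) : trace (c • T) = c * trace T := by
  simp only [← traceCLM_apply]
  exact (traceCLM d k).map_smul c T

/-- Cyclicity carries the leftmost B to the right of S, where it forms the second half of the
commutator with S. -/
theorem trace_opComm_comp {B : Sch d k →L[ℂ] Sch d k} (hB : RealSymm B)
    (D : Sch d k →L[ℂ] Sch d k) (S : SmoothOp d k) :
    trace (opComm D B ∘L S) = trace (D ∘L commutator B S) := by
  have h1 : opComm D B ∘L S = D ∘L (B ∘L S) - B ∘L (D ∘L S) := rfl
  have h2 : D ∘L commutator B S =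
      D ∘L (B ∘L S) - (D ∘L S) ∘L ContinuousLinearMap.precomp ℂ B := by
    ext1 u
    simp [commutator]
  rw [h1, h2, trace_sub, trace_sub, hB.cyclic]

theorem snoc_perm (π : Equiv.Perm (Fin k)) (x : Cfg d k) (y : EuclideanSpace ℝ (Fin d)) :
    (Fin.snoc (α := fun _ => EuclideanSpace ℝ (Fin d)) (fun i => x (π i)) y : Cfg d (k + 1)) =
      fun i => (Fin.snoc (α := fun _ => EuclideanSpace ℝ (Fin d)) x y : Cfg d (k + 1))
        (π.viaEmbedding Fin.castSuccEmb i) := by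
  funext i
  refine Fin.lastCases ?_ (fun i => ?_) i
  · rw [Equiv.Perm.viaEmbedding_apply_of_notMem]
    · simp
    · rintro ⟨a, ha⟩
      exact (Fin.castSucc_lt_last a).ne ha
  · have := Equiv.Perm.viaEmbedding_apply π Fin.castSuccEmb i
    rw [Fin.coe_castSuccEmb] at this
    rw [this]
    simp

theorem IsSymm.partialTrace {T : SmoothOp d (k + 1)} (hT : T.IsSymm) :
    (partialTraceCLM d k T).IsSymm := by
  refine isSymm_of_kernel (fun π x x' => ?_) (fun π x x' => ?_)
  · simp only [kernel_partialTraceCLM, snoc_perm, hT.kernel_left]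
  · simp only [kernel_partialTraceCLM, snoc_perm, hT.kernel_right]

theorem IsHerm.partialTrace {T : SmoothOp d (k + 1)} (hT : T.IsHerm) :
    (partialTraceCLM d k T).IsHerm := by
  intro x x'
  rw [kernel_partialTraceCLM, kernel_partialTraceCLM, ← integral_conj]
  congr 1
  funext y
  exact hT _ _

theorem pairLast_apply (hU : U.HasTemperateGrowth) (f : Sch d (k + 1)) (x : Cfg d (k + 1)) :
    pairLast U k f x = (∑ a : Fin k, (U (x a.castSucc - x (Fin.last k)) : ℂ)) * f x := by
  rw [pairLast, sum_apply, sum_apply, Finset.sum_mul]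
  exact Finset.sum_congr rfl fun a _ => pairMul_apply hU _ _ f x

theorem kernel_commutator_pairLast (hU : U.HasTemperateGrowth) (T : SmoothOp d (k + 1))
    (x x' : Cfg d (k + 1)) : (commutator (pairLast U k) T).kernel x x' =
      (∑ a : Fin k, (U (x a.castSucc - x (Fin.last k)) : ℂ) -
        ∑ a : Fin k, (U (x' a.castSucc - x' (Fin.last k)) : ℂ)) * T.kernel x x' := by
  have h : ContinuousLinearMap.precomp ℂ (pairLast U k) (dirac x') =
      (∑ a : Fin k, (U (x' a.castSucc - x' (Fin.last k)) : ℂ)) • dirac x' := by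
    ext f
    exact pairLast_apply hU f x'
  rw [commutator, kernel_sub, sub_mul]
  congr 1
  · exact pairLast_apply hU _ _
  · change T (ContinuousLinearMap.precomp ℂ (pairLast U k) (dirac x')) x = _
    rw [h, map_smul]
    rfl

/-- The interaction with the last particle is invariant only under permutations of the first k, but
these are the ones that matter once the last variable is integrated out. -/
theorem IsSymm.coupling (hU : U.HasTemperateGrowth) {T : SmoothOp d (k + 1)} (hT : T.IsSymm) :
    (partialTraceCLM d k (SmoothOp.commutator (pairLast U k) T)).IsSymm := by
  have hsum : ∀ (π : Equiv.Perm (Fin k)) (x : Cfg d k) (y : EuclideanSpace ℝ (Fin d)),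
      ∑ a : Fin k, (U (x (π a) - y) : ℂ) = ∑ a : Fin k, (U (x a - y) : ℂ) :=
    fun π x y => Equiv.sum_comp π fun a => (U (x a - y) : ℂ)
  have hl : ∀ (π : Equiv.Perm (Fin k)) (x : Cfg d k) y z,
      T.kernel (Fin.snoc (α := fun _ => EuclideanSpace ℝ (Fin d)) (fun i => x (π i)) y) z =
        T.kernel (Fin.snoc (α := fun _ => EuclideanSpace ℝ (Fin d)) x y) z := fun π x y z => by
    rw [snoc_perm, hT.kernel_left]
  have hr : ∀ (π : Equiv.Perm (Fin k)) (x : Cfg d k) y z,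
      T.kernel z (Fin.snoc (α := fun _ => EuclideanSpace ℝ (Fin d)) (fun i => x (π i)) y) =
        T.kernel z (Fin.snoc (α := fun _ => EuclideanSpace ℝ (Fin d)) x y) := fun π x y z => by
    rw [snoc_perm, hT.kernel_right]
  refine isSymm_of_kernel (fun π x x' => ?_) (fun π x x' => ?_)
  · simp only [kernel_partialTraceCLM, kernel_commutator_pairLast hU, Fin.snoc_castSucc,
      Fin.snoc_last, hsum, hl]
  · simp only [kernel_partialTraceCLM, kernel_commutator_pairLast hU, Fin.snoc_castSucc,
      Fin.snoc_last, hsum, hr]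

theorem IsHerm.smul_commutator {T : SmoothOp d k} (hT : T.IsHerm) {B : Sch d k →L[ℂ] Sch d k}
    (hB : IsRealOp B) (c : ℝ) : ((Complex.I * c) • SmoothOp.commutator B T).IsHerm := by
  intro x x'
  rw [kernel_smul, kernel_smul, map_mul, hT.commutator hB, map_mul, Complex.conj_I,
    Complex.conj_ofReal]
  ring

end SmoothOp

end ReducedOperators

/-! ### The trace pairing of observables and density matrices -/

section Pairing

variable {d k N : ℕ}

/-- The pairing `Tr(A γ)` of an observable and a density matrix. -/
def obsPairing (d k : ℕ) : Obs d k →ₗ[ℝ] DM d k →ₗ[ℝ] ℂ :=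
  LinearMap.mk₂ ℝ (fun A γ => SmoothOp.trace (BSmoothOp.toOp (A.1 ∘L γ.1)))
    (fun A B γ => by
      rw [← SmoothOp.trace_add]
      rfl)
    (fun c A γ => by
      rw [Complex.real_smul, ← SmoothOp.trace_smul]
      rfl)
    (fun A γ δ => by
      rw [← SmoothOp.trace_add]
      congr 1
      ext1 u
      exact congrArg Subtype.val (map_add A.1 _ _))
    (fun c A γ => by
      rw [Complex.real_smul, ← SmoothOp.trace_smul]
      congr 1
      ext1 u
      exact congrArg Subtype.val (map_smul A.1 (c : ℂ) _))

theorem obsPairing_apply (A : Obs d k) (γ : DM d k) :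
    obsPairing d k A γ = SmoothOp.trace (BSmoothOp.toOp (A.1 ∘L γ.1)) := rfl

theorem trPairing_eq (A : ObsHier d N) (Γ : DMHier d N) :
    trPairing A Γ = ∑ k : Idx N, obsPairing d k (A k) (Γ k) := rfl

theorem obsPairing_obsOf {M : Sch d k →L[ℂ] Sch d k} (hM : IsSkew M) (γ : DM d k) :
    obsPairing d k (obsOf M hM) γ = SmoothOp.trace (M ∘L BSmoothOp.toOp γ.1) :=
  SmoothOp.trace_toOp_symAct M γ.1

theorem obsPairing_ofOp (A : Obs d k) {T : SmoothOp d k} (hT : T.IsSymm) (hH : T.IsHerm) :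
    obsPairing d k A ⟨SmoothOp.ofOp T, hH.ofOp_mem⟩ = SmoothOp.trace (liftB A.1 ∘L T) := by
  rw [obsPairing_apply, SmoothOp.toOp_comp, SmoothOp.toOp_ofOp hT]

theorem op_coe (Γ : DMHier d N) (k : Idx N) : Γ.op k = BSmoothOp.toOp (Γ k).1 := dif_pos k.2

end Pairing

/-! ### The bracket with the gradient of the Hamiltonian -/

section Bracket

variable {d k N : ℕ} {U : EuclideanSpace ℝ (Fin d) → ℝ}

/-- The factor N of the bracket on 𝔤_N is carried by the second entry, where it turns ε of a
Hamiltonian component into a full N-particle operator P. -/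
theorem obsBracket_val {A B : Obs d N} {P : BSch d N →L[ℂ] BSch d N} {c : ℂ}
    (h : (N : ℂ) • B.1 = c • P) : (obsBracket A B).1 = c • (A.1 ∘L P - P ∘L A.1) := by
  have h1 : (obsBracket A B).1 = (N : ℂ) • (A.1 ∘L B.1 - B.1 ∘L A.1) :=
    (Nat.cast_smul_eq_nsmul ℂ N (A.1 ∘L B.1 - B.1 ∘L A.1)).symm
  have h2 : ∀ f, (N : ℂ) • B.1 f = c • P f := fun f =>
    congrArg (fun T : BSch d N →L[ℂ] BSch d N => T f) h
  rw [h1]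
  ext1 f
  simp only [smul_apply, sub_apply, ContinuousLinearMap.comp_apply, smul_sub]
  rw [← map_smul A.1, h2, map_smul, h2]

/-- The gradient of the BBGKY Hamiltonian. -/
def obsW (hU : U.HasTemperateGrowth) (κ : ℝ) (k : ℕ) : Obs d k :=
  -- The factor is -i because a gradient is paired through i Tr.
  obsOf ((Complex.I * (-1 : ℝ)) • bbgkyW U κ k) ((realSymm_bbgkyW hU κ k).isSkew (-1))

theorem bracket_obsW_one (hU : U.HasTemperateGrowth) (κ : ℝ) (hk1 : 1 ≤ k) (hk : k ≤ N)
    (A : Obs d k) :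
    epsInv k N (obsBracket (eps k N A) (eps 1 N (obsW hU κ 1))) =
      obsOf ((Complex.I * (1 : ℝ)) • opComm (liftB A.1) (totalLaplacian d k))
        ((isSkew_liftB A).opComm realSymm_totalLaplacian 1) := by
  refine epsInv_eq_obsOf hk1 hk (Fin.castLEEmb hk) _ ?_
  have h1 : (N : ℂ) • (eps 1 N (obsW hU κ 1)).1 =
      (Complex.I * (1 : ℝ)) • bos (totalLaplacian d N) := by
    rw [obsW, eps_obsOf (hk1.trans hk) (Fin.castLEEmb (hk1.trans hk)),
      ← smul_symAct_laplacian (Fin.castLEEmb (hk1.trans hk))]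
    have h2 : (Complex.I * ((-1 : ℝ) : ℂ)) • bbgkyW U κ 1 =
        (Complex.I * ((1 : ℝ) : ℂ)) • totalLaplacian d 1 := by
      simp [bbgkyW]
    rw [h2, symAct_smul, smul_comm]
  rw [obsBracket_val h1, eps_val hk (Fin.castLEEmb hk), comm_symAct_totalLaplacian, symAct_smul]

/-- -iκ N divided by the N (N - 1) ordered pairs leaves -iκ / (N - 1). -/
theorem smul_eps_obsW_two (hU : U.HasTemperateGrowth) (κ : ℝ) (hN : 2 ≤ N) :
    (N : ℂ) • (eps 2 N (obsW hU κ 2)).1 =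
      (Complex.I * (-κ / ((N : ℝ) - 1) : ℝ)) • bos (pairTotal U N) := by
  have h0 : ((N : ℂ) - 1) ≠ 0 := by
    have : (1 : ℂ) ≠ N := by
      have h1 : 1 ≠ N := by omega
      exact_mod_cast h1
    exact sub_ne_zero.2 this.symm
  rw [obsW, eps_obsOf hN (Fin.castLEEmb hN), ← smul_symAct_pairMul hU (Fin.castLEEmb hN)]
  have h2 : (Complex.I * ((-1 : ℝ) : ℂ)) • bbgkyW U κ 2 =
      (Complex.I * ((-1 : ℝ) : ℂ) * κ) • pairMul U 0 1 := by
    rw [bbgkyW, smul_smul]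
  rw [h2, symAct_smul, smul_smul, smul_smul]
  congr 1
  push_cast
  field_simp

theorem bracket_obsW_two (hU : U.HasTemperateGrowth) (he : ∀ x, U (-x) = U x) (κ : ℝ)
    (hN : 2 ≤ N) (hk : k + 1 ≤ N) (A : Obs d k) :
    epsInv (k + 1) N (obsBracket (eps k N A) (eps 2 N (obsW hU κ 2))) =
      obsOf ((Complex.I * (-κ / ((N : ℝ) - 1) : ℝ)) • nextOp U N (liftB A.1))
        (isSkew_nextOp hU (isSkew_liftB A) _) := by
  refine epsInv_eq_obsOf (Nat.le_add_left 1 k) hk (Fin.castLEEmb hk) _ ?_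
  rw [obsBracket_val (smul_eps_obsW_two hU κ hN),
    eps_val (Nat.le_of_succ_le hk) (Fin.castSuccEmb.trans (Fin.castLEEmb hk)),
    comm_symAct_pairTotal_eq hU he, symAct_smul]

/-- At the top no further particle is available: min(N + 1, N) = N, and the commutator stays in N
variables. -/
theorem bracket_obsW_two_top (hU : U.HasTemperateGrowth) (κ : ℝ) (hN : 2 ≤ N) (A : Obs d N) :
    epsInv N N (obsBracket (eps N N A) (eps 2 N (obsW hU κ 2))) =
      obsOf ((Complex.I * (-κ / ((N : ℝ) - 1) : ℝ)) • opComm (liftB A.1) (pairTotal U N))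
        ((isSkew_liftB A).opComm (realSymm_pairTotal hU) _) := by
  refine epsInv_eq_obsOf (by omega) le_rfl (Function.Embedding.refl _) _ ?_
  rw [obsBracket_val (smul_eps_obsW_two hU κ hN), eps_val le_rfl (Function.Embedding.refl _),
    symAct_refl, symAct_refl, comm_bos_pairTotal hU, bos_smul]

theorem obsBracket_zero_right (A : Obs d N) : obsBracket A 0 = 0 := by
  refine Subtype.ext ?_
  rw [obsBracket_val (P := 0) (c := 0)]
  · ext1 f
    simp
  · ext1 f
    simp

theorem bracket_obsW_of_three_le (hU : U.HasTemperateGrowth) (κ : ℝ) {j m : ℕ} (hj : 3 ≤ j)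
    (hjN : j ≤ N) (hm1 : 1 ≤ m) (hm : m ≤ N) (A : Obs d N) :
    epsInv m N (obsBracket A (eps j N (obsW hU κ j))) = 0 := by
  have h : obsW hU κ j = 0 := by
    obtain ⟨i, rfl⟩ := Nat.exists_eq_add_of_le' hj
    refine Subtype.ext ?_
    have h0 : (Complex.I * ((-1 : ℝ) : ℂ)) • bbgkyW U κ (i + 3) = 0 := smul_zero _
    change bos _ = 0
    rw [h0, bos_zero]
  rw [h, eps_zero hjN, obsBracket_zero_right, epsInv_zero hm1 hm]

/-- The value of the BBGKY vector field, for `S = γ^{(k)}` and `S' = γ^{(k+1)}`. -/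
def bbgkyOp (U : EuclideanSpace ℝ (Fin d) → ℝ) (κ : ℝ) (N : ℕ) {k : ℕ} (S : SmoothOp d k)
    (S' : SmoothOp d (k + 1)) : SmoothOp d k :=
  (Complex.I * (1 : ℝ)) • SmoothOp.commutator (totalLaplacian d k) S +
    (Complex.I * (-κ / ((N : ℝ) - 1) : ℝ)) •
      -- For k < N the bracket of A^(k) with W^(2) lands at level k + 1, so it is tested on
      -- γ^{(k+1)} only; for k = N it lands at N.
      if k < N then
        SmoothOp.commutator (pairTotal U k) (SmoothOp.partialTraceCLM d k S') +
          (2 * ((N : ℂ) - k)) •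
            SmoothOp.partialTraceCLM d k (SmoothOp.commutator (pairLast U k) S')
      else SmoothOp.commutator (pairTotal U k) S

/-- Cyclicity moves the potentials onto S, and the partial trace is dual to acting in the first k
variables. In the internal term the partial trace comes first, so the commutator is with Tr_{k+1} S;
in the coupling term it comes last. -/
theorem trace_nextOp_comp (hU : U.HasTemperateGrowth) (D : Sch d k →L[ℂ] Sch d k)
    (S : SmoothOp d (k + 1)) :
    SmoothOp.trace (nextOp U N D ∘L S) =
      SmoothOp.trace (D ∘L (SmoothOp.commutator (pairTotal U k) (SmoothOp.partialTraceCLM d k S) +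
          (2 * ((N : ℂ) - k)) •
            SmoothOp.partialTraceCLM d k (SmoothOp.commutator (pairLast U k) S))) := by
  rw [nextOp_eq, ContinuousLinearMap.add_comp, ContinuousLinearMap.smul_comp,
    ContinuousLinearMap.comp_add, ContinuousLinearMap.comp_smul, SmoothOp.trace_add,
    SmoothOp.trace_add, SmoothOp.trace_smul, SmoothOp.trace_smul, SmoothOp.trace_act_comp,
    SmoothOp.trace_opComm_comp (realSymm_pairTotal hU),
    SmoothOp.trace_opComm_comp (realSymm_pairLast hU), SmoothOp.trace_act_comp,
    SmoothOp.partialTrace_eq, SmoothOp.partialTrace_eq]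

theorem sum_idx_fiber {α M : Type*} [Fintype α] [AddCommMonoid M] {β : Type*} [Fintype β]
    [DecidableEq β] (m : α → β) (g : β → α → M) :
    ∑ b, ∑ a with m a = b, g b a = ∑ a, g (m a) a := by
  simp only [Finset.sum_filter]
  rw [Finset.sum_comm]
  refine Finset.sum_congr rfl fun a _ => ?_
  simp

/-- The bracket with the gradient of the BBGKY Hamiltonian is the pairing with the BBGKY vector
field. -/
theorem trPairing_hierBracket (hU : U.HasTemperateGrowth) (he : ∀ x, U (-x) = U x) (κ : ℝ)
    (hN : 2 ≤ N) (A : ObsHier d N) (Γ : DMHier d N) :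
    trPairing (hierBracket A fun k => obsW hU κ k) Γ =
      ∑ k : Idx N, SmoothOp.trace (liftB (A k).1 ∘L bbgkyOp U κ N (Γ.op k) (Γ.op (k + 1))) := by
  classical
  -- Each pair of levels feeds exactly one level m, so the sum over levels and fibres collapses to a
  -- sum over pairs.
  let m : Idx N × Idx N → Idx N := fun p => ⟨min ((p.1 : ℕ) + (p.2 : ℕ) - 1) N, by
    have h1 := Finset.mem_Icc.1 p.1.2
    have h2 := Finset.mem_Icc.1 p.2.2
    rw [Finset.mem_Icc]
    omega⟩
  let g : Idx N → Idx N × Idx N → ℂ := fun k p =>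
    obsPairing d k (epsInv (k : ℕ) N (obsBracket (eps (p.1 : ℕ) N (A p.1))
      (eps (p.2 : ℕ) N (obsW hU κ p.2)))) (Γ k)
  have h1 : trPairing (hierBracket A fun k => obsW hU κ k) Γ = ∑ p, g (m p) p := by
    rw [← sum_idx_fiber m g, trPairing_eq]
    refine Finset.sum_congr rfl fun k _ => ?_
    rw [hierBracket, map_sum, LinearMap.sum_apply]
    refine Finset.sum_congr (Finset.filter_congr fun p _ => ?_) fun p _ => rfl
    exact ⟨fun h => Subtype.ext h, fun h => congrArg Subtype.val h⟩
  rw [h1, Fintype.sum_prod_type]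
  refine Finset.sum_congr rfl fun k _ => ?_
  have hk := Finset.mem_Icc.1 k.2
  let j1 : Idx N := ⟨1, Finset.mem_Icc.2 ⟨le_rfl, by omega⟩⟩
  let j2 : Idx N := ⟨2, Finset.mem_Icc.2 ⟨by omega, hN⟩⟩
  have hne : j1 ≠ j2 := fun h => by
    have := congrArg Subtype.val h
    simp [j1, j2] at this
  -- The Hamiltonian has no components of order three or higher.
  have h2 : ∑ j, g (m (k, j)) (k, j) = g (m (k, j1)) (k, j1) + g (m (k, j2)) (k, j2) := by
    rw [← Finset.sum_pair hne (f := fun j => g (m (k, j)) (k, j))]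
    refine (Finset.sum_subset (Finset.subset_univ _) fun j _ hj => ?_).symm
    have hj' := Finset.mem_Icc.1 j.2
    have h3 : 3 ≤ (j : ℕ) := by
      simp only [Finset.mem_insert, Finset.mem_singleton, not_or, j1, j2, Subtype.ext_iff] at hj
      omega
    have hm := Finset.mem_Icc.1 (m (k, j)).2
    simp only [g]
    rw [bracket_obsW_of_three_le hU κ h3 hj'.2 hm.1 hm.2, map_zero, LinearMap.zero_apply]
  rw [h2]
  have hm1 : m (k, j1) = k := Subtype.ext (by simp only [m, j1]; omega)
  have h3 : g (m (k, j1)) (k, j1) = (Complex.I * (1 : ℝ)) * SmoothOp.trace (liftB (A k).1 ∘L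
      SmoothOp.commutator (totalLaplacian d k) (Γ.op k)) := by
    rw [hm1]
    simp only [g, j1]
    rw [bracket_obsW_one hU κ hk.1 hk.2, obsPairing_obsOf, ContinuousLinearMap.smul_comp,
      SmoothOp.trace_smul, SmoothOp.trace_opComm_comp realSymm_totalLaplacian, op_coe]
  rw [h3, bbgkyOp, ContinuousLinearMap.comp_add, SmoothOp.trace_add, ContinuousLinearMap.comp_smul,
    SmoothOp.trace_smul, ContinuousLinearMap.comp_smul, SmoothOp.trace_smul]
  congr 1
  by_cases hkN : (k : ℕ) < N
  · let k' : Idx N := ⟨k + 1, Finset.mem_Icc.2 ⟨by omega, hkN⟩⟩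
    have hm2 : m (k, j2) = k' := Subtype.ext (by simp only [m, j2, k']; omega)
    rw [if_pos hkN, hm2]
    simp only [g, j2]
    have h4 : Γ.op ((k : ℕ) + 1) = BSmoothOp.toOp (Γ k').1 := op_coe Γ k'
    rw [h4, bracket_obsW_two hU he κ hN hkN, obsPairing_obsOf, ContinuousLinearMap.smul_comp,
      SmoothOp.trace_smul, trace_nextOp_comp hU]
  · obtain ⟨k, hk'⟩ := k
    obtain rfl : k = N := by
      simp only at hk hkN
      omega
    have hm2 : m (⟨k, hk'⟩, j2) = ⟨k, hk'⟩ := Subtype.ext (by simp only [m, j2]; omega)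
    rw [if_neg hkN, hm2]
    simp only [g, j2]
    rw [bracket_obsW_two_top hU κ hN, obsPairing_obsOf, ContinuousLinearMap.smul_comp,
      SmoothOp.trace_smul, SmoothOp.trace_opComm_comp (realSymm_pairTotal hU)]
    congr 4
    exact (op_coe Γ ⟨k, hk'⟩).symm

end Bracket

/-! ### Smoothness of continuous linear maps -/

section GateauxLinear

/-- Continuous linear maps are smooth. -/
theorem gateauxSmooth_of_linear {X Y : Type*} [AddCommGroup X] [Module ℝ X] [TopologicalSpace X]
    [AddCommGroup Y] [Module ℝ Y] [TopologicalSpace Y] (f : X →ₗ[ℝ] Y) (hf : Continuous f) :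
    GateauxSmooth f := by
  have hquot : ∀ (s : ℝ) (x w : X), s ≠ 0 → s⁻¹ • (f (x + s • w) - f x) = f w := by
    intro s x w hs
    rw [map_add, map_smul, add_sub_cancel_left, smul_smul, inv_mul_cancel₀ hs, one_smul]
  refine ⟨fun n x v => match n, v with
    | 0, _ => f x
    | 1, v => f (v 0)
    | _ + 2, _ => 0, fun _ _ => rfl, fun n => ?_, fun n x v w => ?_⟩
  · match n with
    | 0 => exact hf.comp continuous_fst
    | 1 => exact hf.comp ((continuous_apply 0).comp continuous_snd)
    | _ + 2 => exact continuous_const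
  · match n with
    | 0 =>
      refine tendsto_const_nhds.congr' ?_
      filter_upwards [self_mem_nhdsWithin] with s hs
      exact (hquot s x w hs).symm
    | 1 =>
      refine tendsto_const_nhds.congr fun s => ?_
      simp
    | _ + 2 =>
      refine tendsto_const_nhds.congr fun s => ?_
      simp

end GateauxLinear

/-! ### Rank-one observables and densities -/

section RankOne

variable {d k N : ℕ}

/-- Complex conjugation of bosonic functions. -/
def conjB (f : BSch d k) : BSch d k := ⟨conjS (f : Sch d k), fun π x => by
  rw [conjS_apply, conjS_apply, f.2 π x]⟩

theorem toBDual_conjB (f g : BSch d k) : toBDual (conjB f) g = l2inner (f : Sch d k) g := by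
  rw [SmoothOp.toBDual_apply]
  congr 1
  ext x
  simp [conjB]

theorem toBDual_apply_conjB (f g : BSch d k) : toBDual g (conjB f) = l2inner (f : Sch d k) g := by
  rw [SmoothOp.toBDual_apply, l2inner, l2inner]
  congr 1
  funext x
  simp [conjB, mul_comm]

/-- The density matrix `|f⟩⟨f|`. -/
def rankOne (f : BSch d k) : DM d k :=
  -- Distributions are paired bilinearly, so f is conjugated to obtain the inner product.
  ⟨{ toFun := fun u => u (conjB f) • f
     map_add' := fun u v => add_smul _ _ _
     map_smul' := fun c u => mul_smul _ _ _
     cont := ((continuous_id (X := ℂ)).smul continuous_const).comp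
       (continuous_eval_const (conjB f)) }, fun g h => by
    change l2inner (toBDual g (conjB f) • (f : Sch d k)) h =
      l2inner (g : Sch d k) (toBDual h (conjB f) • (f : Sch d k))
    rw [toBDual_apply_conjB, toBDual_apply_conjB, l2inner_csmul_left, l2inner_csmul_right,
      l2inner_conj_symm, mul_comm]⟩

theorem obsPairing_rankOne (A : Obs d k) (f : BSch d k) :
    obsPairing d k A (rankOne f) = l2inner (f : Sch d k) (A.1 f) := by
  rw [obsPairing_apply, SmoothOp.trace, l2inner]
  congr 1
  funext x
  have h : (BSmoothOp.toOp (A.1 ∘L (rankOne f).1)).kernel x x =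
      (A.1 ((conjB f : Sch d k) x • f) : Sch d k) x := rfl
  rw [h, map_smul]
  rfl

/-- The observable `i |f⟩⟨f|`. -/
def rankOneObs (f : BSch d k) : Obs d k :=
  ⟨(toBDual (conjB f)).smulRight (Complex.I • f), fun g h => by
    change l2inner (toBDual (conjB f) g • Complex.I • (f : Sch d k)) h =
      -l2inner (g : Sch d k) (toBDual (conjB f) h • Complex.I • (f : Sch d k))
    rw [toBDual_conjB, toBDual_conjB, l2inner_csmul_left, l2inner_csmul_left, l2inner_csmul_right,
      l2inner_csmul_right, l2inner_conj_symm, Complex.conj_I]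
    ring⟩

theorem obsPairing_rankOneObs (f : BSch d k) (γ : DM d k) :
    obsPairing d k (rankOneObs f) γ = Complex.I * l2inner (f : Sch d k) (γ.1 (toBDual f)) := by
  have h1 : (γ.1 (toBDual f) : Sch d k) = BSmoothOp.toOp γ.1 (SmoothOp.toDual (f : Sch d k)) := by
    rw [SmoothOp.toOp_apply, SmoothOp.toDual_comp_incl, symmetrize_incl]
  rw [h1, SmoothOp.l2inner_apply_toDual, SmoothOp.integral_kernel_swap, obsPairing_apply,
    SmoothOp.trace, ← MeasureTheory.integral_const_mul]
  congr 1
  funext x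
  have h2 : (BSmoothOp.toOp ((rankOneObs f).1 ∘L γ.1)).kernel x x =
      toBDual (conjB f) (γ.1 (diracAt x ∘L inclB d k)) * (Complex.I * (f : Sch d k) x) := rfl
  rw [h2, toBDual_conjB, l2inner, mul_left_comm, ← MeasureTheory.integral_mul_const]
  congr 2
  funext y
  have h3 : (BSmoothOp.toOp γ.1).kernel y x = (γ.1 (diracAt x ∘L inclB d k) : Sch d k) y := rfl
  rw [h3]
  ring

/-- Polarization. -/
theorem eq_zero_of_l2inner_self (L : BSch d k →ₗ[ℂ] BSch d k)
    (h : ∀ f : BSch d k, l2inner (f : Sch d k) (L f) = 0) : L = 0 := by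
  have h1 : ∀ f g : BSch d k, l2inner (f : Sch d k) (L g) + l2inner (g : Sch d k) (L f) = 0 := by
    intro f g
    have h2 := h (f + g)
    rw [map_add] at h2
    change l2inner ((f : Sch d k) + (g : Sch d k)) ((L f : Sch d k) + (L g : Sch d k)) = 0 at h2
    rw [l2inner_add_left, l2inner_add_right, l2inner_add_right, h, h] at h2
    simpa using h2
  refine LinearMap.ext fun g => eq_of_l2inner_bosonic fun f => ?_
  have h2 := h1 f g
  -- The factor I enters the two terms with opposite signs, so this identity and the one for g
  -- isolate the inner product of f with L g.
  have h3 := h1 f (Complex.I • g)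
  rw [map_smul] at h3
  change l2inner (f : Sch d k) (Complex.I • (L g : Sch d k)) +
    l2inner (Complex.I • (g : Sch d k)) (L f) = 0 at h3
  rw [l2inner_csmul_left, l2inner_csmul_right, Complex.conj_I, neg_mul, ← sub_eq_add_neg,
    ← mul_sub] at h3
  have h4 := (mul_eq_zero.1 h3).resolve_left Complex.I_ne_zero
  change _ = l2inner (f : Sch d k) 0
  rw [l2inner_zero_right]
  linear_combination (h2 + h4) / 2

/-- The densities |f⟩⟨f| give the quadratic form ⟨f, A f⟩, which determines A by polarization. -/
theorem obs_eq_of_obsPairing {A B : Obs d k}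
    (h : ∀ γ, obsPairing d k A γ = obsPairing d k B γ) : A = B := by
  have h1 : (A.1 - B.1 : BSch d k →L[ℂ] BSch d k) = 0 := by
    have := eq_zero_of_l2inner_self (A.1 - B.1 : BSch d k →L[ℂ] BSch d k).toLinearMap fun (f : BSch d k) => by
      change l2inner (f : Sch d k) ((A.1 f : Sch d k) - (B.1 f : Sch d k)) = 0
      rw [l2inner_sub_right, ← obsPairing_rankOne, ← obsPairing_rankOne, h, sub_self]
    ext1 f
    exact LinearMap.congr_fun this f
  exact Subtype.ext (sub_eq_zero.1 h1)

end RankOne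

/-! ### Admissible functionals, gradients, and uniqueness of Hamiltonian vector fields -/

section Functionals

variable {d k N : ℕ}

/-- `γ ↦ Tr(A γ)` as a continuous functional. -/
theorem continuous_obsPairing (A : Obs d k) : Continuous (obsPairing d k A) := by
  have h1 : Continuous fun T : BSmoothOp d k => A.1 ∘L T :=
    (ContinuousLinearMap.postcomp (BSchDual d k) A.1).continuous
  have h2 : Continuous fun T : BSmoothOp d k => (inclB d k) ∘L T :=
    (ContinuousLinearMap.postcomp (BSchDual d k) (inclB d k)).continuous
  have h3 : Continuous fun T : BSchDual d k →L[ℂ] Sch d k =>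
      T ∘L ContinuousLinearMap.precomp ℂ (inclB d k) :=
    (ContinuousLinearMap.precomp (Sch d k) (ContinuousLinearMap.precomp ℂ (inclB d k))).continuous
  have h4 := (SmoothOp.traceCLM d k).continuous.comp
    (h3.comp (h2.comp (h1.comp (continuous_subtype_val (p := (· ∈ densityMatrices d k))))))
  refine h4.congr fun γ => ?_
  exact SmoothOp.traceCLM_apply _

/-- The pairing with an observable hierarchy. -/
def trPairingL (A : ObsHier d N) : DMHier d N →ₗ[ℝ] ℂ :=
  ∑ k : Idx N, obsPairing d k (A k) ∘ₗ LinearMap.proj k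

theorem trPairingL_apply (A : ObsHier d N) (Γ : DMHier d N) :
    trPairingL A Γ = trPairing A Γ := by
  rw [trPairingL, LinearMap.sum_apply]
  rfl

theorem continuous_trPairing (A : ObsHier d N) :
    Continuous fun Γ : DMHier d N => trPairing A Γ :=
  continuous_finsetSum _ fun k _ => (continuous_obsPairing (A k)).comp (continuous_apply k)

/-- The real part of `i Tr(A · Γ)`. -/
def obsFunctional (A : ObsHier d N) : DMHier d N →ₗ[ℝ] ℝ :=
  Complex.reLm ∘ₗ (Complex.I • trPairingL A)

theorem obsFunctional_apply (A : ObsHier d N) (Γ : DMHier d N) :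
    obsFunctional A Γ = (Complex.I * trPairing A Γ).re := by
  rw [← trPairingL_apply]
  rfl

theorem gateauxSmooth_obsFunctional (A : ObsHier d N) : GateauxSmooth (obsFunctional A) := by
  refine gateauxSmooth_of_linear _ ?_
  refine (Complex.continuous_re.comp ((continuous_trPairing A).const_smul Complex.I)).congr ?_
  exact fun Γ => (obsFunctional_apply A Γ).symm

theorem obsFunctional_mem (A : ObsHier d N)
    (hA : ∀ Γ : DMHier d N, (Complex.I * trPairing A Γ).im = 0) :
    (fun Γ : DMHier d N => obsFunctional A Γ) ∈ admissible d N := by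
  refine Algebra.subset_adjoin ⟨gateauxSmooth_obsFunctional A, A, fun Γ => ?_⟩
  beta_reduce
  rw [obsFunctional_apply]
  exact Complex.ext rfl (by rw [Complex.ofReal_im, hA])

theorem hasDerivAt_linear (f : DMHier d N →ₗ[ℝ] ℝ) (Γ δ : DMHier d N) :
    HasDerivAt (fun s : ℝ => f (Γ + s • δ)) (f δ) 0 := by
  have h : (fun s : ℝ => f (Γ + s • δ)) = fun s => f Γ + s * f δ := by
    funext s
    rw [map_add, map_smul, smul_eq_mul]
  rw [h]
  simpa using ((hasDerivAt_id (0 : ℝ)).mul_const (f δ)).const_add (f Γ)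

/-- `A` represents the derivative of `F` at `Γ`. -/
def IsGradient (F : DMHier d N → ℝ) (Γ : DMHier d N) (A : ObsHier d N) : Prop :=
  ∀ δ : DMHier d N, ∃ F' : ℝ,
    HasDerivAt (fun s : ℝ => F (Γ + s • δ)) F' 0 ∧ (F' : ℂ) = Complex.I * trPairing A δ

theorem trPairing_zero (Γ : DMHier d N) : trPairing (0 : ObsHier d N) Γ = 0 := by
  simp [trPairing_eq]

theorem trPairing_add (A B : ObsHier d N) (Γ : DMHier d N) :
    trPairing (A + B) Γ = trPairing A Γ + trPairing B Γ := by
  simp [trPairing_eq, Finset.sum_add_distrib]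

theorem trPairing_smul (c : ℝ) (A : ObsHier d N) (Γ : DMHier d N) :
    trPairing (fun k => c • A k : ObsHier d N) Γ = c * trPairing A Γ := by
  simp [trPairing_eq, Finset.mul_sum]

/-- Generators are linear and have constant gradients; the sum and product rules propagate existence
through the generated algebra. -/
theorem exists_isGradient {F : DMHier d N → ℝ} (hF : F ∈ admissible d N) (Γ : DMHier d N) :
    ∃ A, IsGradient F Γ A := by
  have h0 : ∀ δ : DMHier d N, Γ + (0 : ℝ) • δ = Γ := fun δ => by rw [zero_smul, add_zero]
  induction hF using Algebra.adjoin_induction with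
  | mem F hF =>
    obtain ⟨-, A, hA⟩ := hF
    have h : F = fun Δ => obsFunctional A Δ := funext fun Δ => by
      rw [obsFunctional_apply, ← hA, Complex.ofReal_re]
    refine ⟨A, fun δ => ⟨F δ, ?_, hA δ⟩⟩
    rw [h]
    exact hasDerivAt_linear (obsFunctional A) Γ δ
  | algebraMap c =>
    refine ⟨0, fun δ => ⟨0, hasDerivAt_const _ _, ?_⟩⟩
    rw [trPairing_zero]
    simp
  | add F G _ _ hF hG =>
    obtain ⟨A, hA⟩ := hF
    obtain ⟨B, hB⟩ := hG
    refine ⟨A + B, fun δ => ?_⟩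
    obtain ⟨F', hF', hFA⟩ := hA δ
    obtain ⟨G', hG', hGB⟩ := hB δ
    refine ⟨F' + G', hF'.add hG', ?_⟩
    rw [trPairing_add, mul_add, ← hFA, ← hGB, Complex.ofReal_add]
  | mul F G _ _ hF hG =>
    obtain ⟨A, hA⟩ := hF
    obtain ⟨B, hB⟩ := hG
    refine ⟨(fun k => G Γ • A k : ObsHier d N) + fun k => F Γ • B k, fun δ => ?_⟩
    obtain ⟨F', hF', hFA⟩ := hA δ
    obtain ⟨G', hG', hGB⟩ := hB δ
    refine ⟨F' * G Γ + F Γ * G', ?_, ?_⟩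
    · have := hF'.mul hG'
      simp only [h0] at this
      exact this
    · rw [trPairing_add, trPairing_smul, trPairing_smul, mul_add, mul_left_comm, ← hFA,
        mul_left_comm, ← hGB]
      push_cast
      ring

theorem dmGradient_spec {F : DMHier d N → ℝ} (hF : F ∈ admissible d N) (Γ : DMHier d N) :
    IsGradient F Γ (dmGradient F Γ) := Classical.epsilon_spec (exists_isGradient hF Γ)

theorem trPairing_single (A : ObsHier d N) (k : Idx N) (γ : DM d k) :
    trPairing A (Pi.single k γ) = obsPairing d k (A k) γ := by
  classical
  rw [trPairing_eq, Finset.sum_eq_single k]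
  · rw [Pi.single_eq_same]
  · intro j _ hj
    rw [Pi.single_eq_of_ne hj, map_zero]
  · simp

/-- Directions concentrated at one level reduce this to `obs_eq_of_obsPairing`; thus the gradient
picked by choice is the only one. -/
theorem IsGradient.unique {F : DMHier d N → ℝ} {Γ : DMHier d N} {A B : ObsHier d N}
    (hA : IsGradient F Γ A) (hB : IsGradient F Γ B) : A = B := by
  classical
  funext k
  refine obs_eq_of_obsPairing fun γ => ?_
  rw [← trPairing_single, ← trPairing_single]
  obtain ⟨F', hF', hFA⟩ := hA (Pi.single k γ)
  obtain ⟨G', hG', hGB⟩ := hB (Pi.single k γ)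
  rw [hF'.unique hG', hGB] at hFA
  exact (mul_left_cancel₀ Complex.I_ne_zero hFA).symm

/-- The derivative of a linear functional is the functional itself, so the Hamiltonian condition
prescribes its value at X Γ. -/
theorem IsHamiltonianVectorField.functional_eq {H : DMHier d N → ℝ}
    {X : DMHier d N → DMHier d N} (hX : IsHamiltonianVectorField H X) {A : ObsHier d N}
    (hA : ∀ Γ : DMHier d N, (Complex.I * trPairing A Γ).im = 0) (Γ : DMHier d N) :
    obsFunctional A (X Γ) = poissonBracket (fun Δ => obsFunctional A Δ) H Γ :=
  (hasDerivAt_linear (obsFunctional A) Γ (X Γ)).unique (hX.2 _ (obsFunctional_mem A hA) Γ)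

/-- A Hamiltonian vector field is unique. -/
theorem IsHamiltonianVectorField.unique {H : DMHier d N → ℝ} {X Y : DMHier d N → DMHier d N}
    (hX : IsHamiltonianVectorField H X) (hY : IsHamiltonianVectorField H Y) : X = Y := by
  classical
  funext Γ k
  -- The test functionals come from i|f⟩⟨f| at level k; they are real because densities are
  -- self-adjoint.
  have hpair : ∀ (f : BSch d k) (Δ : DMHier d N), trPairing (Pi.single k (rankOneObs f)) Δ =
      Complex.I * l2inner (f : Sch d k) ((Δ k).1 (toBDual f)) := by
    intro f Δ
    rw [trPairing_eq, Finset.sum_eq_single k, Pi.single_eq_same, obsPairing_rankOneObs]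
    · intro j _ hj
      rw [Pi.single_eq_of_ne hj, map_zero, LinearMap.zero_apply]
    · simp
  have hval : ∀ (f : BSch d k) (Δ : DMHier d N), Complex.I * trPairing (Pi.single k (rankOneObs f)) Δ =
      -l2inner (f : Sch d k) ((Δ k).1 (toBDual f)) := by
    intro f Δ
    rw [hpair, ← mul_assoc, Complex.I_mul_I, neg_one_mul]
  have him : ∀ (f : BSch d k) (Δ : DMHier d N), (l2inner (f : Sch d k) ((Δ k).1 (toBDual f))).im = 0 := by
    intro f Δ
    rw [← Complex.conj_eq_iff_im, l2inner_conj_symm, (Δ k).2]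
  have him' : ∀ (f : BSch d k) (Δ : DMHier d N),
      (Complex.I * trPairing (Pi.single k (rankOneObs f)) Δ).im = 0 := fun f Δ => by
    rw [hval, Complex.neg_im, him, neg_zero]
  have heq : ∀ f : BSch d k, l2inner (f : Sch d k) ((X Γ k).1 (toBDual f)) =
      l2inner (f : Sch d k) ((Y Γ k).1 (toBDual f)) := by
    intro f
    have h3 := (hX.functional_eq (him' f) Γ).trans (hY.functional_eq (him' f) Γ).symm
    rw [obsFunctional_apply, obsFunctional_apply, hval, hval, Complex.neg_re, Complex.neg_re,
      neg_inj] at h3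
    exact Complex.ext h3 ((him f _).trans (him f _).symm)
  let D : BSmoothOp d k := (X Γ k).1 - (Y Γ k).1
  let L : BSch d k →ₗ[ℂ] BSch d k :=
    { toFun := fun f => D (toBDual f)
      map_add' := fun f g => by
        rw [← map_add]
        congr 1
        ext h
        simp [toBDual]
      map_smul' := fun c f => by
        rw [RingHom.id_apply, ← map_smul]
        congr 1
        ext h
        simp [toBDual] }
  have hL : L = 0 := eq_zero_of_l2inner_self L fun f => by
    change l2inner (f : Sch d k) (((X Γ k).1 (toBDual f) : Sch d k) - (Y Γ k).1 (toBDual f)) = 0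
    rw [l2inner_sub_right, heq, sub_self]
  -- So far the difference vanishes on distributions given by bosonic functions; this kills its
  -- kernel, and with it the operator on all distributions.
  have hD : BSmoothOp.toOp D = BSmoothOp.toOp 0 := by
    refine SmoothOp.ext_kernel fun x x' => ?_
    have h0 : (BSmoothOp.toOp (0 : BSmoothOp d k)).kernel x x' = 0 := rfl
    rw [h0]
    refine eq_zero_of_integral_mul (ψ := fun z => (BSmoothOp.toOp D).kernel x z) ?_ (fun g => ?_) x'
    · simp only [SmoothOp.kernel_eq]
      fun_prop
    · rw [← SmoothOp.apply_toDual, SmoothOp.toOp_apply, SmoothOp.toDual_comp_incl]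
      have := LinearMap.congr_fun hL (symmetrize d k g)
      change D (toBDual (symmetrize d k g)) = 0 at this
      rw [this]
      rfl
  exact Subtype.ext (sub_eq_zero.1 (SmoothOp.toOp_injective hD))

end Functionals

/-! ### The BBGKY vector field, its Hamiltonian nature, and the hierarchy -/

section VectorField

variable {d k N : ℕ} {U : EuclideanSpace ℝ (Fin d) → ℝ}

theorem isSymm_op (Γ : DMHier d N) (k : ℕ) : (Γ.op k).IsSymm := by
  rw [DMHier.op]
  split_ifs with h
  · exact SmoothOp.isSymm_toOp _
  · exact SmoothOp.isSymm_of_kernel (fun _ _ _ => rfl) fun _ _ _ => rfl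

theorem isHerm_op (Γ : DMHier d N) (k : ℕ) : (Γ.op k).IsHerm := by
  rw [DMHier.op]
  split_ifs with h
  · exact SmoothOp.isHerm_toOp _
  · exact fun x x' => map_zero (starRingEnd ℂ)

theorem isSymm_bbgkyOp (hU : U.HasTemperateGrowth) (κ : ℝ) {S : SmoothOp d k}
    {S' : SmoothOp d (k + 1)} (hS : S.IsSymm) (hS' : S'.IsSymm) : (bbgkyOp U κ N S S').IsSymm := by
  refine ((hS.commutator commPerm_totalLaplacian).smul _).add (SmoothOp.IsSymm.smul _ ?_)
  split_ifs
  · exact (hS'.partialTrace.commutator (commPerm_pairTotal hU)).add ((hS'.coupling hU).smul _)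
  · exact hS.commutator (commPerm_pairTotal hU)

/-- Commutators of real symmetric operators with Hermitian ones are anti-Hermitian and occur here
with imaginary coefficients; the partial trace preserves the Hermitian property. Thus the field
takes values in the density matrices. -/
theorem isHerm_bbgkyOp (hU : U.HasTemperateGrowth) (κ : ℝ) {S : SmoothOp d k}
    {S' : SmoothOp d (k + 1)} (hS : S.IsHerm) (hS' : S'.IsHerm) : (bbgkyOp U κ N S S').IsHerm := by
  refine (hS.smul_commutator realSymm_totalLaplacian.real 1).add ?_
  split_ifs
  · have h1 := hS'.partialTrace.smul_commutator (realSymm_pairTotal hU).real (-κ / ((N : ℝ) - 1))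
    have h2 := ((hS'.smul_commutator (realSymm_pairLast hU).real
      (-κ / ((N : ℝ) - 1))).partialTrace).smul (2 * ((N : ℝ) - k))
    have h3 := h1.add h2
    rw [map_smul, smul_smul] at h3
    rw [smul_add, smul_smul]
    have h4 : Complex.I * ((-κ / ((N : ℝ) - 1) : ℝ) : ℂ) * (2 * ((N : ℂ) - k)) =
        ((2 * ((N : ℝ) - k) : ℝ) : ℂ) * (Complex.I * ((-κ / ((N : ℝ) - 1) : ℝ) : ℂ)) := by
      push_cast
      ring
    rw [h4]
    exact h3
  · exact hS.smul_commutator (realSymm_pairTotal hU).real _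

theorem commutator_add_right (B : Sch d k →L[ℂ] Sch d k) (S T : SmoothOp d k) :
    SmoothOp.commutator B (S + T) = SmoothOp.commutator B S + SmoothOp.commutator B T := by
  ext u x
  simp only [SmoothOp.commutator, sub_apply, ContinuousLinearMap.comp_apply, add_apply, map_add]
  ring

theorem commutator_smul_right (B : Sch d k →L[ℂ] Sch d k) (c : ℂ) (T : SmoothOp d k) :
    SmoothOp.commutator B (c • T) = c • SmoothOp.commutator B T := by
  ext u x
  simp only [SmoothOp.commutator, sub_apply, ContinuousLinearMap.comp_apply, smul_apply, map_smul,
    smul_sub]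

instance instSmoothOpTopologicalAddGroup (d k : ℕ) : IsTopologicalAddGroup (SmoothOp d k) :=
  ContinuousLinearMap.topologicalAddGroup

theorem SmoothOp.continuous_add {Z : Type*} [TopologicalSpace Z] {f g : Z → SmoothOp d k}
    (hf : Continuous f) (hg : Continuous g) : Continuous fun z => f z + g z :=
  (instSmoothOpTopologicalAddGroup d k).toContinuousAdd.continuous_add.comp (hf.prodMk hg)

theorem SmoothOp.continuous_const_smul {Z : Type*} [TopologicalSpace Z] {f : Z → SmoothOp d k}
    (c : ℂ) (hf : Continuous f) : Continuous fun z => c • f z := hf.const_smul c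

theorem continuous_commutator (B : Sch d k →L[ℂ] Sch d k) :
    Continuous (SmoothOp.commutator B) := by
  have h1 : Continuous fun T : SmoothOp d k => B ∘L T :=
    (ContinuousLinearMap.postcomp (SchDual d k) B).continuous
  have h2 : Continuous fun T : SmoothOp d k => T ∘L ContinuousLinearMap.precomp ℂ B :=
    (ContinuousLinearMap.precomp (Sch d k) (ContinuousLinearMap.precomp ℂ B)).continuous
  refine (SmoothOp.continuous_add h1 (h2.const_smul (-1 : ℂ))).congr fun T => ?_
  ext u x
  simp [SmoothOp.commutator, sub_eq_add_neg]

theorem bbgkyOp_add (κ : ℝ) (S T : SmoothOp d k) (S' T' : SmoothOp d (k + 1)) :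
    bbgkyOp U κ N (S + T) (S' + T') = bbgkyOp U κ N S S' + bbgkyOp U κ N T T' := by
  rw [bbgkyOp, bbgkyOp, bbgkyOp]
  split_ifs
  · simp only [commutator_add_right, map_add, smul_add]
    abel
  · simp only [commutator_add_right, smul_add]
    abel

theorem bbgkyOp_smul (κ : ℝ) (c : ℂ) (S : SmoothOp d k) (S' : SmoothOp d (k + 1)) :
    bbgkyOp U κ N (c • S) (c • S') = c • bbgkyOp U κ N S S' := by
  rw [bbgkyOp, bbgkyOp]
  split_ifs
  · simp only [commutator_smul_right, map_smul, smul_add, smul_smul, mul_comm, mul_left_comm,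
      mul_assoc]
  · simp only [commutator_smul_right, smul_add, smul_smul, mul_comm]

theorem continuous_bbgkyOp (κ : ℝ) : Continuous fun p : SmoothOp d k × SmoothOp d (k + 1) =>
    bbgkyOp U κ N p.1 p.2 := by
  have h1 : Continuous fun p : SmoothOp d k × SmoothOp d (k + 1) =>
      SmoothOp.commutator (totalLaplacian d k) p.1 := (continuous_commutator _).comp continuous_fst
  have h2 : Continuous fun p : SmoothOp d k × SmoothOp d (k + 1) =>
      SmoothOp.commutator (pairTotal U k) p.1 := (continuous_commutator _).comp continuous_fst
  have h3 : Continuous fun p : SmoothOp d k × SmoothOp d (k + 1) =>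
      SmoothOp.commutator (pairTotal U k) (SmoothOp.partialTraceCLM d k p.2) :=
    (continuous_commutator _).comp ((SmoothOp.partialTraceCLM d k).continuous.comp continuous_snd)
  have h4 : Continuous fun p : SmoothOp d k × SmoothOp d (k + 1) =>
      SmoothOp.partialTraceCLM d k (SmoothOp.commutator (pairLast U k) p.2) :=
    (SmoothOp.partialTraceCLM d k).continuous.comp ((continuous_commutator _).comp continuous_snd)
  unfold bbgkyOp
  split_ifs
  · exact SmoothOp.continuous_add (SmoothOp.continuous_const_smul _ h1)
      (SmoothOp.continuous_const_smul _
        (SmoothOp.continuous_add h3 (SmoothOp.continuous_const_smul _ h4)))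
  · exact SmoothOp.continuous_add (SmoothOp.continuous_const_smul _ h1)
      (SmoothOp.continuous_const_smul _ h2)

/-- `T ↦ ofOp T` as a continuous linear map. -/
def ofOpCLM (d k : ℕ) : SmoothOp d k →L[ℂ] BSmoothOp d k :=
  ContinuousLinearMap.postcomp (BSchDual d k) (symmetrize d k) ∘L
    ContinuousLinearMap.precomp (Sch d k) (ContinuousLinearMap.precomp ℂ (symmetrize d k))

theorem ofOpCLM_apply (T : SmoothOp d k) : ofOpCLM d k T = SmoothOp.ofOp T := rfl

theorem continuous_op (k : ℕ) : Continuous fun Γ : DMHier d N => Γ.op k := by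
  by_cases hk : k ∈ Finset.Icc 1 N
  · have h1 : Continuous fun T : BSmoothOp d k => (inclB d k) ∘L T :=
      (ContinuousLinearMap.postcomp (BSchDual d k) (inclB d k)).continuous
    have h2 : Continuous fun T : BSchDual d k →L[ℂ] Sch d k =>
        T ∘L ContinuousLinearMap.precomp ℂ (inclB d k) :=
      (ContinuousLinearMap.precomp (Sch d k) (ContinuousLinearMap.precomp ℂ (inclB d k))).continuous
    have h3 := h2.comp (h1.comp ((continuous_subtype_val (p := (· ∈ densityMatrices d k))).comp
      (continuous_apply (A := fun j : Idx N => DM d j) ⟨k, hk⟩)))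
    refine h3.congr fun Γ => ?_
    exact (op_coe Γ ⟨k, hk⟩).symm
  · have h : (fun Γ : DMHier d N => Γ.op k) = fun _ => 0 := funext fun Γ => dif_neg hk
    rw [h]
    exact continuous_const

theorem op_add (Γ Δ : DMHier d N) (k : ℕ) : (Γ + Δ).op k = Γ.op k + Δ.op k := by
  simp only [DMHier.op]
  split_ifs
  · rfl
  · exact (add_zero _).symm

theorem op_smul (c : ℝ) (Γ : DMHier d N) (k : ℕ) : (c • Γ).op k = (c : ℂ) • Γ.op k := by
  simp only [DMHier.op]
  split_ifs
  · rfl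
  · exact (smul_zero _).symm

/-- The BBGKY vector field. -/
def bbgkyField (hU : U.HasTemperateGrowth) (κ : ℝ) (N : ℕ) : DMHier d N →ₗ[ℝ] DMHier d N where
  toFun Γ := fun k => ⟨SmoothOp.ofOp (bbgkyOp U κ N (Γ.op k) (Γ.op (k + 1))),
    (isHerm_bbgkyOp hU κ (isHerm_op Γ k) (isHerm_op Γ (k + 1))).ofOp_mem⟩
  map_add' Γ Δ := by
    funext k
    refine Subtype.ext ?_
    change SmoothOp.ofOp (bbgkyOp U κ N ((Γ + Δ).op k) ((Γ + Δ).op (k + 1))) =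
      SmoothOp.ofOp (bbgkyOp U κ N (Γ.op k) (Γ.op (k + 1))) +
        SmoothOp.ofOp (bbgkyOp U κ N (Δ.op k) (Δ.op (k + 1)))
    rw [op_add, op_add, bbgkyOp_add]
    exact map_add (ofOpCLM d k) _ _
  map_smul' c Γ := by
    funext k
    refine Subtype.ext ?_
    change SmoothOp.ofOp (bbgkyOp U κ N ((c • Γ).op k) ((c • Γ).op (k + 1))) =
      (c : ℂ) • SmoothOp.ofOp (bbgkyOp U κ N (Γ.op k) (Γ.op (k + 1)))
    rw [op_smul, op_smul, bbgkyOp_smul]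
    exact map_smul (ofOpCLM d k) (c : ℂ) _

theorem bbgkyField_apply (hU : U.HasTemperateGrowth) (κ : ℝ) (Γ : DMHier d N) (k : Idx N) :
    bbgkyField hU κ N Γ k = ⟨SmoothOp.ofOp (bbgkyOp U κ N (Γ.op k) (Γ.op (k + 1))),
      (isHerm_bbgkyOp hU κ (isHerm_op Γ k) (isHerm_op Γ (k + 1))).ofOp_mem⟩ := rfl

theorem continuous_bbgkyField (hU : U.HasTemperateGrowth) (κ : ℝ) :
    Continuous (bbgkyField (d := d) hU κ N) := by
  refine continuous_pi fun k => Continuous.subtype_mk ?_ _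
  have h := (ofOpCLM d k).continuous.comp ((continuous_bbgkyOp (U := U) (N := N) κ).comp
    ((continuous_op (N := N) (k : ℕ)).prodMk (continuous_op ((k : ℕ) + 1))))
  refine h.congr fun Γ => ?_
  simp only [Function.comp_apply, ofOpCLM_apply]

theorem op_bbgkyField (hU : U.HasTemperateGrowth) (κ : ℝ) (Γ : DMHier d N) (hk1 : 1 ≤ k)
    (hk : k ≤ N) : (bbgkyField hU κ N Γ).op k = bbgkyOp U κ N (Γ.op k) (Γ.op (k + 1)) := by
  have h := op_coe (bbgkyField hU κ N Γ) ⟨k, Finset.mem_Icc.2 ⟨hk1, hk⟩⟩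
  rw [bbgkyField_apply, SmoothOp.toOp_ofOp (isSymm_bbgkyOp hU κ (isSymm_op Γ _) (isSymm_op Γ _))]
    at h
  exact h

theorem trPairing_bbgkyField (hU : U.HasTemperateGrowth) (he : ∀ x, U (-x) = U x) (κ : ℝ)
    (hN : 2 ≤ N) (A : ObsHier d N) (Γ : DMHier d N) :
    trPairing (hierBracket A fun k => obsW hU κ k) Γ = trPairing A (bbgkyField hU κ N Γ) := by
  rw [trPairing_hierBracket hU he κ hN, trPairing_eq]
  refine Finset.sum_congr rfl fun k _ => ?_
  rw [bbgkyField_apply, obsPairing_ofOp _ (isSymm_bbgkyOp hU κ (isSymm_op Γ _) (isSymm_op Γ _))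
    (isHerm_bbgkyOp hU κ (isHerm_op Γ k) (isHerm_op Γ (k + 1)))]

/-! ### The Hamiltonian -/

theorem bbgkyTrace_eq (hU : U.HasTemperateGrowth) (κ : ℝ) (Γ : DMHier d N) :
    bbgkyTrace U κ Γ = Complex.I * trPairing (fun k => obsW hU κ k) Γ := by
  rw [bbgkyTrace, trPairing_eq, ← Finset.sum_coe_sort, Finset.mul_sum]
  refine Finset.sum_congr rfl fun k _ => ?_
  rw [obsW, obsPairing_obsOf, ContinuousLinearMap.smul_comp, SmoothOp.trace_smul, op_coe,
    ← mul_assoc, ← mul_assoc, Complex.I_mul_I]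
  simp

theorem bbgkyTrace_im (hU : U.HasTemperateGrowth) (κ : ℝ) (Γ : DMHier d N) :
    (bbgkyTrace U κ Γ).im = 0 := by
  rw [← Complex.conj_eq_iff_im, bbgkyTrace, map_sum]
  exact Finset.sum_congr rfl fun k _ =>
    (isHerm_op Γ k).conj_trace_comp (realSymm_bbgkyW hU κ k).real ((realSymm_bbgkyW hU κ k).cyclic _)

theorem bbgkyHamiltonian_eq (hU : U.HasTemperateGrowth) (κ : ℝ) :
    bbgkyHamiltonian U κ = fun Γ : DMHier d N => obsFunctional (fun k => obsW hU κ k) Γ := by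
  funext Γ
  rw [bbgkyHamiltonian, bbgkyTrace_eq hU, obsFunctional_apply]

theorem bbgkyHamiltonian_mem (hU : U.HasTemperateGrowth) (κ : ℝ) :
    bbgkyHamiltonian U κ ∈ admissible d N := by
  rw [bbgkyHamiltonian_eq hU]
  refine obsFunctional_mem _ fun Γ => ?_
  rw [← bbgkyTrace_eq, bbgkyTrace_im hU]

/-- The Hamiltonian is linear, hence its own derivative, and uniqueness of gradients identifies the
chosen one. -/
theorem dmGradient_bbgkyHamiltonian (hU : U.HasTemperateGrowth) (κ : ℝ) (Γ : DMHier d N) :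
    dmGradient (bbgkyHamiltonian U κ) Γ = (fun k : Idx N => obsW hU κ k) := by
  have h : IsGradient (bbgkyHamiltonian U κ) Γ (fun k : Idx N => obsW hU κ k) := by
    intro δ
    have h1 : Complex.I * trPairing (fun k : Idx N => obsW hU κ k) δ = bbgkyTrace U κ δ :=
      (bbgkyTrace_eq hU κ δ).symm
    refine ⟨bbgkyHamiltonian U κ δ, ?_, ?_⟩
    · rw [bbgkyHamiltonian_eq hU]
      exact hasDerivAt_linear (obsFunctional fun k : Idx N => obsW hU κ k) Γ δ
    · rw [h1]
      exact Complex.ext rfl (bbgkyTrace_im hU κ δ).symm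
  exact (dmGradient_spec (bbgkyHamiltonian_mem hU κ) Γ).unique h

/-- The derivative of F along the field is i Tr(dF · X), which `trPairing_bbgkyField` turns into the
Poisson bracket. Smoothness holds because the field is linear and continuous. -/
theorem isHamiltonianVectorField_bbgkyField (hU : U.HasTemperateGrowth) (he : ∀ x, U (-x) = U x)
    (κ : ℝ) (hN : 2 ≤ N) :
    IsHamiltonianVectorField (bbgkyHamiltonian U κ) (bbgkyField (d := d) hU κ N) := by
  refine ⟨gateauxSmooth_of_linear _ (continuous_bbgkyField hU κ), fun F hF Γ => ?_⟩
  obtain ⟨F', hF', h⟩ := dmGradient_spec hF Γ (bbgkyField hU κ N Γ)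
  rw [poissonBracket, dmGradient_bbgkyHamiltonian hU, trPairing_bbgkyField hU he κ hN, ← h,
    Complex.ofReal_re]
  exact hF'

/-! ### The hierarchy -/

theorem commutator_sum {α : Type*} (s : Finset α) (B : α → Sch d k →L[ℂ] Sch d k)
    (T : SmoothOp d k) :
    SmoothOp.commutator (∑ a ∈ s, B a) T = ∑ a ∈ s, SmoothOp.commutator (B a) T := by
  ext1 u
  have h : ContinuousLinearMap.precomp ℂ (∑ a ∈ s, B a) u =
      ∑ a ∈ s, ContinuousLinearMap.precomp ℂ (B a) u := by
    ext f
    simp [ContinuousLinearMap.precomp_apply, sum_apply]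
  simp only [SmoothOp.commutator, sub_apply, ContinuousLinearMap.comp_apply, sum_apply, h, map_sum,
    Finset.sum_sub_distrib]

theorem neg_one_smul_op (T : SmoothOp d k) : (-1 : ℂ) • T = -T := by
  ext u x
  simp

theorem commutator_neg (B : Sch d k →L[ℂ] Sch d k) (T : SmoothOp d k) :
    SmoothOp.commutator (-B) T = -SmoothOp.commutator B T := by
  ext1 u
  have h : ContinuousLinearMap.precomp ℂ (-B) u = -ContinuousLinearMap.precomp ℂ B u := by
    ext f
    simp [ContinuousLinearMap.precomp_apply]
  simp only [SmoothOp.commutator, sub_apply, ContinuousLinearMap.comp_apply, neg_apply, h, map_neg]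
  abel

/-- For even U the two orders of a pair contribute equally. -/
theorem pairTotal_eq (hU : U.HasTemperateGrowth) (he : ∀ x, U (-x) = U x) : pairTotal U k =
    ∑ p : Fin k × Fin k with p.1 < p.2, pairMul U p.1 p.2 +
      ∑ p : Fin k × Fin k with p.1 < p.2, pairMul U p.1 p.2 := by
  have h1 : ∑ p : Fin k × Fin k with p.1 < p.2, pairMul U p.1 p.2 =
      ∑ p : Fin k × Fin k with p.2 < p.1, pairMul U p.1 p.2 := by
    simp only [Finset.sum_filter]
    refine Fintype.sum_equiv (Equiv.prodComm _ _) _ _ fun p => ?_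
    rw [pairMul_swap hU he]
    rfl
  nth_rewrite 2 [h1]
  rw [pairTotal, ← Fintype.sum_prod_type', Finset.sum_filter, Finset.sum_filter,
    ← Finset.sum_add_distrib]
  refine Finset.sum_congr rfl fun p _ => ?_
  rcases lt_trichotomy p.1 p.2 with h | h | h
  · simp [h, h.ne, h.not_gt]
  · simp [h]
  · simp [h, h.ne', h.not_gt]

theorem commutator_pairTotal (hU : U.HasTemperateGrowth) (he : ∀ x, U (-x) = U x)
    (T : SmoothOp d k) : SmoothOp.commutator (pairTotal U k) T =
      (2 : ℂ) • ∑ p : Fin k × Fin k with p.1 < p.2, SmoothOp.commutator (pairMul U p.1 p.2) T := by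
  rw [two_smul, ← commutator_sum]
  have h : ∀ B : Sch d k →L[ℂ] Sch d k, SmoothOp.commutator (B + B) T =
      SmoothOp.commutator B T + SmoothOp.commutator B T := fun B => by
    have := commutator_sum (Finset.univ : Finset (Fin 2)) (fun _ => B) T
    simpa [two_smul] using this
  rw [pairTotal_eq hU he, h]

/-- One particle has no pairs; for this reason no relation between γ^{(1)} and γ^{(2)} is required.
-/
theorem commutator_pairTotal_one (T : SmoothOp d 1) : SmoothOp.commutator (pairTotal U 1) T = 0 := by
  have h : pairTotal (d := d) U 1 = ∑ i ∈ (∅ : Finset (Fin 1)), pairMul U i i := by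
    simp [pairTotal]
  rw [h, commutator_sum, Finset.sum_empty]

/-- The field has Tr_{k+1} γ^{(k+1)} where the internal term has γ^{(k)}; the two commutators agree
by reduction, or trivially for k = 1. In the constants, i² supplies the signs and the double count
of pairs the factor 2 in 2κ / (N - 1). -/
theorem I_smul_bbgkyOp_of_lt (hU : U.HasTemperateGrowth) (he : ∀ x, U (-x) = U x) (κ : ℝ)
    (hk : k < N) (S : SmoothOp d k) (S' : SmoothOp d (k + 1)) (hS : k ≠ 1 → S = S'.partialTrace) :
    Complex.I • bbgkyOp U κ N S S' = bbgkyInternal N U κ S + bbgkyCoupling N U κ S' := by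
  have h1 : SmoothOp.commutator (pairTotal U k) (SmoothOp.partialTraceCLM d k S') =
      SmoothOp.commutator (pairTotal U k) S := by
    by_cases h : k = 1
    · subst h
      rw [commutator_pairTotal_one, commutator_pairTotal_one]
    · rw [hS h, SmoothOp.partialTrace_eq]
  have h2 : SmoothOp.partialTraceCLM d k (SmoothOp.commutator (pairLast U k) S') =
      ∑ i : Fin k, SmoothOp.partialTrace
        (SmoothOp.commutator (pairMul U i.castSucc (Fin.last k)) S') := by
    rw [pairLast, commutator_sum, map_sum]
    simp only [SmoothOp.partialTrace_eq]
  rw [bbgkyOp, if_pos hk, h1, h2, commutator_pairTotal hU he, bbgkyInternal, bbgkyCoupling,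
    commutator_neg]
  simp only [smul_add, smul_smul]
  have e1 : Complex.I * (Complex.I * ((1 : ℝ) : ℂ)) = -1 := by
    rw [Complex.ofReal_one, mul_one, Complex.I_mul_I]
  have e2 : Complex.I * (Complex.I * ((-κ / ((N : ℝ) - 1) : ℝ) : ℂ) * 2) =
      ((2 * κ / ((N : ℝ) - 1) : ℝ) : ℂ) := by
    push_cast
    linear_combination (-(κ : ℂ) / ((N : ℂ) - 1) * 2) * Complex.I_mul_I
  have e3 : Complex.I * (Complex.I * ((-κ / ((N : ℝ) - 1) : ℝ) : ℂ) * (2 * ((N : ℂ) - k))) =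
      ((2 * κ * ((N : ℝ) - k) / ((N : ℝ) - 1) : ℝ) : ℂ) := by
    push_cast
    linear_combination (-(κ : ℂ) / ((N : ℂ) - 1) * (2 * ((N : ℂ) - k))) * Complex.I_mul_I
  rw [e1, e2, e3, neg_one_smul_op, add_assoc]

theorem I_smul_bbgkyOp_top (hU : U.HasTemperateGrowth) (he : ∀ x, U (-x) = U x) (κ : ℝ)
    (S : SmoothOp d N) (S' : SmoothOp d (N + 1)) :
    Complex.I • bbgkyOp U κ N S S' = bbgkyInternal N U κ S := by
  rw [bbgkyOp, if_neg (lt_irrefl N), commutator_pairTotal hU he, bbgkyInternal, commutator_neg]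
  simp only [smul_add, smul_smul]
  have e1 : Complex.I * (Complex.I * ((1 : ℝ) : ℂ)) = -1 := by
    rw [Complex.ofReal_one, mul_one, Complex.I_mul_I]
  have e2 : Complex.I * (Complex.I * ((-κ / ((N : ℝ) - 1) : ℝ) : ℂ) * 2) =
      ((2 * κ / ((N : ℝ) - 1) : ℝ) : ℂ) := by
    push_cast
    linear_combination (-(κ : ℂ) / ((N : ℂ) - 1) * 2) * Complex.I_mul_I
  rw [e1, e2, neg_one_smul_op]

/-- Along a reduced curve the field satisfies the algebraic equations of the hierarchy, and these
determine the derivative, since multiplication by i is injective and the levels 1, …, N determine a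
hierarchy. -/
theorem solvesBBGKY_iff (hU : U.HasTemperateGrowth) (he : ∀ x, U (-x) = U x) (κ : ℝ) (hN : 2 ≤ N)
    {I : Set ℝ} {Γ : ℝ → DMHier d N} (hΓ : ∀ t ∈ I, IsReducedHierarchy (Γ t)) :
    SolvesBBGKY I U κ Γ ↔ ∀ t ∈ I, HasCurveDerivAt I Γ (bbgkyField hU κ N (Γ t)) t := by
  have hlt : ∀ t ∈ I, ∀ k, 1 ≤ k → k < N → Complex.I • (bbgkyField hU κ N (Γ t)).op k =
      bbgkyInternal N U κ ((Γ t).op k) + bbgkyCoupling N U κ ((Γ t).op (k + 1)) := by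
    intro t ht k hk1 hk
    rw [op_bbgkyField hU κ (Γ t) hk1 hk.le, I_smul_bbgkyOp_of_lt hU he κ hk]
    exact fun h => hΓ t ht k (by omega) hk
  have htop : ∀ t ∈ I, Complex.I • (bbgkyField hU κ N (Γ t)).op N =
      bbgkyInternal N U κ ((Γ t).op N) := by
    intro t _
    rw [op_bbgkyField hU κ (Γ t) (by omega) le_rfl, I_smul_bbgkyOp_top hU he κ]
  constructor
  · intro h t ht
    obtain ⟨v, hv, h1, h2⟩ := h t ht
    have hval : v = bbgkyField hU κ N (Γ t) := by
      funext k
      refine Subtype.ext (SmoothOp.toOp_injective ?_)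
      rw [← op_coe, ← op_coe]
      have hk := Finset.mem_Icc.1 k.2
      have hI : Complex.I • v.op k = Complex.I • (bbgkyField hU κ N (Γ t)).op k := by
        obtain ⟨k, hk'⟩ := k
        rcases hk.2.lt_or_eq with hlt' | heq
        · exact (h1 k hk.1 hlt').trans (hlt t ht k hk.1 hlt').symm
        · simp only at heq
          subst heq
          exact h2.trans (htop t ht).symm
      have hI' := congrArg (fun T : SmoothOp d k => (-Complex.I) • T) hI
      simpa [smul_smul] using hI'
    rwa [← hval]
  · exact fun h t ht => ⟨_, h t ht, hlt t ht, htop t ht⟩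

end VectorField

/-! ### Regularity and evenness of the rescaled potential -/

section ScaledPotential

variable {d : ℕ} {V : EuclideanSpace ℝ (Fin d) → ℝ}

theorem hasTemperateGrowth_scaledPotential (hV : ContDiff ℝ ∞ V) (hc : HasCompactSupport V) (β : ℝ)
    {N : ℕ} (hN : N ≠ 0) : (scaledPotential V β N).HasTemperateGrowth := by
  have h0 : (N : ℝ) ^ ((d : ℝ) * β) ≠ 0 :=
    (Real.rpow_pos_of_pos (Nat.cast_pos.2 (Nat.pos_of_ne_zero hN)) _).ne'
  refine HasCompactSupport.hasTemperateGrowth ?_ ?_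
  · exact (hc.comp_smul h0).mul_left
  · exact contDiff_const.mul (hV.comp (contDiff_const_smul _))

theorem scaledPotential_neg (hV : ∀ x, V (-x) = V x) (β : ℝ) (N : ℕ)
    (x : EuclideanSpace ℝ (Fin d)) : scaledPotential V β N (-x) = scaledPotential V β N x := by
  rw [scaledPotential, scaledPotential, smul_neg, hV]

end ScaledPotential

end

theorem theorem2p1 (d N : ℕ) (hd : 1 ≤ d) (hN : 2 ≤ N)
    (V : EuclideanSpace ℝ (Fin d) → ℝ) (hVsmooth : ContDiff ℝ ∞ V) (hVsupp : HasCompactSupport V)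
    (hVeven : ∀ x, V (-x) = V x) (hVnonneg : ∀ x, 0 ≤ V x) (hVint : ∫ x, V x = 1)
    (β : ℝ) (hβ0 : 0 < β) (hβ1 : β < 1) (κ : ℝ) (hκ : κ = 1 ∨ κ = -1)
    (H : DMHier d N → ℝ) (hH : H = bbgkyHamiltonian (scaledPotential V β N) κ) :
    (∀ Γ : DMHier d N, ((H Γ : ℝ) : ℂ) = bbgkyTrace (scaledPotential V β N) κ Γ) ∧
    H ∈ admissible d N ∧
    (∃! X : DMHier d N → DMHier d N, IsHamiltonianVectorField H X) ∧
    ∀ X : DMHier d N → DMHier d N, IsHamiltonianVectorField H X →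
      ∀ (a b : ℝ), a < b → ∀ Γ : ℝ → DMHier d N, SmoothCurveOn (Set.Icc a b) Γ →
        (∀ t ∈ Set.Icc a b, IsReducedHierarchy (Γ t)) →
        (SolvesBBGKY (Set.Icc a b) (scaledPotential V β N) κ Γ ↔
          ∀ t ∈ Set.Icc a b, HasCurveDerivAt (Set.Icc a b) Γ (X (Γ t)) t) := by
  have hU := hasTemperateGrowth_scaledPotential hVsmooth hVsupp β (N := N) (by omega)
  have he := scaledPotential_neg hVeven β N
  subst hH
  have hX := isHamiltonianVectorField_bbgkyField (d := d) hU he κ hN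
  refine ⟨fun Γ => Complex.ext rfl ?_, bbgkyHamiltonian_mem hU κ,
    ⟨_, hX, fun Y hY => hY.unique hX⟩, fun X hX' a b _ Γ _ hΓ => ?_⟩
  · rw [Complex.ofReal_im, bbgkyTrace_im hU]
  -- By uniqueness any Hamiltonian vector field is the explicit one.
  · rw [hX'.unique hX]
    exact solvesBBGKY_iff hU he κ hN hΓ
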